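/- Let $\mathbf{Spc}$ be a full subcategory of the category of topological spaces that is complete, cocomplete and cartesian closed and contains the standard simplices $\Delta^n$ (for example, compactly generated Hausdorff spaces, or $k$-spaces). Products, mapping spaces, (co)limits, ends and coends of spaces are formed in $\mathbf{Spc}$. For a small $\mathbf{Spc}$-enriched category $C$ let $C^*$ be the $\mathbf{Spc}$-category of continuous (that is, $\mathbf{Spc}$-enriched) functors $C\to\mathbf{Spc}$, with mapping spaces $\operatorname{map}_{C^*}(F,G)=\int_{c}\operatorname{map}(F(c),G(c))$. For a continuous functor $J\colon C\to D$ and $F\in C^*$ let $\operatorname{LKan}_JF=\int^{c\in C}\operatorname{map}_D(J(c),-)\times F(c)\in D^*$, and for $F_1,\dots,F_n\in C^*$ let $\widetilde\prod_iF_i\in(C^n)^*$ be the external product $(c_1,\dots,c_n)\mapsto\prod_iF_i(c_i)$. Both constructions are continuous in the functors $F$, $F_i$. An operad is a non-symmetric operad $A$ in $\mathbf{Spc}$: spaces $A(n)$, $n\ge 0$, a base point $\iota\in A(1)$ and compositions $A(n)\times A(k_1)\times\dots\times A(k_n)\to A(k_1+\dots+k_n)$, associative and with unit $\iota$. For a finite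 ordered set $S$ put $A(S)=A(\#S)$. Fix an operad $A$. Let $D_+$ be its category of operators: the objects are the finite ordinals $S$ (including $\emptyset$), the morphism spaces are $$\operatorname{map}_{D_+}(S,T)=\coprod_{\varphi\colon S\to T\text{ monotone}}\ \prod_{t\in T}A(\varphi^{-1}t),$$ and composition is given by the operad composition over the fibres. Let $D\subseteq D_+$ be the full subcategory of the nonempty ordinals. Let $ED\in D^*$ be the geometric realization $ED(c)=\int^{[n]\in\Delta}\Delta^n\times\mathcal E_nD(c)$ of the simplicial bar construction $$\mathcal E_nD(c)=\coprod_{c_0,\dots,c_n\in D}\operatorname{map}_D(c_0,c)\times\prod_{i=0}^{n-1}\operatorname{map}_D(c_{i+1},c_i),$$ and let $\widetilde{ED}\in D_+^*$ be its extension by $\widetilde{ED}(\emptyset)=\emptyset$. Let $u(n)\colon D_+^n\to D_+$ be the ordinal sum functor $(V_1,\dots,V_n)\mapsto V_1\sqcup\dots\sqcup V_n$, and define $$\epsilon(n)=\operatorname{LKan}_{u(n)}\Bigl(\widetilde{\prod_{1\le i\le n}}\widetilde{ED}\Bigr)\in D_+^*,\qquad \tilde A(n)=\operatorname{map}_{D_+^*}(\widetilde{ED},\epsilon(n)).$$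 Theorem. (a) The canonical maps $\widetilde{ED}(c)\to\epsilon(1)(c)$, $x\mapsto[x,\mathrm{id}_c]$, form an isomorphism $i\colon\widetilde{ED}\cong\epsilon(1)$ of continuous functors. (b) For all $n\ge0$ and $k_1,\dots,k_n\ge 0$, there is an isomorphism of continuous functors $$\kappa\colon\operatorname{LKan}_{u(n)}\Bigl(\widetilde{\prod_{i}}\,\epsilon(k_i)\Bigr)\cong\epsilon(k_1+\dots+k_n),$$ which is compatible with the canonical maps from $\prod_{i,j}\widetilde{ED}(U_{ij})\times\operatorname{map}_{D_+}(\bigsqcup_{i,j}U_{ij},d)$ to both sides at $d$; on the left-hand side the canonical map is $((x_{ij}),g)\mapsto\bigl[\bigl([(x_{ij})_j,\mathrm{id}_{\bigsqcup_jU_{ij}}]\bigr)_i,\,g\bigr]$. (c) The spaces $\tilde A(n)$, $n\ge 0$, with the base point of $\tilde A(1)$ given by $i$ and with the compositions $$\tilde A(n)\times\tilde A(k_1)\times\dots\times\tilde A(k_n)\to\tilde A(k_1+\dots+k_n),\qquad (f,(g_i))\mapsto\kappa\circ\operatorname{LKan}_{u(n)}\Bigl(\widetilde{\prod_{i}}\,g_i\Bigr)\circ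 f,$$ form an operad, the extended operad associated to $A$. -/

import Mathlib

open CategoryTheory MonoidalCategory CartesianMonoidalCategory Limits MonoidalClosed

set_option linter.unusedSectionVars false
set_option linter.unusedSimpArgs false

universe u

namespace ExtendedOperad

/-! ### Finite ordinals, fibres of monotone maps, ordinal sums -/

/-- The number of elements of the fibre `φ⁻¹ t`. -/
def fib {a b : ℕ} (φ : Fin a →o Fin b) (t : Fin b) : ℕ :=
  (Finset.univ.filter fun s => φ s = t).card

/-- The order preserving enumeration of the fibre `φ⁻¹ t`. -/
def fibEnum {a b : ℕ} (φ : Fin a →o Fin b) (t : Fin b) : Fin (fib φ t) ↪o Fin a :=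
  Finset.orderEmbOfFin (Finset.univ.filter fun s => φ s = t) rfl

theorem fibEnum_mem {a b : ℕ} (φ : Fin a →o Fin b) (t : Fin b) (i : Fin (fib φ t)) :
    φ (fibEnum φ t i) = t := by
  have h := Finset.orderEmbOfFin_mem (Finset.univ.filter fun s => φ s = t) rfl i
  exact (Finset.mem_filter.1 h).2

theorem range_fibEnum {a b : ℕ} (φ : Fin a →o Fin b) (t : Fin b) :
    Set.range (fibEnum φ t) = {s | φ s = t} := by
  have h := Finset.range_orderEmbOfFin (Finset.univ.filter fun s => φ s = t) rfl
  refine Eq.trans h ?_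
  ext x
  simp

theorem fib_card_sum {a b : ℕ} (φ : Fin a →o Fin b) (s : Finset (Fin b)) :
    ∑ t ∈ s, fib φ t = (Finset.univ.filter fun x => φ x ∈ s).card := by
  rw [Finset.card_eq_sum_card_fiberwise (f := φ) (t := s) (by intro x; simp)]
  refine Finset.sum_congr rfl fun t ht => ?_
  unfold fib
  congr 1
  ext x
  simp only [Finset.mem_filter, Finset.mem_univ, true_and]
  exact ⟨fun h => ⟨h ▸ ht, h⟩, fun h => h.2⟩

theorem sum_fib {a b c : ℕ} (φ : Fin a →o Fin b) (ψ : Fin b →o Fin c) (w : Fin c) :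
    ∑ i : Fin (fib ψ w), fib φ (fibEnum ψ w i) = fib (ψ.comp φ) w := by
  have h : ∑ i : Fin (fib ψ w), fib φ (fibEnum ψ w i) =
      ∑ t ∈ Finset.univ.filter (fun t => ψ t = w), fib φ t := by
    refine (Finset.sum_map Finset.univ (fibEnum ψ w).toEmbedding (fib φ)).symm.trans ?_
    refine Finset.sum_congr ?_ fun _ _ => rfl
    ext x
    have := Set.ext_iff.1 (range_fibEnum ψ w) x
    simpa using this
  rw [h, fib_card_sum]
  unfold fib
  congr 1
  ext x
  simp

/-- The sigma-equivalence `(i, j) ↦ k₀ + ... + k_{i-1} + j` is lexicographic. -/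
theorem sigma_lt {n : ℕ} {k : Fin n → ℕ} {i i' : Fin n} {j : Fin (k i)} {j' : Fin (k i')}
    (h : i < i') :
    (finSigmaFinEquiv ⟨i, j⟩ : Fin (∑ i, k i)) < finSigmaFinEquiv ⟨i', j'⟩ := by
  rw [Fin.lt_def, finSigmaFinEquiv_apply, finSigmaFinEquiv_apply]
  have key : ∀ (m : ℕ) (hm : m ≤ n), ∑ l : Fin m, k (Fin.castLE hm l) =
      ∑ l ∈ Finset.univ.filter (fun l : Fin n => l.1 < m), k l := by
    intro m hm
    refine (Finset.sum_map Finset.univ (Fin.castLEEmb hm) k).symm.trans ?_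
    refine Finset.sum_congr ?_ fun _ _ => rfl
    ext x
    simp only [Finset.mem_map, Finset.mem_univ, true_and, Finset.mem_filter]
    constructor
    · rintro ⟨y, rfl⟩
      exact y.2
    · intro hx
      exact ⟨⟨x, hx⟩, rfl⟩
  dsimp only
  rw [key, key]
  have h1 : ∑ l ∈ insert i (Finset.univ.filter (fun l : Fin n => l.1 < i.1)), k l ≤
      ∑ l ∈ Finset.univ.filter (fun l : Fin n => l.1 < i'.1), k l := by
    apply Finset.sum_le_sum_of_subset
    intro x hx
    simp only [Finset.mem_insert, Finset.mem_filter, Finset.mem_univ, true_and] at hx ⊢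
    rcases hx with rfl | hx
    · exact h
    · exact lt_trans hx h
  rw [Finset.sum_insert (by simp)] at h1
  have := j.2
  omega

theorem sigma_lt' {n : ℕ} {k : Fin n → ℕ} {i : Fin n} {j j' : Fin (k i)} (h : j < j') :
    (finSigmaFinEquiv ⟨i, j⟩ : Fin (∑ i, k i)) < finSigmaFinEquiv ⟨i, j'⟩ := by
  rw [Fin.lt_def, finSigmaFinEquiv_apply, finSigmaFinEquiv_apply]
  dsimp only
  have : j.1 < j'.1 := h
  omega

/-- The pair `(i, j)` that corresponds to a position in an ordinal sum. -/
abbrev pos {n : ℕ} {k : Fin n → ℕ} (p : Fin (∑ i, k i)) : (i : Fin n) × Fin (k i) :=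
  finSigmaFinEquiv.symm p

theorem sum_pos {n : ℕ} {k : Fin n → ℕ} (l : ∀ i, Fin (k i) → ℕ) :
    ∑ i, ∑ j, l i j = ∑ p : Fin (∑ i, k i), l (pos p).1 (pos p).2 := by
  refine (Fintype.sum_sigma fun q : (i : Fin n) × Fin (k i) => l q.1 q.2).symm.trans ?_
  exact (Equiv.sum_comp (finSigmaFinEquiv (n := k)).symm (fun q => l q.1 q.2)).symm

theorem strictMono_of_sigma {n : ℕ} {k : Fin n → ℕ} {α : Type} [Preorder α]
    (f : (i : Fin n) × Fin (k i) → α)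
    (h1 : ∀ i i' j j', i < i' → f ⟨i, j⟩ < f ⟨i', j'⟩) (h2 : ∀ i j j', j < j' → f ⟨i, j⟩ < f ⟨i, j'⟩) :
    StrictMono fun p : Fin (∑ i, k i) => f (pos p) := by
  intro p q hpq
  obtain ⟨⟨i, j⟩, rfl⟩ := finSigmaFinEquiv.surjective p
  obtain ⟨⟨i', j'⟩, rfl⟩ := finSigmaFinEquiv.surjective q
  simp only [pos, Equiv.symm_apply_apply]
  rcases lt_trichotomy i i' with h | h | h
  · exact h1 _ _ _ _ h
  · subst h
    rcases lt_trichotomy j j' with h | h | h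
    · exact h2 _ _ _ h
    · subst h
      exact absurd hpq (lt_irrefl _)
    · exact absurd hpq (sigma_lt' h).asymm
  · exact absurd hpq (sigma_lt h).asymm

theorem fibEnum_comp {b c d : ℕ} (ψ : Fin b →o Fin c) (θ : Fin c →o Fin d) (r : Fin d)
    (p : Fin (∑ i : Fin (fib θ r), fib ψ (fibEnum θ r i))) :
    fibEnum (θ.comp ψ) r (Fin.cast (sum_fib ψ θ r) p) =
      fibEnum ψ (fibEnum θ r (pos p).1) (pos p).2 := by
  have hs := strictMono_of_sigma (k := fun i : Fin (fib θ r) => fib ψ (fibEnum θ r i))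
    (fun q => fibEnum ψ (fibEnum θ r q.1) q.2) (by
      intro i i' j j' h
      by_contra hn
      have := ψ.monotone (not_lt.1 hn)
      rw [fibEnum_mem, fibEnum_mem] at this
      exact absurd ((fibEnum θ r).lt_iff_lt.2 h) (not_lt.2 this)) (by
      intro i j j' h
      exact (fibEnum ψ _).lt_iff_lt.2 h)
  have hu := Finset.orderEmbOfFin_unique (s := Finset.univ.filter fun s => (θ.comp ψ) s = r) rfl
    (f := fun x => fibEnum ψ (fibEnum θ r (pos (Fin.cast (sum_fib ψ θ r).symm x)).1)
      (pos (Fin.cast (sum_fib ψ θ r).symm x)).2) (by intro x; simp [fibEnum_mem])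
      (by intro x y h; exact hs (show Fin.cast _ x < Fin.cast _ y from h))
  have := congrFun hu (Fin.cast (sum_fib ψ θ r) p)
  exact this.symm

/-- Auxiliary definition for `sumMap`. -/
def sumFun {n : ℕ} {V W : Fin n → ℕ} (φ : ∀ i, Fin (V i) →o Fin (W i))
    (q : (i : Fin n) × Fin (V i)) : Fin (∑ i, W i) :=
  finSigmaFinEquiv ⟨q.1, φ q.1 q.2⟩

/-- The ordinal sum of monotone maps, `(i, j) ↦ (i, φ i j)`. -/
def sumMap {n : ℕ} {V W : Fin n → ℕ} (φ : ∀ i, Fin (V i) →o Fin (W i)) :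
    Fin (∑ i, V i) →o Fin (∑ i, W i) where
  toFun p := sumFun φ (pos p)
  monotone' := by
    intro p q hpq
    obtain ⟨⟨i, j⟩, rfl⟩ := finSigmaFinEquiv.surjective p
    obtain ⟨⟨i', j'⟩, rfl⟩ := finSigmaFinEquiv.surjective q
    change sumFun φ (finSigmaFinEquiv.symm _) ≤ sumFun φ (finSigmaFinEquiv.symm _)
    rw [Equiv.symm_apply_apply, Equiv.symm_apply_apply]
    rcases lt_trichotomy i i' with h | h | h
    · exact (sigma_lt h).le
    · subst h
      have hj : j ≤ j' := by
        by_contra hn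
        exact absurd hpq (not_le.2 (sigma_lt' (not_le.1 hn)))
      rcases ((φ i).monotone hj).lt_or_eq with h | h
      · exact (sigma_lt' h).le
      · exact (congrArg (fun t => (finSigmaFinEquiv ⟨i, t⟩ : Fin (∑ i, W i))) h).le
    · exact absurd hpq (not_le.2 (sigma_lt h))

theorem sumMap_apply {n : ℕ} {V W : Fin n → ℕ} (φ : ∀ i, Fin (V i) →o Fin (W i)) (i : Fin n)
    (j : Fin (V i)) : sumMap φ (finSigmaFinEquiv ⟨i, j⟩) = finSigmaFinEquiv ⟨i, φ i j⟩ :=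
  congrArg (sumFun φ) (Equiv.symm_apply_apply _ _)

theorem sumMap_id {n : ℕ} (V : Fin n → ℕ) :
    sumMap (fun i => (OrderHom.id : Fin (V i) →o Fin (V i))) = OrderHom.id := by
  refine OrderHom.ext _ _ (funext fun p => ?_)
  obtain ⟨⟨i, j⟩, rfl⟩ := finSigmaFinEquiv.surjective p
  rw [sumMap_apply]
  rfl

theorem sumMap_comp {n : ℕ} {U V W : Fin n → ℕ} (φ : ∀ i, Fin (U i) →o Fin (V i))
    (ψ : ∀ i, Fin (V i) →o Fin (W i)) :
    sumMap (fun i => (ψ i).comp (φ i)) = (sumMap ψ).comp (sumMap φ) := by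
  refine OrderHom.ext _ _ (funext fun p => ?_)
  obtain ⟨⟨i, j⟩, rfl⟩ := finSigmaFinEquiv.surjective p
  change _ = sumMap ψ (sumMap φ _)
  rw [sumMap_apply, sumMap_apply, sumMap_apply]
  rfl

theorem fib_sumMap {n : ℕ} {V W : Fin n → ℕ} (φ : ∀ i, Fin (V i) →o Fin (W i))
    (p : Fin (∑ i, W i)) : fib (φ (pos p).1) (pos p).2 = fib (sumMap φ) p := by
  obtain ⟨⟨i, t⟩, rfl⟩ := finSigmaFinEquiv.surjective p
  refine (congrArg (fun q : (i : Fin n) × Fin (W i) => fib (φ q.1) q.2)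
    (Equiv.symm_apply_apply _ (⟨i, t⟩ : (i : Fin n) × Fin (W i)))).trans ?_
  dsimp only
  unfold fib
  rw [← Finset.card_map ((Function.Embedding.sigmaMk i).trans
    (finSigmaFinEquiv (n := V)).toEmbedding)]
  congr 1
  ext q
  obtain ⟨⟨i', j'⟩, rfl⟩ := finSigmaFinEquiv.surjective q
  simp only [Finset.mem_map, Finset.mem_filter, Finset.mem_univ, true_and, sumMap_apply,
    EmbeddingLike.apply_eq_iff_eq]
  constructor
  · rintro ⟨j, rfl, h⟩
    have h' : (⟨i, j⟩ : (i : Fin n) × Fin (V i)) = ⟨i', j'⟩ := finSigmaFinEquiv.injective h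
    cases h'
    rfl
  · intro h
    obtain ⟨rfl, h⟩ := Sigma.mk.inj h
    exact ⟨j', eq_of_heq h, rfl⟩

theorem fibEnum_sumMap {n : ℕ} {V W : Fin n → ℕ} (φ : ∀ i, Fin (V i) →o Fin (W i))
    (p : Fin (∑ i, W i)) (l : Fin (fib (φ (pos p).1) (pos p).2)) :
    fibEnum (sumMap φ) p (Fin.cast (fib_sumMap φ p) l) =
      finSigmaFinEquiv ⟨(pos p).1, fibEnum (φ (pos p).1) (pos p).2 l⟩ := by
  have hu := Finset.orderEmbOfFin_unique (s := Finset.univ.filter fun s => sumMap φ s = p) rfl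
    (f := fun x => finSigmaFinEquiv ⟨(pos p).1,
      fibEnum (φ (pos p).1) (pos p).2 (Fin.cast (fib_sumMap φ p).symm x)⟩) (by
        intro x
        simp [sumMap_apply, fibEnum_mem, pos])
      (by
        intro x y h
        refine sigma_lt' ((fibEnum _ _).lt_iff_lt.2 ?_)
        exact h)
  exact (congrFun hu (Fin.cast (fib_sumMap φ p) l)).symm

theorem fib_id {a : ℕ} (t : Fin a) : fib (OrderHom.id : Fin a →o Fin a) t = 1 := by
  simp [fib, Finset.filter_eq']

theorem fibEnum_id {a : ℕ} (t : Fin a) (i : Fin (fib (OrderHom.id : Fin a →o Fin a) t)) :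
    fibEnum (OrderHom.id : Fin a →o Fin a) t i = t := by
  simpa using fibEnum_mem (OrderHom.id : Fin a →o Fin a) t i

universe v₁ u₁

noncomputable section

variable {V : Type u₁} [Category.{v₁} V] [CartesianMonoidalCategory V]

/-! ### Non-symmetric operads -/

section Operads

variable [HasLimitsOfSize.{0, 0} V]

/-- A (non-symmetric) operad structure on a sequence of spaces `X 0, X 1, ...`: a base point
`ι ∈ X 1` and compositions `X n × (X k₁ × ... × X kₙ) ⟶ X (k₁ + ... + kₙ)`, subject to the unit and
associativity laws, which are written in terms of (generalized) elements
`x : W ⟶ X n`, `y i : W ⟶ X (k i)`, `z i j : W ⟶ X (l i j)`. -/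
structure Operad (X : ℕ → V) where
  /-- the unit -/
  unit : 𝟙_ V ⟶ X 1
  /-- the composition -/
  comp (n : ℕ) (k : Fin n → ℕ) : X n ⊗ (∏ᶜ fun i => X (k i)) ⟶ X (∑ i, k i)
  unit_comp {W : V} (m : ℕ) (x : W ⟶ X m) :
    lift (toUnit W ≫ unit) (Pi.lift fun _ : Fin 1 => x) ≫ comp 1 (fun _ => m) =
      x ≫ eqToHom (congrArg X (by simp))
  comp_unit {W : V} (n : ℕ) (x : W ⟶ X n) :
    lift x (Pi.lift fun _ : Fin n => toUnit W ≫ unit) ≫ comp n (fun _ => 1) =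
      x ≫ eqToHom (congrArg X (by simp))
  assoc {W : V} (n : ℕ) (k : Fin n → ℕ) (l : ∀ i, Fin (k i) → ℕ) (x : W ⟶ X n)
    (y : ∀ i, W ⟶ X (k i)) (z : ∀ i j, W ⟶ X (l i j)) :
    lift (lift x (Pi.lift y) ≫ comp n k)
        (Pi.lift fun p : Fin (∑ i, k i) => z (pos p).1 (pos p).2) ≫
      comp (∑ i, k i) (fun p => l (pos p).1 (pos p).2) =
    lift x (Pi.lift fun i => lift (y i) (Pi.lift (z i)) ≫ comp (k i) (l i)) ≫
      comp n (fun i => ∑ j, l i j) ≫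
      eqToHom (congrArg X (sum_pos l))

variable {X : ℕ → V} (A : Operad X)

/-- Composition of elements, with values in a prescribed space `X m`, where `m = ∑ i, k i`. -/
def Operad.mul {n : ℕ} {k : Fin n → ℕ} {m : ℕ} (h : ∑ i, k i = m) {W : V} (x : W ⟶ X n)
    (y : ∀ i, W ⟶ X (k i)) : W ⟶ X m :=
  lift x (Pi.lift y) ≫ A.comp n k ≫ eqToHom (congrArg X h)

theorem Operad.comp_mul {n : ℕ} {k : Fin n → ℕ} {m : ℕ} (h : ∑ i, k i = m) {W' W : V}
    (f : W' ⟶ W) (x : W ⟶ X n) (y : ∀ i, W ⟶ X (k i)) :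
    f ≫ A.mul h x y = A.mul h (f ≫ x) (fun i => f ≫ y i) := by
  have : f ≫ Pi.lift y = Pi.lift fun i => f ≫ y i := by
    apply Pi.hom_ext
    intro i
    simp
  simp [Operad.mul, ← this, comp_lift_assoc]

/-- An element of some `X m`, with `m` remembered; a device to handle identifications
`X m = X m'`. -/
abbrev Elt (X : ℕ → V) (W : V) := Σ m : ℕ, (W ⟶ X m)

/-- The composition on elements. -/
def Operad.mulE {W : V} (x : Elt X W) (y : Fin x.1 → Elt X W) : Elt X W :=
  ⟨∑ i, (y i).1, lift x.2 (Pi.lift fun i => (y i).2) ≫ A.comp x.1 fun i => (y i).1⟩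

theorem elt_cast {W : V} {m m' : ℕ} (h : m = m') (x : W ⟶ X m) :
    (⟨m', x ≫ eqToHom (congrArg X h)⟩ : Elt X W) = ⟨m, x⟩ := by
  subst h
  simp

theorem elt_inj {W : V} {m : ℕ} {x y : W ⟶ X m} (h : (⟨m, x⟩ : Elt X W) = ⟨m, y⟩) : x = y :=
  eq_of_heq (Sigma.mk.inj h).2

theorem Operad.mul_elt {n : ℕ} {k : Fin n → ℕ} {m : ℕ} (h : ∑ i, k i = m) {W : V} (x : W ⟶ X n)
    (y : ∀ i, W ⟶ X (k i)) :
    (⟨m, A.mul h x y⟩ : Elt X W) = A.mulE ⟨n, x⟩ fun i => ⟨k i, y i⟩ := by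
  subst h
  simp [Operad.mul, Operad.mulE]

theorem Operad.mulE_congr {W : V} {x x' : Elt X W} (h : x = x') {y : Fin x.1 → Elt X W}
    {y' : Fin x'.1 → Elt X W} (hy : ∀ i, y i = y' (Fin.cast (congrArg Sigma.fst h) i)) :
    A.mulE x y = A.mulE x' y' := by
  subst h
  have : y = y' := funext hy
  rw [this]

theorem Operad.mulE_assoc {W : V} (x : Elt X W) (y : Fin x.1 → Elt X W)
    (z : ∀ i, Fin (y i).1 → Elt X W) :
    A.mulE (A.mulE x y) (fun p => z (pos p).1 (pos p).2) =
      A.mulE x fun i => A.mulE (y i) (z i) := by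
  have h := A.assoc x.1 (fun i => (y i).1) (fun i j => (z i j).1) x.2 (fun i => (y i).2)
    (fun i j => (z i j).2)
  unfold Operad.mulE
  dsimp only
  rw [h, ← Category.assoc]
  exact elt_cast (sum_pos fun i j => (z i j).1) _

theorem Operad.unit_mulE {W : V} (x : Elt X W) :
    A.mulE ⟨1, toUnit W ≫ A.unit⟩ (fun _ => x) = x := by
  have h := A.unit_comp x.1 x.2
  unfold Operad.mulE
  dsimp only
  rw [h]
  exact elt_cast (by simp) _

theorem Operad.mulE_unit {W : V} (x : Elt X W) :
    A.mulE x (fun _ => ⟨1, toUnit W ≫ A.unit⟩) = x := by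
  have h := A.comp_unit x.1 x.2
  unfold Operad.mulE
  dsimp only
  rw [h]
  exact elt_cast (by simp) _

end Operads

/-! ### Maps out of products of coproducts -/

section Distributive

/-- The symmetry of the cartesian product. -/
def swap (X Y : V) : X ⊗ Y ⟶ Y ⊗ X := lift (snd X Y) (fst X Y)

theorem lift_swap {W X Y : V} (f : W ⟶ X) (g : W ⟶ Y) : lift f g ≫ swap X Y = lift g f := by
  simp [swap]

theorem lift_assoc_aux {P Q R S T : V} (m : P ⊗ Q ⟶ S) (m' : S ⊗ R ⟶ T) :
    (α_ P Q R).inv ≫ m ▷ R ≫ m' =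
      lift (lift (fst _ _) (snd _ _ ≫ fst _ _) ≫ m) (snd _ _ ≫ snd _ _) ≫ m' := by
  have : (α_ P Q R).inv = lift (lift (fst _ _) (snd _ _ ≫ fst _ _)) (snd _ _ ≫ snd _ _) := by
    ext <;> simp
  rw [this]
  simp

variable [MonoidalClosed V]

/-- Currying of the second variable. -/
def rcurry {X Y Z : V} (f : X ⊗ Y ⟶ Z) : X ⟶ (ihom Y).obj Z := curry (swap Y X ≫ f)

/-- Inverse of `rcurry`. -/
def runcurry {X Y Z : V} (f : X ⟶ (ihom Y).obj Z) : X ⊗ Y ⟶ Z := swap X Y ≫ uncurry f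

theorem runcurry_rcurry {X Y Z : V} (f : X ⊗ Y ⟶ Z) : runcurry (rcurry f) = f := by
  have : swap X Y ≫ swap Y X = 𝟙 _ := by ext <;> simp [swap]
  rw [runcurry, rcurry, uncurry_curry, ← Category.assoc, this, Category.id_comp]

theorem lift_runcurry {W X X' Y Z : V} (p : W ⟶ X) (q : W ⟶ Y) (g : X ⟶ X')
    (f : X' ⟶ (ihom Y).obj Z) : lift p q ≫ runcurry (g ≫ f) = lift (p ≫ g) q ≫ runcurry f := by
  simp [runcurry, uncurry_natural_left, swap, comp_lift_assoc]

theorem rcurry_injective {X Y Z : V} {f g : X ⊗ Y ⟶ Z} (h : rcurry f = rcurry g) : f = g := by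
  rw [← runcurry_rcurry f, h, runcurry_rcurry]

theorem rcurry_natural {X X' Y Z : V} (g : X' ⟶ X) (f : X ⊗ Y ⟶ Z) :
    g ≫ rcurry f = rcurry (lift (fst _ _ ≫ g) (snd _ _) ≫ f) := by
  rw [rcurry, rcurry, ← curry_natural_left]
  congr 1
  rw [← Category.assoc, ← Category.assoc]
  congr 1
  ext <;> simp [swap]


/-- A jointly epimorphic family. -/
def JointEpi {J : Type} {P : J → V} {Y : V} (ι : ∀ j, P j ⟶ Y) : Prop :=
  ∀ ⦃Z : V⦄ (f g : Y ⟶ Z), (∀ j, ι j ≫ f = ι j ≫ g) → f = g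

theorem JointEpi.tensor {J : Type} {P : J → V} {Y : V} {ι : ∀ j, P j ⟶ Y} (h : JointEpi ι)
    {W Z : V} {f g : Y ⊗ W ⟶ Z}
    (hfg : ∀ j, lift (fst (P j) W ≫ ι j) (snd _ _) ≫ f = lift (fst (P j) W ≫ ι j) (snd _ _) ≫ g) :
    f = g := by
  apply rcurry_injective
  apply h
  intro j
  rw [rcurry_natural, rcurry_natural, hfg]

/-- Prepending a factor to a finite product. -/
def piCons [HasLimitsOfSize.{0, 0} V] {n : ℕ} (Q : Fin (n + 1) → V) :
    Q 0 ⊗ (∏ᶜ fun i : Fin n => Q i.succ) ⟶ ∏ᶜ Q :=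
  Pi.lift (Fin.cases (fst _ _) (fun i => snd _ _ ≫ Pi.π (fun i : Fin n => Q i.succ) i))

/-- Splitting off the first factor of a finite product. -/
def piUncons [HasLimitsOfSize.{0, 0} V] {n : ℕ} (Q : Fin (n + 1) → V) :
    (∏ᶜ Q) ⟶ Q 0 ⊗ (∏ᶜ fun i : Fin n => Q i.succ) :=
  lift (Pi.π Q 0) (Pi.lift fun i => Pi.π Q i.succ)

theorem piUncons_piCons [HasLimitsOfSize.{0, 0} V] {n : ℕ} (Q : Fin (n + 1) → V) :
    piUncons Q ≫ piCons Q = 𝟙 _ := by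
  apply Pi.hom_ext
  intro i
  refine Fin.cases ?_ (fun i => ?_) i <;> simp [piUncons, piCons]

theorem piUncons_lift_piCons [HasLimitsOfSize.{0, 0} V] {n : ℕ} (Q : Fin (n + 1) → V) {Z : V}
    (f : (∏ᶜ Q) ⟶ Z) : piUncons Q ≫ lift (fst _ _) (snd _ _) ≫ piCons Q ≫ f = f := by
  rw [lift_fst_snd, Category.id_comp, reassoc_of% piUncons_piCons]

theorem piCons_piUncons [HasLimitsOfSize.{0, 0} V] {n : ℕ} (Q : Fin (n + 1) → V) :
    piCons Q ≫ piUncons Q = 𝟙 _ := by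
  apply CartesianMonoidalCategory.hom_ext
  · simp [piUncons, piCons]
  · simp only [piUncons, piCons, Category.assoc, lift_snd, Category.id_comp]
    apply Pi.hom_ext
    intro i
    simp

theorem piUncons_natural [HasLimitsOfSize.{0, 0} V] {n : ℕ} {Q R : Fin (n + 1) → V}
    (f : ∀ i, Q i ⟶ R i) :
    Limits.Pi.map f ≫ piUncons R =
      piUncons Q ≫ lift (fst _ _ ≫ f 0) (snd _ _ ≫ Limits.Pi.map fun i : Fin n => f i.succ) := by
  apply CartesianMonoidalCategory.hom_ext
  · simp [piUncons]
  · simp only [piUncons, Category.assoc, lift_snd, lift_snd_assoc]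
    apply Pi.hom_ext
    intro i
    simp

theorem JointEpi.pi [HasLimitsOfSize.{0, 0} V] {n : ℕ} {J : Fin n → Type}
    {P : ∀ i, J i → V} {Y : Fin n → V} {ι : ∀ i j, P i j ⟶ Y i} (h : ∀ i, JointEpi (ι i)) :
    JointEpi (fun j : ∀ i, J i => Limits.Pi.map fun i => ι i (j i)) := by
  induction n with
  | zero =>
    intro Z f g hfg
    have := hfg (fun i => i.elim0)
    have e : ∀ (f : (∏ᶜ Y) ⟶ Z), f = (Pi.lift fun i => i.elim0) ≫
        (Limits.Pi.map fun i : Fin 0 => ι i (i.elim0)) ≫ f := by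
      intro f
      rw [← Category.assoc]
      refine (Category.id_comp f).symm.trans (congrArg (· ≫ f) ?_)
      apply Pi.hom_ext
      intro i
      exact i.elim0
    rw [e f, e g, this]
  | succ n ih =>
    intro Z f g hfg
    have key : piCons Y ≫ f = piCons Y ≫ g := by
      apply (h 0).tensor
      intro j0
      apply curry_injective
      apply ih (fun i => h i.succ)
      intro jt
      rw [← curry_natural_left, ← curry_natural_left]
      congr 1
      have e := hfg (Fin.cons j0 jt)
      have e2 : piCons (fun i => P i (Fin.cons (α := J) j0 jt i)) ≫
          (Limits.Pi.map fun i => ι i (Fin.cons (α := J) j0 jt i)) =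
          (P 0 j0 ◁ Limits.Pi.map fun i : Fin n => ι i.succ (jt i)) ≫
            lift (fst _ _ ≫ ι 0 j0) (snd _ _) ≫ piCons Y := by
        rw [← Category.comp_id (Limits.Pi.map _), ← piUncons_piCons, reassoc_of% piUncons_natural,
          reassoc_of% piCons_piUncons]
        simp only [← Category.assoc]
        congr 1
        apply CartesianMonoidalCategory.hom_ext
        · simp
          exact (tensorHom_fst _ _).symm
        · simp
          exact (tensorHom_snd _ _).symm
      have e3 : ∀ f : (∏ᶜ Y) ⟶ Z, (P 0 j0 ◁ Limits.Pi.map fun i : Fin n => ι i.succ (jt i)) ≫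
          lift (fst _ _ ≫ ι 0 j0) (snd _ _) ≫ piCons Y ≫ f =
          piCons (fun i => P i (Fin.cons (α := J) j0 jt i)) ≫
          (Limits.Pi.map fun i => ι i (Fin.cons (α := J) j0 jt i)) ≫ f := fun f =>
        ((congrArg (_ ≫ ·) (Category.assoc _ _ _).symm).trans (Category.assoc _ _ _).symm).trans
          ((congrArg (· ≫ f) e2).symm.trans (Category.assoc _ _ _))
      exact (e3 f).trans ((congrArg _ e).trans (e3 g).symm)
    rw [← Category.id_comp f, ← piUncons_piCons, Category.assoc, key, ← Category.assoc,
      piUncons_piCons, Category.id_comp]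

variable [HasLimitsOfSize.{0, 0} V] [HasColimitsOfSize.{0, 0} V]

theorem jointEpi_sigma {J : Type} (P : J → V) : JointEpi (Sigma.ι P) :=
  fun _ _ _ h => Sigma.hom_ext _ _ h

theorem exists_piDesc {n : ℕ} {J : Fin n → Type} (P : ∀ i, J i → V) {Z : V}
    (f : ∀ j : ∀ i, J i, (∏ᶜ fun i => P i (j i)) ⟶ Z) :
    ∃ g : (∏ᶜ fun i => ∐ P i) ⟶ Z, ∀ j, (Limits.Pi.map fun i => Sigma.ι (P i) (j i)) ≫ g = f j := by
  induction n generalizing Z with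
  | zero =>
    refine ⟨(Pi.lift fun i => i.elim0) ≫ f (fun i => i.elim0), fun j => ?_⟩
    obtain rfl : j = fun i => i.elim0 := funext fun i => i.elim0
    rw [← Category.assoc]
    refine (congrArg (· ≫ f fun i => i.elim0) ?_).trans (Category.id_comp _)
    apply Pi.hom_ext
    intro i
    exact i.elim0
  | succ n ih =>
    choose g hg using fun j0 : J 0 => ih (fun i => P i.succ) (Z := (ihom (P 0 j0)).obj Z)
      (fun jt => curry (piCons (fun i => P i (Fin.cons (α := J) j0 jt i)) ≫ f (Fin.cons j0 jt)))
    refine ⟨piUncons _ ≫ runcurry (Sigma.desc fun j0 => rcurry (uncurry (g j0))), fun j => ?_⟩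
    obtain ⟨j0, jt, rfl⟩ : ∃ j0 jt, j = Fin.cons (α := J) j0 jt :=
      ⟨j 0, Fin.tail j, (Fin.cons_self_tail j).symm⟩
    rw [reassoc_of% piUncons_natural, ← lift_runcurry]
    have e1 : Sigma.ι (P 0) (Fin.cons (α := J) j0 jt 0) ≫
        Sigma.desc (fun j0 => rcurry (uncurry (g j0))) = rcurry (uncurry (g j0)) := by
      exact Sigma.ι_desc _ _
    rw [e1]
    change piUncons (fun i => P i (Fin.cons (α := J) j0 jt i)) ≫
      lift (fst (P 0 j0) (∏ᶜ fun i : Fin n => P i.succ (jt i)))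
        (snd _ _ ≫ Limits.Pi.map fun i : Fin n => Sigma.ι (P i.succ) (jt i)) ≫
      runcurry (rcurry (uncurry (g j0))) = f (Fin.cons (α := J) j0 jt)
    rw [runcurry_rcurry]
    have e2 : ∀ {W : V} (p : W ⟶ P 0 j0) {S S' : V} (q : W ⟶ S) (r : S ⟶ S')
        (h : S' ⟶ (ihom (P 0 j0)).obj Z),
        lift p (q ≫ r) ≫ uncurry h = lift p q ≫ uncurry (r ≫ h) := by
      intro W p S S' q r h
      rw [uncurry_natural_left, ← Category.assoc, lift_whiskerLeft]
    refine (congrArg (piUncons _ ≫ ·) (e2 _ _ _ _)).trans ?_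
    have e3 := hg j0 jt
    refine (congrArg (fun t => piUncons _ ≫ lift (fst _ _) (snd _ _) ≫ uncurry t) e3).trans ?_
    change piUncons (fun i => P i (Fin.cons (α := J) j0 jt i)) ≫
      lift (fst (P 0 j0) (∏ᶜ fun i : Fin n => P i.succ (jt i)))
          (snd (P 0 j0) (∏ᶜ fun i : Fin n => P i.succ (jt i))) ≫
        uncurry (curry (piCons (fun i => P i (Fin.cons (α := J) j0 jt i)) ≫ f (Fin.cons j0 jt))) = _
    rw [uncurry_curry]
    exact piUncons_lift_piCons _ _

/-- The morphism out of a finite product of coproducts that is given by a family of morphisms. -/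
def piDesc {n : ℕ} {J : Fin n → Type} (P : ∀ i, J i → V) {Z : V}
    (f : ∀ j : ∀ i, J i, (∏ᶜ fun i => P i (j i)) ⟶ Z) : (∏ᶜ fun i => ∐ P i) ⟶ Z :=
  (exists_piDesc P f).choose

theorem map_piDesc {n : ℕ} {J : Fin n → Type} (P : ∀ i, J i → V) {Z : V}
    (f : ∀ j : ∀ i, J i, (∏ᶜ fun i => P i (j i)) ⟶ Z) (j : ∀ i, J i) :
    (Limits.Pi.map fun i => Sigma.ι (P i) (j i)) ≫ piDesc P f = f j :=
  (exists_piDesc P f).choose_spec j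

/-- The morphism out of a product of two coproducts that is given by a family of morphisms. -/
def sigmaDesc₂ {J K : Type} (P : J → V) (Q : K → V) {Z : V} (f : ∀ j k, P j ⊗ Q k ⟶ Z) :
    (∐ P) ⊗ (∐ Q) ⟶ Z :=
  runcurry (Sigma.desc fun j => rcurry (uncurry (Sigma.desc fun k => curry (f j k))))

theorem lift_sigmaDesc₂ {J K : Type} (P : J → V) (Q : K → V) {Z : V} (f : ∀ j k, P j ⊗ Q k ⟶ Z)
    {W : V} {j : J} {k : K} (x : W ⟶ P j) (y : W ⟶ Q k) :
    lift (x ≫ Sigma.ι P j) (y ≫ Sigma.ι Q k) ≫ sigmaDesc₂ P Q f = lift x y ≫ f j k := by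
  have : lift x (y ≫ Sigma.ι Q k) = lift x y ≫ P j ◁ Sigma.ι Q k := by simp
  rw [sigmaDesc₂, ← lift_runcurry, Sigma.ι_desc, runcurry_rcurry, this, Category.assoc,
    ← uncurry_natural_left, Sigma.ι_desc, uncurry_curry]

end Distributive


/-! ### The category of operators of an operad -/

section Operators

variable [MonoidalClosed V] [HasLimitsOfSize.{0, 0} V] [HasColimitsOfSize.{0, 0} V]
  {X : ℕ → V}

/-- The objects of the category of operators `Δ₊(A)`: the finite ordinals. -/
structure Ordinals (A : Operad X) where
  /-- the number of elements -/
  len : ℕ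

/-- `A(φ) = ∏ₜ A(φ⁻¹ t)` for a monotone map `φ`. -/
abbrev fibProd (X : ℕ → V) {a b : ℕ} (φ : Fin a →o Fin b) : V :=
  ∏ᶜ fun t : Fin b => X (fib φ t)

/-- The space of morphisms `∐_φ A(φ)`, indexed by the monotone maps `φ`. -/
abbrev opHom (X : ℕ → V) (a b : ℕ) : V :=
  ∐ fun φ : Fin a →o Fin b => fibProd X φ

/-- The element of the space of morphisms that is given by a monotone map `φ` and elements of
`A(φ⁻¹ t)` for all `t`. -/
def opMk {W : V} {a b : ℕ} (φ : Fin a →o Fin b) (x : ∀ t, W ⟶ X (fib φ t)) : W ⟶ opHom X a b :=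
  Pi.lift x ≫ Sigma.ι (fun φ : Fin a →o Fin b => fibProd X φ) φ

theorem comp_opMk {W' W : V} {a b : ℕ} (f : W' ⟶ W) (φ : Fin a →o Fin b)
    (x : ∀ t, W ⟶ X (fib φ t)) : f ≫ opMk φ x = opMk φ fun t => f ≫ x t := by
  rw [opMk, opMk, ← Category.assoc]
  congr 1
  apply Pi.hom_ext
  intro i
  simp

theorem opMk_congr {W : V} {a b : ℕ} {φ φ' : Fin a →o Fin b} (h : φ = φ')
    {x : ∀ t, W ⟶ X (fib φ t)} {x' : ∀ t, W ⟶ X (fib φ' t)}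
    (hx : ∀ t, (⟨fib φ t, x t⟩ : Elt X W) = ⟨fib φ' t, x' t⟩) : opMk φ x = opMk φ' x' := by
  subst h
  have : x = x' := funext fun t => elt_inj (hx t)
  rw [this]

theorem op_ext {a b : ℕ} {W Z : V} {f g : opHom X a b ⊗ W ⟶ Z}
    (h : ∀ {W' : V} (φ : Fin a →o Fin b) (x : ∀ t, W' ⟶ X (fib φ t)) (w : W' ⟶ W),
      lift (opMk φ x) w ≫ f = lift (opMk φ x) w ≫ g) : f = g := by
  apply (jointEpi_sigma _).tensor
  intro φ
  have e : fst (fibProd X φ) W ≫ Sigma.ι (fun φ : Fin a →o Fin b => fibProd X φ) φ =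
      opMk φ fun t => fst (fibProd X φ) W ≫ Pi.π _ t := by
    rw [opMk]
    congr 1
    apply Pi.hom_ext
    intro t
    simp
  rw [e]
  exact h _ _ _

theorem op_ext' {a b : ℕ} {Z : V} {f g : opHom X a b ⟶ Z}
    (h : ∀ {W' : V} (φ : Fin a →o Fin b) (x : ∀ t, W' ⟶ X (fib φ t)),
      opMk φ x ≫ f = opMk φ x ≫ g) : f = g := by
  apply Sigma.hom_ext
  intro φ
  have e : Sigma.ι (fun φ : Fin a →o Fin b => fibProd X φ) φ =
      opMk φ fun t => Pi.π (fun t => X (fib φ t)) t := by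
    rw [opMk]
    refine (Category.id_comp _).symm.trans (congrArg (· ≫ _) ?_)
    apply Pi.hom_ext
    intro t
    simp
  rw [e]
  exact h _ _

variable (A : Operad X)

/-- The identity morphism: the base points in `A(1)`. -/
def opId (a : ℕ) : 𝟙_ V ⟶ opHom X a a :=
  opMk OrderHom.id fun t => A.unit ≫ eqToHom (congrArg X (fib_id t).symm)

/-- The composition: over the composite of monotone maps `φ` and `ψ`, the component at `w` is the
operadic composition of the element of `A(ψ⁻¹ w)` with the elements of `A(φ⁻¹ t)`, for
`t ∈ ψ⁻¹ w`. -/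
def opComp (a b c : ℕ) : opHom X a b ⊗ opHom X b c ⟶ opHom X a c :=
  sigmaDesc₂ _ _ fun φ ψ => opMk (ψ.comp φ) fun w =>
    A.mul (sum_fib φ ψ w) (snd (fibProd X φ) (fibProd X ψ) ≫ Pi.π _ w)
      fun i => fst (fibProd X φ) (fibProd X ψ) ≫ Pi.π _ (fibEnum ψ w i)

theorem lift_opComp {W : V} {a b c : ℕ} (φ : Fin a →o Fin b) (x : ∀ t, W ⟶ X (fib φ t))
    (ψ : Fin b →o Fin c) (y : ∀ t, W ⟶ X (fib ψ t)) :
    lift (opMk φ x) (opMk ψ y) ≫ opComp A a b c =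
      opMk (ψ.comp φ) fun w => A.mul (sum_fib φ ψ w) (y w) fun i => x (fibEnum ψ w i) := by
  refine (lift_sigmaDesc₂ (fun φ : Fin a →o Fin b => fibProd X φ)
    (fun ψ : Fin b →o Fin c => fibProd X ψ) _ (Pi.lift x) (Pi.lift y)).trans ?_
  rw [comp_opMk]
  congr 1
  funext w
  rw [Operad.comp_mul]
  congr 1
  · simp
  · funext i
    simp

theorem opId_elt {W : V} {a : ℕ} (t : Fin a) :
    (⟨_, toUnit W ≫ A.unit ≫ eqToHom (congrArg X (fib_id t).symm)⟩ : Elt X W) =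
      ⟨1, toUnit W ≫ A.unit⟩ := by
  rw [← Category.assoc]
  exact elt_cast (fib_id t).symm _

theorem opId_opComp {W : V} (a b : ℕ) (f : W ⟶ opHom X a b) :
    lift (toUnit W ≫ opId A a) f ≫ opComp A a a b = f := by
  have : lift (toUnit _ ≫ opId A a) (𝟙 _) ≫ opComp A a a b = 𝟙 _ := by
    apply op_ext'
    intro W φ x
    rw [comp_lift_assoc, Category.comp_id, comp_toUnit_assoc, opId, comp_opMk, lift_opComp]
    refine opMk_congr (by ext; rfl) fun t => ?_
    rw [Operad.mul_elt]
    refine (A.mulE_congr (x' := ⟨fib φ t, x t⟩) rfl (y' := fun _ => ⟨1, toUnit _ ≫ A.unit⟩)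
      fun i => ?_).trans (A.mulE_unit _)
    exact opId_elt A _
  have e : lift (toUnit W ≫ opId A a) f = f ≫ lift (toUnit _ ≫ opId A a) (𝟙 _) := by simp
  rw [e, Category.assoc, this, Category.comp_id]

theorem opComp_opId {W : V} (a b : ℕ) (f : W ⟶ opHom X a b) :
    lift f (toUnit W ≫ opId A b) ≫ opComp A a b b = f := by
  have : lift (𝟙 _) (toUnit _ ≫ opId A b) ≫ opComp A a b b = 𝟙 _ := by
    apply op_ext'
    intro W φ x
    rw [comp_lift_assoc, Category.comp_id, comp_toUnit_assoc, opId, comp_opMk, lift_opComp]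
    refine opMk_congr (by ext; rfl) fun t => ?_
    rw [Operad.mul_elt]
    refine (A.mulE_congr (opId_elt A _) (y' := fun _ => ⟨fib φ t, x t⟩)
      fun i => ?_).trans (A.unit_mulE _)
    rw [fibEnum_id]
  have e : lift f (toUnit W ≫ opId A b) = f ≫ lift (𝟙 _) (toUnit _ ≫ opId A b) := by simp
  rw [e, Category.assoc, this, Category.comp_id]

theorem op_ext₃ {a b c d : ℕ} {Z : V} {F G : opHom X a b ⊗ (opHom X b c ⊗ opHom X c d) ⟶ Z}
    (h : ∀ {W : V} (φ : Fin a →o Fin b) (x : ∀ t, W ⟶ X (fib φ t)) (ψ : Fin b →o Fin c)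
      (y : ∀ t, W ⟶ X (fib ψ t)) (θ : Fin c →o Fin d) (z : ∀ t, W ⟶ X (fib θ t)),
      lift (opMk φ x) (lift (opMk ψ y) (opMk θ z)) ≫ F =
        lift (opMk φ x) (lift (opMk ψ y) (opMk θ z)) ≫ G) : F = G := by
  apply op_ext
  intro W φ x w
  have key : lift (snd (opHom X b c ⊗ opHom X c d) W ≫ opMk φ x) (fst _ _) ≫ F =
      lift (snd (opHom X b c ⊗ opHom X c d) W ≫ opMk φ x) (fst _ _) ≫ G := by
    have k1 : lift (snd _ _ ≫ snd _ _ ≫ opMk φ x)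
          (lift (fst (opHom X b c) (opHom X c d ⊗ W)) (snd _ _ ≫ fst _ _)) ≫ F =
        lift (snd _ _ ≫ snd _ _ ≫ opMk φ x)
          (lift (fst (opHom X b c) (opHom X c d ⊗ W)) (snd _ _ ≫ fst _ _)) ≫ G := by
      apply op_ext
      intro W₂ ψ y w₂
      have k2 : lift (snd _ _ ≫ fst _ _ ≫ opMk φ x) (lift (snd _ _ ≫ snd _ _ ≫ opMk ψ y)
            (fst (opHom X c d) (W ⊗ W₂))) ≫ F =
          lift (snd _ _ ≫ fst _ _ ≫ opMk φ x) (lift (snd _ _ ≫ snd _ _ ≫ opMk ψ y)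
            (fst (opHom X c d) (W ⊗ W₂))) ≫ G := by
        apply op_ext
        intro W₃ θ z w₃
        simpa [comp_lift_assoc, comp_opMk] using h φ (fun t => w₃ ≫ fst _ _ ≫ x t) ψ
          (fun t => w₃ ≫ snd _ _ ≫ y t) θ z
      simpa [comp_lift_assoc] using
        congrArg (lift (w₂ ≫ fst _ _) (lift (w₂ ≫ snd _ _) (𝟙 _)) ≫ ·) k2
    simpa [comp_lift_assoc] using
      congrArg (lift (fst _ _ ≫ fst _ _) (lift (fst _ _ ≫ snd _ _) (snd _ _)) ≫ ·) k1
  simpa [comp_lift_assoc] using congrArg (lift w (𝟙 W) ≫ ·) key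

theorem opComp_assoc {W : V} (a b c d : ℕ) (f : W ⟶ opHom X a b) (g : W ⟶ opHom X b c)
    (h : W ⟶ opHom X c d) :
    lift (lift f g ≫ opComp A a b c) h ≫ opComp A a c d =
      lift f (lift g h ≫ opComp A b c d) ≫ opComp A a b d := by
  have key : lift (lift (fst _ _) (snd _ _ ≫ fst _ _) ≫ opComp A a b c) (snd _ _ ≫ snd _ _) ≫
      opComp A a c d =
      lift (fst (opHom X a b) (opHom X b c ⊗ opHom X c d))
        (lift (snd _ _ ≫ fst _ _) (snd _ _ ≫ snd _ _) ≫ opComp A b c d) ≫ opComp A a b d := by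
    apply op_ext₃
    intro W φ x ψ y θ z
    have e1 : lift (lift (opMk φ x) (opMk ψ y) ≫ opComp A a b c) (opMk θ z) ≫ opComp A a c d =
        lift (opMk φ x) (lift (opMk ψ y) (opMk θ z) ≫ opComp A b c d) ≫ opComp A a b d := by
      rw [lift_opComp, lift_opComp, lift_opComp, lift_opComp]
      refine opMk_congr rfl fun r => ?_
      refine ((A.mul_elt _ _ _).trans ?_).trans (A.mul_elt _ _ _).symm
      refine Eq.trans ?_ (A.mulE_congr (A.mul_elt (sum_fib ψ θ r) (z r) _) (y' := fun p =>
        ⟨_, x (fibEnum ψ (fibEnum θ r (pos p).1) (pos p).2)⟩) ?_).symm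
      · refine Eq.trans ?_ (A.mulE_assoc (⟨_, z r⟩ : Elt X W) (fun i => ⟨_, y (fibEnum θ r i)⟩)
          (fun i j => ⟨_, x (fibEnum ψ (fibEnum θ r i) j)⟩)).symm
        refine A.mulE_congr rfl fun i => ?_
        rw [Operad.mul_elt]
        rfl
      · intro p
        obtain ⟨p, rfl⟩ : ∃ q, p = Fin.cast (sum_fib ψ θ r) q :=
          ⟨Fin.cast (sum_fib ψ θ r).symm p, rfl⟩
        have e := fibEnum_comp ψ θ r p
        exact congrArg (fun t => (⟨fib φ t, x t⟩ : Elt X W)) e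
    simpa [comp_lift_assoc] using e1
  have := congrArg (lift f (lift g h) ≫ ·) key
  simpa [comp_lift_assoc] using this

/-- The category of operators `Δ₊(A)` as a category enriched in spaces. -/
instance operators : EnrichedCategory V (Ordinals A) where
  Hom a b := opHom X a.len b.len
  id a := opId A a.len
  comp a b c := opComp A a.len b.len c.len
  id_comp a b := by
    have := opId_opComp A a.len b.len (𝟙 _)
    refine Eq.trans ?_ this
    rw [← Category.assoc]
    congr 1
    ext <;> simp
  comp_id a b := by
    have := opComp_opId A a.len b.len (𝟙 _)
    refine Eq.trans ?_ this
    rw [← Category.assoc]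
    congr 1
    ext <;> simp
  assoc a b c d := by
    have := opComp_assoc A a.len b.len c.len d.len (fst _ (_ ⊗ _)) (snd _ _ ≫ fst _ _)
      (snd _ _ ≫ snd _ _)
    refine Eq.trans (Eq.trans ?_ this) ?_
    · exact lift_assoc_aux _ _
    · congr 1
      ext <;> simp

end Operators


/-! ### Finite powers of enriched categories and the ordinal sum functors -/

section OrdinalSum

theorem lift_eId_eComp {C : Type} [EnrichedCategory V C] {W : V} {a b : C} (f : W ⟶ (a ⟶[V] b)) :
    lift (toUnit W ≫ eId V a) f ≫ eComp V a a b = f := by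
  have := f ≫= e_id_comp V a b
  rw [Category.comp_id] at this
  refine Eq.trans ?_ this
  simp only [← Category.assoc]
  congr 1
  ext <;> simp

theorem lift_eComp_eId {C : Type} [EnrichedCategory V C] {W : V} {a b : C} (f : W ⟶ (a ⟶[V] b)) :
    lift f (toUnit W ≫ eId V b) ≫ eComp V a b b = f := by
  have := f ≫= e_comp_id V a b
  rw [Category.comp_id] at this
  refine Eq.trans ?_ this
  simp only [← Category.assoc]
  congr 1
  ext <;> simp

theorem lift_eComp_assoc {C : Type} [EnrichedCategory V C] {W : V} {a b c d : C}
    (f : W ⟶ (a ⟶[V] b)) (g : W ⟶ (b ⟶[V] c)) (h : W ⟶ (c ⟶[V] d)) :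
    lift (lift f g ≫ eComp V a b c) h ≫ eComp V a c d =
      lift f (lift g h ≫ eComp V b c d) ≫ eComp V a b d := by
  have := lift f (lift g h) ≫= e_assoc V a b c d
  rw [lift_assoc_aux] at this
  simpa [comp_lift_assoc] using this

/-- The power `Cⁿ` of an enriched category. -/
instance powerCategory [HasLimitsOfSize.{0, 0} V] {C : Type} [EnrichedCategory V C] (n : ℕ) :
    EnrichedCategory V (Fin n → C) where
  Hom a b := ∏ᶜ fun i => (a i ⟶[V] b i)
  id a := Pi.lift fun i => eId V (a i)
  comp a b c := Pi.lift fun i =>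
    lift (fst _ _ ≫ Pi.π _ i) (snd _ _ ≫ Pi.π _ i) ≫ eComp V (a i) (b i) (c i)
  id_comp a b := by
    apply Pi.hom_ext
    intro i
    simp only [Category.assoc, Pi.lift_π, Category.id_comp]
    have := Pi.π (fun i => (a i ⟶[V] b i)) i ≫= e_id_comp V (a i) (b i)
    rw [Category.comp_id] at this
    refine Eq.trans ?_ this
    simp only [← Category.assoc]
    congr 1
    ext <;> simp
  comp_id a b := by
    apply Pi.hom_ext
    intro i
    simp only [Category.assoc, Pi.lift_π, Category.id_comp]
    have := Pi.π (fun i => (a i ⟶[V] b i)) i ≫= e_comp_id V (a i) (b i)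
    rw [Category.comp_id] at this
    refine Eq.trans ?_ this
    simp only [← Category.assoc]
    congr 1
    ext <;> simp
  assoc a b c d := by
    apply Pi.hom_ext
    intro i
    simp only [Category.assoc, Pi.lift_π]
    have : ∀ {P Q R : V} (m : Q ⟶ R), P ◁ m = lift (fst _ _) (snd _ _ ≫ m) := fun m => by
      ext <;> simp
    rw [lift_assoc_aux, this]
    simpa [comp_lift_assoc, -lift_fst_comp_snd_comp] using lift_eComp_assoc
      (fst (∏ᶜ fun i => (a i ⟶[V] b i))
        ((∏ᶜ fun i => (b i ⟶[V] c i)) ⊗ ∏ᶜ fun i => (c i ⟶[V] d i)) ≫ Pi.π _ i)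
      (snd _ _ ≫ fst _ _ ≫ Pi.π _ i) (snd _ _ ≫ snd _ _ ≫ Pi.π _ i)

variable [MonoidalClosed V] [HasLimitsOfSize.{0, 0} V] [HasColimitsOfSize.{0, 0} V]
  {X : ℕ → V}

theorem pi_lift_comp {n : ℕ} {P : Fin n → V} {W W' : V} (f : W' ⟶ W) (x : ∀ i, W ⟶ P i) :
    f ≫ Pi.lift x = Pi.lift fun i => f ≫ x i := by
  apply Pi.hom_ext
  intro i
  simp

theorem opPi_ext {n : ℕ} {a b : Fin n → ℕ} {W Z : V}
    {f g : (∏ᶜ fun i => opHom X (a i) (b i)) ⊗ W ⟶ Z}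
    (h : ∀ {W' : V} (φ : ∀ i, Fin (a i) →o Fin (b i)) (x : ∀ i t, W' ⟶ X (fib (φ i) t))
      (w : W' ⟶ W), lift (Pi.lift fun i => opMk (φ i) (x i)) w ≫ f =
        lift (Pi.lift fun i => opMk (φ i) (x i)) w ≫ g) : f = g := by
  apply (JointEpi.pi fun i : Fin n =>
    jointEpi_sigma fun φ : Fin (a i) →o Fin (b i) => fibProd X φ).tensor
  intro φ
  have e : fst (∏ᶜ fun i => fibProd X (φ i)) W ≫ (Limits.Pi.map fun i =>
      Sigma.ι (fun φ : Fin (a i) →o Fin (b i) => fibProd X φ) (φ i)) =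
      Pi.lift fun i => opMk (φ i) fun t => fst _ _ ≫ Pi.π _ i ≫ Pi.π _ t := by
    apply Pi.hom_ext
    intro i
    simp only [opMk, Category.assoc, Pi.map_π, Pi.lift_π]
    rw [← Category.assoc]
    congr 1
    apply Pi.hom_ext
    intro t
    simp
  rw [e]
  exact h _ _ _

theorem opPi_ext₂ {n : ℕ} {a b c : Fin n → ℕ} {Z : V}
    {f g : (∏ᶜ fun i => opHom X (a i) (b i)) ⊗ (∏ᶜ fun i => opHom X (b i) (c i)) ⟶ Z}
    (h : ∀ {W : V} (φ : ∀ i, Fin (a i) →o Fin (b i)) (x : ∀ i t, W ⟶ X (fib (φ i) t))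
      (ψ : ∀ i, Fin (b i) →o Fin (c i)) (y : ∀ i t, W ⟶ X (fib (ψ i) t)),
      lift (Pi.lift fun i => opMk (φ i) (x i)) (Pi.lift fun i => opMk (ψ i) (y i)) ≫ f =
      lift (Pi.lift fun i => opMk (φ i) (x i)) (Pi.lift fun i => opMk (ψ i) (y i)) ≫ g) :
    f = g := by
  apply opPi_ext
  intro W φ x w
  have k : lift (snd _ _ ≫ Pi.lift fun i => opMk (φ i) (x i))
        (fst (∏ᶜ fun i => opHom X (b i) (c i)) W) ≫ f =
      lift (snd _ _ ≫ Pi.lift fun i => opMk (φ i) (x i))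
        (fst (∏ᶜ fun i => opHom X (b i) (c i)) W) ≫ g := by
    apply opPi_ext
    intro W₂ ψ y w₂
    simpa [comp_lift_assoc, comp_opMk, pi_lift_comp] using h φ (fun i t => w₂ ≫ x i t) ψ y
  simpa [comp_lift_assoc] using congrArg (lift w (𝟙 _) ≫ ·) k

variable (A : Operad X)

/-- The effect of the ordinal sum on spaces of morphisms. -/
def sumHom {n : ℕ} (a b : Fin n → ℕ) :
    (∏ᶜ fun i => opHom X (a i) (b i)) ⟶ opHom X (∑ i, a i) (∑ i, b i) :=
  piDesc (fun i (φ : Fin (a i) →o Fin (b i)) => fibProd X φ) fun φ =>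
    opMk (sumMap φ) fun p => Pi.π (fun i => fibProd X (φ i)) (pos p).1 ≫
      Pi.π (fun t => X (fib (φ (pos p).1) t)) (pos p).2 ≫ eqToHom (congrArg X (fib_sumMap φ p))

theorem lift_sumHom {n : ℕ} {a b : Fin n → ℕ} {W : V} (φ : ∀ i, Fin (a i) →o Fin (b i))
    (x : ∀ i t, W ⟶ X (fib (φ i) t)) :
    (Pi.lift fun i => opMk (φ i) (x i)) ≫ sumHom a b =
      opMk (sumMap φ) fun p =>
        x (pos p).1 (pos p).2 ≫ eqToHom (congrArg X (fib_sumMap φ p)) := by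
  have e : (Pi.lift fun i => opMk (φ i) (x i)) = (Pi.lift fun i => Pi.lift (x i)) ≫
      Limits.Pi.map fun i =>
        Sigma.ι (fun φ : Fin (a i) →o Fin (b i) => fibProd X φ) (φ i) := by
    apply Pi.hom_ext
    intro i
    simp [opMk]
  rw [e, Category.assoc, sumHom, map_piDesc, comp_opMk]
  congr 1
  funext p
  simp

theorem lift_pi_opComp {n : ℕ} {a b c : Fin n → ℕ} {W : V} (φ : ∀ i, Fin (a i) →o Fin (b i))
    (x : ∀ i t, W ⟶ X (fib (φ i) t)) (ψ : ∀ i, Fin (b i) →o Fin (c i))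
    (y : ∀ i t, W ⟶ X (fib (ψ i) t)) :
    lift (Pi.lift fun i => opMk (φ i) (x i)) (Pi.lift fun i => opMk (ψ i) (y i)) ≫
      (Pi.lift fun i => lift (fst (∏ᶜ fun i => opHom X (a i) (b i)) (∏ᶜ fun i => opHom X (b i) (c i))
        ≫ Pi.π (fun i => opHom X (a i) (b i)) i)
        (snd _ _ ≫ Pi.π (fun i => opHom X (b i) (c i)) i) ≫ opComp A (a i) (b i) (c i)) =
      Pi.lift fun i => opMk ((ψ i).comp (φ i)) fun w =>
        A.mul (sum_fib (φ i) (ψ i) w) (y i w) fun j => x i (fibEnum (ψ i) w j) := by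
  rw [pi_lift_comp]
  congr 1
  funext i
  simp only [comp_lift_assoc, lift_fst_assoc, lift_snd_assoc, Limits.Pi.lift_π]
  exact lift_opComp A _ _ _ _

/-- The ordinal sum functor `u(n) : (D₊)ⁿ → D₊`. -/
def ordinalSum (n : ℕ) : EnrichedFunctor V (Fin n → Ordinals A) (Ordinals A) where
  obj U := ⟨∑ i, (U i).len⟩
  map U W := sumHom (fun i => (U i).len) (fun i => (W i).len)
  map_id U := by
    refine (lift_sumHom _ _).trans (opMk_congr (sumMap_id _) fun p => ?_)
    refine (elt_cast (fib_sumMap _ p) _).trans ?_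
    refine (elt_cast (fib_id _).symm A.unit).trans ?_
    exact (elt_cast (fib_id _).symm A.unit).symm
  map_comp U W Y := by
    apply opPi_ext₂
    intro Z φ x ψ y
    refine (Category.assoc _ _ _).symm.trans ?_
    refine (congrArg (· ≫ sumHom (fun i => (U i).len) (fun i => (Y i).len))
      (lift_pi_opComp A φ x ψ y)).trans ?_
    refine (lift_sumHom _ _).trans ?_
    have e2 : lift (Pi.lift fun i => opMk (φ i) (x i)) (Pi.lift fun i => opMk (ψ i) (y i)) ≫
        (sumHom (fun i => (U i).len) (fun i => (W i).len) ⊗ₘ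
          sumHom (fun i => (W i).len) (fun i => (Y i).len)) ≫ opComp A _ _ _ =
        lift ((Pi.lift fun i => opMk (φ i) (x i)) ≫ sumHom _ _)
          ((Pi.lift fun i => opMk (ψ i) (y i)) ≫ sumHom _ _) ≫ opComp A _ _ _ := by
      rw [lift_map_assoc]
    refine Eq.trans ?_ e2.symm
    rw [lift_sumHom, lift_sumHom, lift_opComp]
    refine opMk_congr (sumMap_comp φ ψ) fun p => ?_
    refine (elt_cast (fib_sumMap _ p) _).trans ?_
    refine (A.mul_elt _ _ _).trans (Eq.trans ?_ (A.mul_elt _ _ _).symm)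
    refine A.mulE_congr (elt_cast (fib_sumMap ψ p) _).symm fun l => ?_
    have e3 := elt_cast (X := X) (fib_sumMap φ (fibEnum (sumMap ψ) p (Fin.cast (fib_sumMap ψ p) l)))
      (x _ (pos (fibEnum (sumMap ψ) p (Fin.cast (fib_sumMap ψ p) l))).2)
    refine Eq.trans ?_ e3.symm
    rw [fibEnum_sumMap]
    exact (congrArg (fun q : (i : Fin n) × Fin (W i).len =>
      (⟨fib (φ q.1) q.2, x q.1 q.2⟩ : Elt X Z)) 
      (Equiv.symm_apply_apply (finSigmaFinEquiv (n := fun i => (W i).len))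
        ⟨(pos p).1, fibEnum (ψ (pos p).1) (pos p).2 l⟩)).symm

end OrdinalSum

/-! ### Continuous functors with values in spaces -/

section Functors

variable [MonoidalClosed V] {C : Type} [EnrichedCategory V C]

/-- The action `F c × C(c, d) ⟶ F d` of the spaces of morphisms on the values of a continuous
functor `F`. -/
def act (F : EnrichedFunctor V C V) (c d : C) : F.obj c ⊗ (c ⟶[V] d) ⟶ F.obj d :=
  uncurry (F.map c d)

theorem lift_uncurry {W X Y Z : V} (x : W ⟶ X) (f : W ⟶ Y) (g : Y ⟶ (ihom X).obj Z) :
    lift x f ≫ uncurry g = lift x (f ≫ g) ≫ (ihom.ev X).app Z := by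
  rw [uncurry_eq, lift_whiskerLeft_assoc]

theorem lift_curry_ev {W X Y Z : V} (x : W ⟶ X) (f : W ⟶ Y) (g : X ⊗ Y ⟶ Z) :
    lift x (f ≫ curry g) ≫ (ihom.ev X).app Z = lift x f ≫ g := by
  rw [← lift_uncurry, uncurry_curry]

theorem ihom_ext {W X Z : V} {f g : W ⟶ (ihom X).obj Z}
    (h : lift (fst X W) (snd X W ≫ f) ≫ (ihom.ev X).app Z =
      lift (fst X W) (snd X W ≫ g) ≫ (ihom.ev X).app Z) : f = g := by
  apply uncurry_injective
  have e : ∀ f : W ⟶ (ihom X).obj Z, uncurry f =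
      lift (fst X W) (snd X W ≫ f) ≫ (ihom.ev X).app Z := by
    intro f
    rw [← lift_uncurry, lift_fst_snd, Category.id_comp]
  rw [e, e, h]

theorem lift_act (F : EnrichedFunctor V C V) {c d : C} {W : V} (x : W ⟶ F.obj c)
    (f : W ⟶ (c ⟶[V] d)) :
    lift x f ≫ act F c d = lift x (f ≫ F.map c d) ≫ (ihom.ev (F.obj c)).app (F.obj d) :=
  lift_uncurry _ _ _

theorem lift_self_eComp_ev {W X Y Z : V} (x : W ⟶ X) (f : W ⟶ (ihom X).obj Y)
    (g : W ⟶ (ihom Y).obj Z) :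
    lift x (lift f g ≫ eComp V X Y Z) ≫ (ihom.ev X).app Z =
      lift (lift x f ≫ (ihom.ev X).app Y) g ≫ (ihom.ev Y).app Z := by
  have e : eComp V X Y Z = curry (compTranspose X Y Z) := rfl
  rw [e, lift_curry_ev, compTranspose_eq]
  have : lift x (lift f g) ≫ (α_ X _ _).inv = lift (lift x f) g := by
    ext <;> simp
  rw [reassoc_of% this]
  rw [lift_whiskerRight_assoc]

theorem lift_self_eId_ev {W X : V} (x : W ⟶ X) :
    lift x (toUnit W ≫ eId V X) ≫ (ihom.ev X).app X = x := by
  have e : eId V X = curry (ρ_ X).hom := rfl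
  rw [e, lift_curry_ev]
  simp

theorem act_eId (F : EnrichedFunctor V C V) {c : C} {W : V} (x : W ⟶ F.obj c) :
    lift x (toUnit W ≫ eId V c) ≫ act F c c = x := by
  rw [lift_act, Category.assoc, F.map_id, lift_self_eId_ev]

theorem act_eComp (F : EnrichedFunctor V C V) {c d e : C} {W : V} (x : W ⟶ F.obj c)
    (f : W ⟶ (c ⟶[V] d)) (g : W ⟶ (d ⟶[V] e)) :
    lift x (lift f g ≫ eComp V c d e) ≫ act F c e = lift (lift x f ≫ act F c d) g ≫ act F d e := by
  rw [lift_act, lift_act, lift_act, Category.assoc, F.map_comp, lift_map_assoc]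
  exact lift_self_eComp_ev _ _ _

/-- The continuous functor that is given by an action of the spaces of morphisms. -/
def ofAct (obj : C → V) (a : ∀ c d : C, obj c ⊗ (c ⟶[V] d) ⟶ obj d)
    (h_id : ∀ {W : V} (c : C) (x : W ⟶ obj c), lift x (toUnit W ≫ eId V c) ≫ a c c = x)
    (h_comp : ∀ {W : V} (c d e : C) (x : W ⟶ obj c) (f : W ⟶ (c ⟶[V] d)) (g : W ⟶ (d ⟶[V] e)),
      lift x (lift f g ≫ eComp V c d e) ≫ a c e = lift (lift x f ≫ a c d) g ≫ a d e) :
    EnrichedFunctor V C V where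
  obj := obj
  map c d := curry (a c d)
  map_id c := by
    apply ihom_ext
    rw [← Category.assoc]
    refine (lift_curry_ev _ _ _).trans ?_
    refine Eq.trans ?_ (congrArg (fun t => lift (fst (obj c) (𝟙_ V)) t ≫
      (ihom.ev (obj c)).app (obj c)) (congrArg (· ≫ eId V (obj c))
        (toUnit_unique (toUnit _) (snd _ _))))
    refine Eq.trans ?_ (lift_self_eId_ev _).symm
    rw [toUnit_unique (snd (obj c) (𝟙_ V)) (toUnit _)]
    exact h_id _ _
  map_comp c d e := by
    apply ihom_ext
    rw [← Category.assoc]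
    refine (lift_curry_ev _ _ _).trans ?_
    have h := h_comp c d e (fst (obj c) ((c ⟶[V] d) ⊗ (d ⟶[V] e))) (snd _ _ ≫ fst _ _)
      (snd _ _ ≫ snd _ _)
    rw [← comp_lift, lift_fst_snd, Category.comp_id] at h
    refine h.trans ?_
    have e1 : ∀ {W X Y Z X' Y' : V} (p : W ⟶ X ⊗ Y) (f : X ⟶ X') (g : Y ⟶ Y') (k : X' ⊗ Y' ⟶ Z),
        p ≫ (f ⊗ₘ g) ≫ k = lift (p ≫ fst _ _ ≫ f) (p ≫ snd _ _ ≫ g) ≫ k := by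
      intros
      rw [← Category.assoc]
      congr 1
      ext <;> simp
    rw [e1]
    refine Eq.trans ?_ (lift_self_eComp_ev _ _ _).symm
    rw [← Category.assoc, ← Category.assoc]
    refine Eq.symm ((lift_curry_ev _ _ _).trans ?_)
    congr 2
    exact lift_curry_ev _ _ _

theorem act_ofAct (obj : C → V) (a : ∀ c d : C, obj c ⊗ (c ⟶[V] d) ⟶ obj d) (h_id) (h_comp)
    (c d : C) : act (ofAct obj a h_id h_comp) c d = a c d :=
  uncurry_curry _

end Functors

/-! ### Mapping spaces, external products and left Kan extensions of continuous functors -/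

section FunctorCategory

variable [MonoidalClosed V] [HasLimitsOfSize.{0, 0} V] [HasColimitsOfSize.{0, 0} V]
  {C : Type} [EnrichedCategory V C] {D : Type} [EnrichedCategory V D]

/-- The first of the two maps whose equalizer is the space of transformations,
`τ ↦ ((x, f) ↦ τ (x f))`. -/
def mapLeft (F G : EnrichedFunctor V C V) : (∏ᶜ fun c => (ihom (F.obj c)).obj (G.obj c)) ⟶
    ∏ᶜ fun p : C × C => (ihom (F.obj p.1 ⊗ (p.1 ⟶[V] p.2))).obj (G.obj p.2) :=
  Pi.lift fun p => curry
    (lift (fst _ _ ≫ act F p.1 p.2) (snd _ _ ≫ Pi.π _ p.2) ≫ (ihom.ev (F.obj p.2)).app (G.obj p.2))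

/-- The second of the two maps whose equalizer is the space of transformations,
`τ ↦ ((x, f) ↦ (τ x) f)`. -/
def mapRight (F G : EnrichedFunctor V C V) : (∏ᶜ fun c => (ihom (F.obj c)).obj (G.obj c)) ⟶
    ∏ᶜ fun p : C × C => (ihom (F.obj p.1 ⊗ (p.1 ⟶[V] p.2))).obj (G.obj p.2) :=
  Pi.lift fun p => curry
    (lift (lift (fst _ _ ≫ fst _ _) (snd _ _ ≫ Pi.π _ p.1) ≫ (ihom.ev (F.obj p.1)).app (G.obj p.1))
      (fst _ _ ≫ snd _ _) ≫ act G p.1 p.2)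

theorem mapLeft_ev {F G : EnrichedFunctor V C V} {c d : C} {W : V} (x : W ⟶ F.obj c)
    (f : W ⟶ (c ⟶[V] d)) (t : W ⟶ ∏ᶜ fun c => (ihom (F.obj c)).obj (G.obj c)) :
    lift (lift x f) ((t ≫ mapLeft F G) ≫ Pi.π _ (c, d)) ≫ (ihom.ev (F.obj c ⊗ _)).app (G.obj d) =
      lift (lift x f ≫ act F c d) (t ≫ Pi.π _ d) ≫ (ihom.ev (F.obj d)).app (G.obj d) := by
  rw [Category.assoc, mapLeft, Pi.lift_π]
  refine (lift_curry_ev _ _ _).trans ?_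
  simp [comp_lift_assoc]

theorem mapRight_ev {F G : EnrichedFunctor V C V} {c d : C} {W : V} (x : W ⟶ F.obj c)
    (f : W ⟶ (c ⟶[V] d)) (t : W ⟶ ∏ᶜ fun c => (ihom (F.obj c)).obj (G.obj c)) :
    lift (lift x f) ((t ≫ mapRight F G) ≫ Pi.π _ (c, d)) ≫ (ihom.ev (F.obj c ⊗ _)).app (G.obj d) =
      lift (lift x (t ≫ Pi.π _ c) ≫ (ihom.ev (F.obj c)).app (G.obj c)) f ≫ act G c d := by
  rw [Category.assoc, mapRight, Pi.lift_π]
  refine (lift_curry_ev _ _ _).trans ?_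
  simp [comp_lift_assoc]

/-- The space `map_{C^*}(F, G)` of transformations of continuous functors `C → V`: the end of the
spaces `map(F c, G c)`, that is, the subspace of all families of maps `F c ⟶ G c` that commute with
the actions of the spaces of morphisms. -/
def mapObj (F G : EnrichedFunctor V C V) : V :=
  equalizer (mapLeft F G) (mapRight F G)

/-- The family of the components of a transformation. -/
def mapι (F G : EnrichedFunctor V C V) :
    mapObj F G ⟶ ∏ᶜ fun c => (ihom (F.obj c)).obj (G.obj c) :=
  equalizer.ι (mapLeft F G) (mapRight F G)

/-- The component at `c` of a transformation. -/
def mapπ (F G : EnrichedFunctor V C V) (c : C) : mapObj F G ⟶ (ihom (F.obj c)).obj (G.obj c) :=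
  mapι F G ≫ Pi.π (fun c => (ihom (F.obj c)).obj (G.obj c)) c

/-- Evaluation of transformations. -/
def eval (F G : EnrichedFunctor V C V) (c : C) : F.obj c ⊗ mapObj F G ⟶ G.obj c :=
  uncurry (mapπ F G c)

theorem lift_eval {F G : EnrichedFunctor V C V} {c : C} {W : V} (x : W ⟶ F.obj c)
    (t : W ⟶ mapObj F G) :
    lift x t ≫ eval F G c = lift x (t ≫ mapπ F G c) ≫ (ihom.ev (F.obj c)).app (G.obj c) :=
  lift_uncurry _ _ _

theorem eval_act {F G : EnrichedFunctor V C V} {c d : C} {W : V} (x : W ⟶ F.obj c)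
    (f : W ⟶ (c ⟶[V] d)) (t : W ⟶ mapObj F G) :
    lift (lift x f ≫ act F c d) t ≫ eval F G d = lift (lift x t ≫ eval F G c) f ≫ act G c d := by
  have h1 := mapLeft_ev x f (t ≫ mapι F G)
  have h2 := mapRight_ev x f (t ≫ mapι F G)
  have h3 : (t ≫ mapι F G) ≫ mapLeft F G = (t ≫ mapι F G) ≫ mapRight F G := by
    rw [Category.assoc, Category.assoc]
    exact congrArg (t ≫ ·) (equalizer.condition (mapLeft F G) (mapRight F G))
  rw [h3] at h1
  rw [lift_eval, lift_eval, mapπ, mapπ, ← Category.assoc, ← Category.assoc]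
  exact h1.symm.trans h2

/-- A family of maps, parametrized by a space `W`, that commutes with the actions of the spaces of
morphisms, as a map to the space of transformations. -/
def mapLift {F G : EnrichedFunctor V C V} {W : V} (τ : ∀ c, F.obj c ⊗ W ⟶ G.obj c)
    (h : ∀ {W' : V} (c d : C) (x : W' ⟶ F.obj c) (f : W' ⟶ (c ⟶[V] d)) (w : W' ⟶ W),
      lift (lift x f ≫ act F c d) w ≫ τ d = lift (lift x w ≫ τ c) f ≫ act G c d) :
    W ⟶ mapObj F G :=
  equalizer.lift (Pi.lift fun c => curry (τ c)) (by
    apply Pi.hom_ext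
    rintro ⟨c, d⟩
    apply ihom_ext
    have h1 := mapLeft_ev (F := F) (G := G) (fst (F.obj c ⊗ (c ⟶[V] d)) W ≫ fst _ _)
      (fst _ _ ≫ snd _ _) (snd _ _ ≫ Pi.lift fun c => curry (τ c))
    have h2 := mapRight_ev (F := F) (G := G) (fst (F.obj c ⊗ (c ⟶[V] d)) W ≫ fst _ _)
      (fst _ _ ≫ snd _ _) (snd _ _ ≫ Pi.lift fun c => curry (τ c))
    have h3 := h c d (fst (F.obj c ⊗ (c ⟶[V] d)) W ≫ fst _ _) (fst _ _ ≫ snd _ _) (snd _ _)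
    have e : ∀ {Y : V} (s : Y ⟶ W) c, (s ≫ Pi.lift fun c => curry (τ c)) ≫
        Pi.π (fun c => (ihom (F.obj c)).obj (G.obj c)) c = s ≫ curry (τ c) := fun s c => by
      rw [Category.assoc, Pi.lift_π]
    rw [e, lift_curry_ev, ← comp_lift, lift_fst_snd, Category.comp_id] at h1 h2
    rw [← comp_lift, lift_fst_snd, Category.comp_id] at h3
    simp only [Category.assoc] at h1 h2 ⊢
    exact h1.trans (h3.trans h2.symm))

theorem lift_mapLift {F G : EnrichedFunctor V C V} {W : V} (τ : ∀ c, F.obj c ⊗ W ⟶ G.obj c) (h)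
    {W' : V} (c : C) (x : W' ⟶ F.obj c) (w : W' ⟶ W) :
    lift x (w ≫ mapLift τ h) ≫ eval F G c = lift x w ≫ τ c := by
  have e : mapLift τ h ≫ mapι F G = Pi.lift fun c => curry (τ c) := equalizer.lift_ι _ _
  have : mapLift τ h ≫ mapπ F G c = curry (τ c) := by
    rw [mapπ, ← Category.assoc, e, Pi.lift_π]
  rw [lift_eval, Category.assoc, this, lift_curry_ev]

theorem map_ext {F G : EnrichedFunctor V C V} {W : V} {f g : W ⟶ mapObj F G}
    (h : ∀ c, lift (fst (F.obj c) W) (snd _ _ ≫ f) ≫ eval F G c =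
      lift (fst (F.obj c) W) (snd _ _ ≫ g) ≫ eval F G c) : f = g := by
  have e : f ≫ mapι F G = g ≫ mapι F G := by
    apply Pi.hom_ext
    intro c
    apply ihom_ext
    have := h c
    rw [lift_eval, lift_eval, Category.assoc, Category.assoc] at this
    rw [Category.assoc, Category.assoc]
    exact this
  exact equalizer.hom_ext e

/-- Composition of transformations. -/
def mapComp (F G H : EnrichedFunctor V C V) : mapObj F G ⊗ mapObj G H ⟶ mapObj F H :=
  mapLift (fun c => lift (lift (fst _ _) (snd _ _ ≫ fst _ _) ≫ eval F G c) (snd _ _ ≫ snd _ _) ≫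
    eval G H c) (by
    intro W c d x f w
    simp only [comp_lift_assoc, comp_lift, lift_fst_assoc, lift_snd_assoc, lift_fst, lift_snd]
    rw [eval_act, eval_act])

/-- An isomorphism of continuous functors. -/
structure FunctorIso (F G : EnrichedFunctor V C V) where
  /-- the components -/
  app (c : C) : F.obj c ≅ G.obj c
  naturality (c d : C) :
    act F c d ≫ (app d).hom = lift (fst _ _ ≫ (app c).hom) (snd _ _) ≫ act G c d

theorem FunctorIso.lift_act {F G : EnrichedFunctor V C V} (e : FunctorIso F G) {W : V} {c d : C}
    (x : W ⟶ F.obj c) (f : W ⟶ (c ⟶[V] d)) :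
    lift x f ≫ act F c d ≫ (e.app d).hom = lift (x ≫ (e.app c).hom) f ≫ act G c d := by
  rw [e.naturality, comp_lift_assoc]
  simp

/-- An isomorphism as a point of the space of transformations. -/
def FunctorIso.point {F G : EnrichedFunctor V C V} (e : FunctorIso F G) : 𝟙_ V ⟶ mapObj F G :=
  mapLift (fun c => fst _ _ ≫ (e.app c).hom) (by
    intro W c d x f w
    simpa using e.lift_act x f)

/-- Composition with an isomorphism. -/
def FunctorIso.post (F : EnrichedFunctor V C V) {G H : EnrichedFunctor V C V}
    (e : FunctorIso G H) : mapObj F G ⟶ mapObj F H :=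
  mapLift (fun c => eval F G c ≫ (e.app c).hom) (by
    intro W c d x f w
    rw [reassoc_of% eval_act x f w, e.lift_act]
    simp)

theorem act_ext {n : ℕ} {P Q R : Fin n → V} (a : ∀ i, P i ⊗ Q i ⟶ R i) {W : V}
    (x : W ⟶ ∏ᶜ P) (f : W ⟶ ∏ᶜ Q) :
    lift x f ≫ (Pi.lift fun i => lift (fst (∏ᶜ P) (∏ᶜ Q) ≫ Pi.π P i) (snd _ _ ≫ Pi.π Q i) ≫ a i) =
      Pi.lift fun i => lift (x ≫ Pi.π P i) (f ≫ Pi.π Q i) ≫ a i := by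
  rw [pi_lift_comp]
  simp [comp_lift_assoc]

/-- The external product `(U₁, ..., Uₙ) ↦ F₁ U₁ × ... × Fₙ Uₙ`. -/
def extProd {n : ℕ} (F : Fin n → EnrichedFunctor V C V) : EnrichedFunctor V (Fin n → C) V :=
  ofAct (fun U => ∏ᶜ fun i => (F i).obj (U i))
    (fun U W => Pi.lift fun i =>
      lift (fst (∏ᶜ fun i => (F i).obj (U i)) (∏ᶜ fun i => (U i ⟶[V] W i)) ≫ Pi.π _ i)
        (snd _ _ ≫ Pi.π _ i) ≫ act (F i) (U i) (W i))
    (by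
      intro W U x
      refine (act_ext (fun i => act (F i) (U i) (U i)) x _).trans ?_
      apply Pi.hom_ext
      intro i
      rw [Pi.lift_π]
      refine Eq.trans ?_ (act_eId (F i) (x ≫ Pi.π (fun i => (F i).obj (U i)) i))
      congr 2
      rw [Category.assoc]
      exact congrArg (toUnit W ≫ ·) (Pi.lift_π _ _))
    (by
      intro W U U' U'' x f g
      refine (act_ext (fun i => act (F i) (U i) (U'' i)) x _).trans ?_
      refine Eq.trans ?_ (act_ext (fun i => act (F i) (U' i) (U'' i)) _ g).symm
      congr 1
      funext i
      have e1 : (lift f g ≫ eComp V U U' U'') ≫ Pi.π (fun i => (U i ⟶[V] U'' i)) i =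
          lift (f ≫ Pi.π (fun i => (U i ⟶[V] U' i)) i) (g ≫ Pi.π (fun i => (U' i ⟶[V] U'' i)) i) ≫
            eComp V (U i) (U' i) (U'' i) := by
        refine (congrArg (· ≫ _)
          (act_ext (fun i => eComp V (U i) (U' i) (U'' i)) f g)).trans ?_
        exact Pi.lift_π _ _
      have e2 : (lift x f ≫ Pi.lift fun i =>
          lift (fst (∏ᶜ fun i => (F i).obj (U i)) (∏ᶜ fun i => (U i ⟶[V] U' i)) ≫ Pi.π _ i)
            (snd _ _ ≫ Pi.π _ i) ≫ act (F i) (U i) (U' i)) ≫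
              Pi.π (fun i => (F i).obj (U' i)) i =
          lift (x ≫ Pi.π (fun i => (F i).obj (U i)) i) (f ≫ Pi.π (fun i => (U i ⟶[V] U' i)) i) ≫
            act (F i) (U i) (U' i) := by
        refine (congrArg (· ≫ _) (act_ext (fun i => act (F i) (U i) (U' i)) x f)).trans ?_
        exact Pi.lift_π _ _
      refine (congrArg (fun t => lift _ t ≫ _) e1).trans ?_
      refine Eq.trans ?_ (congrArg (fun t => lift t _ ≫ _) e2).symm
      exact act_eComp _ _ _ _)

theorem lift_act_extProd {n : ℕ} (F : Fin n → EnrichedFunctor V C V) {U U' : Fin n → C} {W : V}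
    (x : W ⟶ ∏ᶜ fun i => (F i).obj (U i)) (f : W ⟶ ∏ᶜ fun i => (U i ⟶[V] U' i)) :
    lift x f ≫ act (extProd F) U U' = Pi.lift fun i =>
      lift (x ≫ Pi.π (fun i => (F i).obj (U i)) i) (f ≫ Pi.π (fun i => (U i ⟶[V] U' i)) i) ≫
        act (F i) (U i) (U' i) := by
  have e : act (extProd F) U U' = _ := act_ofAct _ _ _ _ U U'
  rw [e]
  exact act_ext (fun i => act (F i) (U i) (U' i)) x f

/-- The external product on spaces of transformations. -/
def extProdMap {n : ℕ} (F G : Fin n → EnrichedFunctor V C V) :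
    (∏ᶜ fun i => mapObj (F i) (G i)) ⟶ mapObj (extProd F) (extProd G) :=
  mapLift (fun U => Pi.lift fun i =>
    lift (fst (∏ᶜ fun i => (F i).obj (U i)) (∏ᶜ fun i => mapObj (F i) (G i)) ≫ Pi.π _ i)
      (snd _ _ ≫ Pi.π _ i) ≫ eval (F i) (G i) (U i)) (by
    intro W U U' x f t
    refine (congrArg (fun s => lift s t ≫ _) (lift_act_extProd F x f)).trans ?_
    refine (act_ext (fun i => eval (F i) (G i) (U' i)) _ t).trans ?_
    refine Eq.trans ?_ (congrArg (fun s => lift s f ≫ act (extProd G) U U')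
      (act_ext (fun i => eval (F i) (G i) (U i)) x t)).symm
    refine Eq.trans ?_ (lift_act_extProd G _ f).symm
    congr 1
    funext i
    rw [Pi.lift_π, Pi.lift_π]
    exact eval_act _ _ _)

/-! #### Left Kan extensions -/

variable (J : EnrichedFunctor V C D)

/-- The first of the two maps whose coequalizer is the left Kan extension, `(x, f, g) ↦ (x f, g)`. -/
def lanLeft (F : EnrichedFunctor V C V) (d : D) :
    (∐ fun p : C × C => (F.obj p.1 ⊗ (p.1 ⟶[V] p.2)) ⊗ (J.obj p.2 ⟶[V] d)) ⟶
      ∐ fun c => F.obj c ⊗ (J.obj c ⟶[V] d) :=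
  Sigma.desc fun p => lift (fst _ _ ≫ act F p.1 p.2) (snd _ _) ≫
    Sigma.ι (fun c => F.obj c ⊗ (J.obj c ⟶[V] d)) p.2

/-- The second of the two maps whose coequalizer is the left Kan extension,
`(x, f, g) ↦ (x, J f then g)`. -/
def lanRight (F : EnrichedFunctor V C V) (d : D) :
    (∐ fun p : C × C => (F.obj p.1 ⊗ (p.1 ⟶[V] p.2)) ⊗ (J.obj p.2 ⟶[V] d)) ⟶
      ∐ fun c => F.obj c ⊗ (J.obj c ⟶[V] d) :=
  Sigma.desc fun p => lift (fst _ _ ≫ fst _ _)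
      (lift (fst _ _ ≫ snd _ _ ≫ J.map p.1 p.2) (snd _ _) ≫ eComp V _ _ _) ≫
    Sigma.ι (fun c => F.obj c ⊗ (J.obj c ⟶[V] d)) p.1

/-- The coend `∫^c F c × D(J c, d)`. -/
def lanObj (F : EnrichedFunctor V C V) (d : D) : V := coequalizer (lanLeft J F d) (lanRight J F d)

/-- The quotient map to the coend. -/
def lanπ (F : EnrichedFunctor V C V) (d : D) :
    (∐ fun c => F.obj c ⊗ (J.obj c ⟶[V] d)) ⟶ lanObj J F d :=
  coequalizer.π (lanLeft J F d) (lanRight J F d)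

/-- The canonical map to the coend. -/
def lanι (F : EnrichedFunctor V C V) (c : C) (d : D) :
    F.obj c ⊗ (J.obj c ⟶[V] d) ⟶ lanObj J F d :=
  Sigma.ι (fun c => F.obj c ⊗ (J.obj c ⟶[V] d)) c ≫ lanπ J F d

theorem lanι_jointEpi (F : EnrichedFunctor V C V) (d : D) :
    JointEpi fun c => lanι J F c d := by
  intro Z f g h
  have e : lanπ J F d ≫ f = lanπ J F d ≫ g := by
    apply Sigma.hom_ext
    intro c
    simpa [lanι] using h c
  exact coequalizer.hom_ext e

theorem lan_ext {F : EnrichedFunctor V C V} {d : D} {W Z : V} {f g : lanObj J F d ⊗ W ⟶ Z}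
    (h : ∀ {W' : V} (c : C) (x : W' ⟶ F.obj c) (p : W' ⟶ (J.obj c ⟶[V] d)) (w : W' ⟶ W),
      lift (lift x p ≫ lanι J F c d) w ≫ f = lift (lift x p ≫ lanι J F c d) w ≫ g) : f = g := by
  apply (lanι_jointEpi J F d).tensor
  intro c
  have := h c (fst (F.obj c ⊗ (J.obj c ⟶[V] d)) W ≫ fst _ _) (fst _ _ ≫ snd _ _) (snd _ _)
  rwa [← comp_lift, lift_fst_snd, Category.comp_id] at this

theorem lanι_act (F : EnrichedFunctor V C V) {c c' : C} {d : D} {W : V} (x : W ⟶ F.obj c)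
    (f : W ⟶ (c ⟶[V] c')) (g : W ⟶ (J.obj c' ⟶[V] d)) :
    lift (lift x f ≫ act F c c') g ≫ lanι J F c' d =
      lift x (lift (f ≫ J.map c c') g ≫ eComp V _ _ _) ≫ lanι J F c d := by
  have e : lanLeft J F d ≫ lanπ J F d = lanRight J F d ≫ lanπ J F d :=
    coequalizer.condition (lanLeft J F d) (lanRight J F d)
  have h := (lift (lift x f) g ≫ Sigma.ι (fun p : C × C =>
    (F.obj p.1 ⊗ (p.1 ⟶[V] p.2)) ⊗ (J.obj p.2 ⟶[V] d)) (c, c')) ≫= e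
  simp only [lanLeft, lanRight, Category.assoc, Sigma.ι_desc_assoc] at h
  simpa [comp_lift_assoc, lanι] using h

/-- Maps out of the coend. -/
def lanDescAux {F : EnrichedFunctor V C V} {d : D} {Z : V}
    (k : (∐ fun c => F.obj c ⊗ (J.obj c ⟶[V] d)) ⟶ Z)
    (hk : lanLeft J F d ≫ k = lanRight J F d ≫ k) : lanObj J F d ⟶ Z :=
  coequalizer.desc k hk

theorem lanπ_lanDescAux {F : EnrichedFunctor V C V} {d : D} {Z : V}
    (k : (∐ fun c => F.obj c ⊗ (J.obj c ⟶[V] d)) ⟶ Z) (hk) :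
    lanπ J F d ≫ lanDescAux J k hk = k :=
  coequalizer.π_desc _ _

/-- Maps out of the coend, with a parameter. -/
def lanDesc {F : EnrichedFunctor V C V} {d : D} {W Z : V}
    (τ : ∀ c, (F.obj c ⊗ (J.obj c ⟶[V] d)) ⊗ W ⟶ Z)
    (h : ∀ {W' : V} (c c' : C) (x : W' ⟶ F.obj c) (f : W' ⟶ (c ⟶[V] c'))
      (g : W' ⟶ (J.obj c' ⟶[V] d)) (w : W' ⟶ W),
      lift (lift (lift x f ≫ act F c c') g) w ≫ τ c' =
        lift (lift x (lift (f ≫ J.map c c') g ≫ eComp V _ _ _)) w ≫ τ c) :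
    lanObj J F d ⊗ W ⟶ Z :=
  runcurry (lanDescAux J (Sigma.desc fun c => rcurry (τ c)) (by
    apply Sigma.hom_ext
    rintro ⟨c, c'⟩
    rw [lanLeft, lanRight, Sigma.ι_desc_assoc, Sigma.ι_desc_assoc, Category.assoc, Category.assoc,
      Sigma.ι_desc, Sigma.ι_desc, rcurry_natural, rcurry_natural]
    congr 1
    have := h c c' (fst ((F.obj c ⊗ (c ⟶[V] c')) ⊗ (J.obj c' ⟶[V] d)) W ≫ fst _ _ ≫ fst _ _)
      (fst _ _ ≫ fst _ _ ≫ snd _ _) (fst _ _ ≫ snd _ _) (snd _ _)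
    have e : lift (fst ((F.obj c ⊗ (c ⟶[V] c')) ⊗ (J.obj c' ⟶[V] d)) W ≫ fst _ _ ≫ fst _ _)
      (fst _ _ ≫ fst _ _ ≫ snd _ _) = fst _ _ ≫ fst _ _ := by
      ext <;> simp
    rw [e] at this
    simpa [comp_lift_assoc] using this))

theorem lift_lanDesc {F : EnrichedFunctor V C V} {d : D} {W Z : V}
    (τ : ∀ c, (F.obj c ⊗ (J.obj c ⟶[V] d)) ⊗ W ⟶ Z) (h) {W' : V} {c : C} (x : W' ⟶ F.obj c)
    (g : W' ⟶ (J.obj c ⟶[V] d)) (w : W' ⟶ W) :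
    lift (lift x g ≫ lanι J F c d) w ≫ lanDesc J τ h = lift (lift x g) w ≫ τ c := by
  rw [lanDesc, ← lift_runcurry, lanι, Category.assoc, lanπ_lanDescAux, Sigma.ι_desc, runcurry_rcurry]

/-- The action of the spaces of morphisms of `D` on the coends `∫^c F c × D(J c, d)`. -/
def lanAct (F : EnrichedFunctor V C V) (d e : D) : lanObj J F d ⊗ (d ⟶[V] e) ⟶ lanObj J F e :=
  lanDesc J (fun c => lift (fst _ _ ≫ fst _ _)
    (lift (fst _ _ ≫ snd _ _) (snd _ _) ≫ eComp V (J.obj c) d e) ≫ lanι J F c e) (by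
      intro W c c' x f g w
      simp only [comp_lift_assoc, comp_lift, lift_fst_assoc, lift_snd_assoc, lift_fst, lift_snd]
      rw [lanι_act, lift_eComp_assoc])

theorem lift_lanAct (F : EnrichedFunctor V C V) {d e : D} {W : V} {c : C} (x : W ⟶ F.obj c)
    (g : W ⟶ (J.obj c ⟶[V] d)) (w : W ⟶ (d ⟶[V] e)) :
    lift (lift x g ≫ lanι J F c d) w ≫ lanAct J F d e =
      lift x (lift g w ≫ eComp V (J.obj c) d e) ≫ lanι J F c e := by
  rw [lanAct, lift_lanDesc]
  simp [comp_lift_assoc]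

/-- The left Kan extension of `F` along `J`, `d ↦ ∫^c F c × D(J c, d)`. -/
def lan (F : EnrichedFunctor V C V) : EnrichedFunctor V D V :=
  ofAct (lanObj J F) (lanAct J F)
    (by
      intro W d x
      have key : lift (fst (lanObj J F d) W) (toUnit _ ≫ eId V d) ≫ lanAct J F d d =
          fst (lanObj J F d) W := by
        apply lan_ext
        intro W' c x p w
        rw [comp_lift_assoc, lift_fst, comp_toUnit_assoc, lift_lanAct, lift_eComp_eId]
      have := lift x (𝟙 W) ≫= key
      simpa [comp_lift_assoc] using this)
    (by
      intro W d d' d'' x f g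
      have key : lift (fst (lanObj J F d) W) (lift (snd _ _ ≫ f) (snd _ _ ≫ g) ≫ eComp V d d' d'') ≫
          lanAct J F d d'' = lift (lift (fst (lanObj J F d) W) (snd _ _ ≫ f) ≫ lanAct J F d d')
            (snd _ _ ≫ g) ≫ lanAct J F d' d'' := by
        apply lan_ext
        intro W' c x p w
        simp only [comp_lift_assoc, comp_lift, lift_fst, lift_snd_assoc]
        rw [lift_lanAct, lift_lanAct, lift_lanAct, lift_eComp_assoc]
      have := lift x (𝟙 W) ≫= key
      simpa [comp_lift_assoc] using this)

theorem lift_act_lan (F : EnrichedFunctor V C V) {d e : D} {W : V} {c : C} (x : W ⟶ F.obj c)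
    (g : W ⟶ (J.obj c ⟶[V] d)) (w : W ⟶ (d ⟶[V] e)) :
    lift (lift x g ≫ lanι J F c d) w ≫ act (lan J F) d e =
      lift x (lift g w ≫ eComp V (J.obj c) d e) ≫ lanι J F c e := by
  have e : act (lan J F) d e = lanAct J F d e := act_ofAct _ _ _ _ d e
  rw [e]
  exact lift_lanAct _ _ _ _ _

/-- The components of the left Kan extension of a transformation. -/
def lanMapApp (F G : EnrichedFunctor V C V) (d : D) :
    lanObj J F d ⊗ mapObj F G ⟶ lanObj J G d :=
  lanDesc J (fun c => lift (lift (fst _ _ ≫ fst _ _) (snd _ _) ≫ eval F G c)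
      (fst _ _ ≫ snd _ _) ≫ lanι J G c d) (by
      intro W c c' x f g w
      simp only [comp_lift_assoc, comp_lift, lift_fst_assoc, lift_snd_assoc, lift_fst, lift_snd]
      rw [eval_act, lanι_act])

theorem lift_lanMapApp (F G : EnrichedFunctor V C V) {d : D} {W : V} {c : C} (x : W ⟶ F.obj c)
    (g : W ⟶ (J.obj c ⟶[V] d)) (w : W ⟶ mapObj F G) :
    lift (lift x g ≫ lanι J F c d) w ≫ lanMapApp J F G d =
      lift (lift x w ≫ eval F G c) g ≫ lanι J G c d := by
  rw [lanMapApp, lift_lanDesc]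
  simp [comp_lift_assoc]

theorem param_eq {P Q R Y Y' Z W : V} (x : W ⟶ P) (f : W ⟶ Q) (w : W ⟶ R) (q : P ⊗ Q ⟶ Y)
    (q' : Y ⊗ R ⟶ Z) (r : P ⊗ R ⟶ Y') (r' : Y' ⊗ Q ⟶ Z)
    (h : lift (lift (fst P W) (snd _ _ ≫ f) ≫ q) (snd _ _ ≫ w) ≫ q' =
      lift (lift (fst P W) (snd _ _ ≫ w) ≫ r) (snd _ _ ≫ f) ≫ r') :
    lift (lift x f ≫ q) w ≫ q' = lift (lift x w ≫ r) f ≫ r' := by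
  have e := lift x (𝟙 W) ≫= h
  simpa [comp_lift_assoc] using e

/-- The left Kan extension on spaces of transformations. -/
def lanMap (F G : EnrichedFunctor V C V) : mapObj F G ⟶ mapObj (lan J F) (lan J G) :=
  mapLift (fun d => lanMapApp J F G d)
    (by
      intro W d d' x f w
      have key : lift (lift (fst (lanObj J F d) W) (snd _ _ ≫ f) ≫ act (lan J F) d d')
          (snd _ _ ≫ w) ≫ lanMapApp J F G d' =
          lift (lift (fst (lanObj J F d) W) (snd _ _ ≫ w) ≫ lanMapApp J F G d) (snd _ _ ≫ f) ≫
            act (lan J G) d d' := by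
        apply lan_ext
        intro W' c x p t
        have e1 : ∀ {Y Z : V} (q : Y ⊗ mapObj F G ⟶ Z) (q' : lanObj J F d ⊗ (d ⟶[V] d') ⟶ Y),
            lift (lift x p ≫ lanι J F c d) t ≫
            lift (lift (fst (lanObj J F d) W) (snd _ _ ≫ f) ≫ q') (snd _ _ ≫ w) ≫ q =
            lift (lift (lift x p ≫ lanι J F c d) (t ≫ f) ≫ q') (t ≫ w) ≫ q := by
          intros
          simp [comp_lift_assoc]
        have e2 : ∀ {Y Z : V} (q : Y ⊗ (d ⟶[V] d') ⟶ Z) (q' : lanObj J F d ⊗ mapObj F G ⟶ Y),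
            lift (lift x p ≫ lanι J F c d) t ≫
            lift (lift (fst (lanObj J F d) W) (snd _ _ ≫ w) ≫ q') (snd _ _ ≫ f) ≫ q =
            lift (lift (lift x p ≫ lanι J F c d) (t ≫ w) ≫ q') (t ≫ f) ≫ q := by
          intros
          simp [comp_lift_assoc]
        refine (e1 (lanMapApp J F G d') (act (lan J F) d d')).trans ?_
        refine Eq.trans ?_ (e2 (act (lan J G) d d') (lanMapApp J F G d)).symm
        refine (congrArg (fun s => lift s (t ≫ w) ≫ lanMapApp J F G d')
          (lift_act_lan J F x p (t ≫ f))).trans ?_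
        refine Eq.trans ?_ (congrArg (fun s => lift s (t ≫ f) ≫ act (lan J G) d d')
          (lift_lanMapApp J F G x p (t ≫ w))).symm
        exact (lift_lanMapApp J F G _ _ _).trans (lift_act_lan J G _ _ _).symm
      exact param_eq x f w _ _ _ _ key)

end FunctorCategory

/-! ### The bar construction -/

section Bar

variable {C : Type} [EnrichedCategory V C]

/-- The composite `o j ⟶ o i` of a chain of morphisms `o n ⟶ ... ⟶ o 1 ⟶ o 0`, for `i ≤ j`. -/
def chain {n : ℕ} {W : V} (o : Fin (n + 1) → C)
    (f : ∀ l : Fin n, W ⟶ (o l.succ ⟶[V] o l.castSucc)) (i j : Fin (n + 1)) (h : i ≤ j) :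
    W ⟶ (o j ⟶[V] o i) :=
  Nat.leRec (motive := fun m _ => ∀ hm : m < n + 1, W ⟶ (o ⟨m, hm⟩ ⟶[V] o i))
    (fun _ => toUnit W ≫ eId V (o i))
    (fun m _ g hm => lift (f ⟨m, Nat.lt_of_succ_lt_succ hm⟩) (g (Nat.lt_of_succ_lt hm)) ≫
      eComp V _ _ _) h j.2

theorem chain_self {n : ℕ} {W : V} (o : Fin (n + 1) → C)
    (f : ∀ l : Fin n, W ⟶ (o l.succ ⟶[V] o l.castSucc)) (i : Fin (n + 1)) :
    chain o f i i le_rfl = toUnit W ≫ eId V (o i) := by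
  unfold chain
  rw [Nat.leRec_self]

theorem chain_succ {n : ℕ} {W : V} (o : Fin (n + 1) → C)
    (f : ∀ l : Fin n, W ⟶ (o l.succ ⟶[V] o l.castSucc)) (i : Fin (n + 1)) (l : Fin n)
    (h : i ≤ l.castSucc) :
    chain o f i l.succ (h.trans (Fin.castSucc_lt_succ).le) =
      lift (f l) (chain o f i l.castSucc h) ≫ eComp V _ _ _ := by
  unfold chain
  exact congrFun (Nat.leRec_succ (motive := fun m _ => ∀ hm : m < n + 1, W ⟶ (o ⟨m, hm⟩ ⟶[V] o i))
    _ _ (show i.1 ≤ l.1 from h)) _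

theorem chain_adj {n : ℕ} {W : V} (o : Fin (n + 1) → C)
    (f : ∀ l : Fin n, W ⟶ (o l.succ ⟶[V] o l.castSucc)) (l : Fin n) :
    chain o f l.castSucc l.succ (Fin.castSucc_lt_succ).le = f l := by
  rw [chain_succ o f _ l le_rfl, chain_self, lift_eComp_eId]

theorem chain_induction {n : ℕ} {i : Fin (n + 1)} {p : ∀ j : Fin (n + 1), i ≤ j → Prop}
    (h0 : p i le_rfl) (h1 : ∀ (l : Fin n) (h : i ≤ l.castSucc), p l.castSucc h →
      p l.succ (h.trans (Fin.castSucc_lt_succ).le)) (j : Fin (n + 1)) (h : i ≤ j) : p j h := by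
  have : ∀ (m : ℕ) (hi : i.1 ≤ m) (hm : m < n + 1), p ⟨m, hm⟩ hi := by
    intro m hi
    induction m, hi using Nat.le_induction with
    | base => exact fun _ => h0
    | succ m hi ih => exact fun hm => h1 ⟨m, Nat.lt_of_succ_lt_succ hm⟩ hi (ih _)
  exact this j.1 h j.2

theorem chain_trans {n : ℕ} {W : V} (o : Fin (n + 1) → C)
    (f : ∀ l : Fin n, W ⟶ (o l.succ ⟶[V] o l.castSucc)) (i j k : Fin (n + 1)) (h : i ≤ j)
    (h' : j ≤ k) :
    lift (chain o f j k h') (chain o f i j h) ≫ eComp V _ _ _ = chain o f i k (h.trans h') := by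
  induction k, h' using chain_induction with
  | h0 => rw [chain_self, lift_eId_eComp]
  | h1 l h' ih => rw [chain_succ o f j l h', lift_eComp_assoc, ih, chain_succ o f i l (h.trans h')]

theorem comp_chain {n : ℕ} {W W' : V} (s : W' ⟶ W) (o : Fin (n + 1) → C)
    (f : ∀ l : Fin n, W ⟶ (o l.succ ⟶[V] o l.castSucc)) (i j : Fin (n + 1)) (h : i ≤ j) :
    s ≫ chain o f i j h = chain o (fun l => s ≫ f l) i j h := by
  induction j, h using chain_induction with
  | h0 => rw [chain_self, chain_self, comp_toUnit_assoc]
  | h1 l h ih => rw [chain_succ o _ i l h, chain_succ o _ i l h, comp_lift_assoc, ih]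

theorem chain_map {n m : ℕ} {W : V} (o : Fin (n + 1) → C)
    (f : ∀ l : Fin n, W ⟶ (o l.succ ⟶[V] o l.castSucc)) (θ : Fin (m + 1) →o Fin (n + 1))
    (i j : Fin (m + 1)) (h : i ≤ j) :
    chain (fun l => o (θ l)) (fun l => chain o f (θ l.castSucc) (θ l.succ)
      (θ.monotone (Fin.castSucc_lt_succ).le)) i j h = chain o f (θ i) (θ j) (θ.monotone h) := by
  induction j, h using chain_induction with
  | h0 => rw [chain_self, chain_self]
  | h1 l h ih => rw [chain_succ _ _ i l h, ih, chain_trans]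

variable [MonoidalClosed V] [HasLimitsOfSize.{0, 0} V] [HasColimitsOfSize.{0, 0} V]

/-- The summand `(C(o 1, o 0) × ... × C(o n, o (n - 1))) × C(o 0, c)` of the bar construction. -/
abbrev barSummand (c : C) {n : ℕ} (o : Fin (n + 1) → C) : V :=
  (∏ᶜ fun l : Fin n => (o l.succ ⟶[V] o l.castSucc)) ⊗ (o 0 ⟶[V] c)

/-- The space of `n`-simplices of the bar construction,
`∐_{o 0, ..., o n} C(o 0, c) × C(o 1, o 0) × ... × C(o n, o (n - 1))`. -/
def bar (c : C) (n : ℕ) : V := ∐ fun o : Fin (n + 1) → C => barSummand (V := V) c o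

/-- The inclusion of a summand. -/
def barι (c : C) {n : ℕ} (o : Fin (n + 1) → C) : barSummand (V := V) c o ⟶ bar c n :=
  Sigma.ι (fun o : Fin (n + 1) → C => barSummand (V := V) c o) o

/-- The element of the bar construction that is given by a chain of morphisms. -/
def barMk {c : C} {n : ℕ} {W : V} (o : Fin (n + 1) → C)
    (f : ∀ l : Fin n, W ⟶ (o l.succ ⟶[V] o l.castSucc)) (g : W ⟶ (o 0 ⟶[V] c)) : W ⟶ bar c n :=
  lift (Pi.lift f) g ≫ barι c o

theorem comp_barMk {c : C} {n : ℕ} {W W' : V} (s : W' ⟶ W) (o : Fin (n + 1) → C)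
    (f : ∀ l : Fin n, W ⟶ (o l.succ ⟶[V] o l.castSucc)) (g : W ⟶ (o 0 ⟶[V] c)) :
    s ≫ barMk o f g = barMk o (fun l => s ≫ f l) (s ≫ g) := by
  rw [barMk, comp_lift_assoc, pi_lift_comp, barMk]

/-- Maps out of the bar construction. -/
def barDesc {c : C} {n : ℕ} {Z : V}
    (k : ∀ o : Fin (n + 1) → C, barSummand (V := V) c o ⟶ Z) : bar c n ⟶ Z :=
  Sigma.desc k

theorem barMk_barDesc {c : C} {n : ℕ} {W Z : V} (o : Fin (n + 1) → C)
    (f : ∀ l : Fin n, W ⟶ (o l.succ ⟶[V] o l.castSucc)) (g : W ⟶ (o 0 ⟶[V] c))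
    (k : ∀ o : Fin (n + 1) → C, barSummand (V := V) c o ⟶ Z) :
    barMk o f g ≫ barDesc k = lift (Pi.lift f) g ≫ k o := by
  rw [barMk, Category.assoc]
  refine congrArg (lift (Pi.lift f) g ≫ ·) ?_
  exact Sigma.ι_desc _ _

theorem barι_eq (c : C) {n : ℕ} (o : Fin (n + 1) → C) :
    barι (V := V) c o = barMk o (fun l => fst _ _ ≫ Pi.π _ l) (snd _ _) := by
  rw [barMk]
  have : (Pi.lift fun l => fst (∏ᶜ fun l : Fin n => (o l.succ ⟶[V] o l.castSucc)) (o 0 ⟶[V] c) ≫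
      Pi.π _ l) = fst _ _ := by
    apply Pi.hom_ext
    intro l
    simp
  rw [this, lift_fst_snd, Category.id_comp]

theorem bar_ext {c : C} {n : ℕ} {Z : V} {k k' : bar c n ⟶ Z}
    (h : ∀ {W : V} (o : Fin (n + 1) → C) (f : ∀ l : Fin n, W ⟶ (o l.succ ⟶[V] o l.castSucc))
      (g : W ⟶ (o 0 ⟶[V] c)), barMk o f g ≫ k = barMk o f g ≫ k') : k = k' := by
  refine Sigma.hom_ext _ _ fun o => ?_
  change barι c o ≫ k = barι c o ≫ k'
  rw [barι_eq]
  exact h _ _ _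

theorem bar_ext₂ {c : C} {n : ℕ} {W Z : V} {k k' : bar c n ⊗ W ⟶ Z}
    (h : ∀ {W' : V} (o : Fin (n + 1) → C) (f : ∀ l : Fin n, W' ⟶ (o l.succ ⟶[V] o l.castSucc))
      (g : W' ⟶ (o 0 ⟶[V] c)) (w : W' ⟶ W), lift (barMk o f g) w ≫ k = lift (barMk o f g) w ≫ k') :
    k = k' := by
  apply (jointEpi_sigma _).tensor
  intro o
  have e : fst (barSummand (V := V) c o) W ≫ barι c o =
      barMk o (fun l => fst _ _ ≫ fst _ _ ≫ Pi.π _ l) (fst _ _ ≫ snd _ _) := by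
    rw [barι_eq, comp_barMk]
  exact (congrArg (fun t => lift t (snd _ _) ≫ k) e).trans
    ((h _ _ _ _).trans (congrArg (fun t => lift t (snd _ _) ≫ k') e).symm)

/-- The simplicial structure of the bar construction: a monotone map `θ` sends the chain
`o n ⟶ ... ⟶ o 0 ⟶ c` to the chain `o (θ m) ⟶ ... ⟶ o (θ 0) ⟶ c` of its composites. -/
def barMap (c : C) {n m : ℕ} (θ : Fin (m + 1) →o Fin (n + 1)) :
    (bar c n : V) ⟶ bar c m :=
  barDesc fun o => barMk (fun l => o (θ l))
    (fun l => chain o (fun l => fst _ _ ≫ Pi.π _ l) (θ l.castSucc) (θ l.succ)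
      (θ.monotone (Fin.castSucc_lt_succ).le))
    (lift (chain o (fun l => fst _ _ ≫ Pi.π _ l) 0 (θ 0) (Fin.zero_le _)) (snd _ _) ≫ eComp V _ _ _)

theorem barMk_barMap {c : C} {n m : ℕ} {W : V} (o : Fin (n + 1) → C)
    (f : ∀ l : Fin n, W ⟶ (o l.succ ⟶[V] o l.castSucc)) (g : W ⟶ (o 0 ⟶[V] c))
    (θ : Fin (m + 1) →o Fin (n + 1)) :
    barMk o f g ≫ barMap c θ = barMk (fun l => o (θ l))
      (fun l => chain o f (θ l.castSucc) (θ l.succ) (θ.monotone (Fin.castSucc_lt_succ).le))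
      (lift (chain o f 0 (θ 0) (Fin.zero_le _)) g ≫ eComp V _ _ _) := by
  rw [barMap, barMk_barDesc, comp_barMk, comp_lift_assoc]
  simp only [comp_chain, lift_fst_assoc, Pi.lift_π, lift_snd]

/-- The bar construction `E_• C (c)`, with `E_n C (c) = ∐ C(o 0, c) × ∏ C(o (l + 1), o l)`. -/
def barObject (c : C) : SimplicialObject V where
  obj n := bar c n.unop.len
  map θ := barMap c θ.unop.toOrderHom
  map_id n := by
    apply bar_ext
    intro W o f g
    rw [barMk_barMap, Category.comp_id]
    have e1 : ∀ l : Fin n.unop.len, chain o f l.castSucc l.succ _ = f l := fun l => chain_adj o f l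
    have e2 : lift (chain o f 0 0 le_rfl) g ≫ eComp V _ _ _ = g := by
      rw [chain_self, lift_eId_eComp]
    exact congrArg₂ (barMk o) (funext e1) e2
  map_comp {a b d} θ θ' := by
    apply bar_ext
    intro W o f g
    rw [← Category.assoc, barMk_barMap, barMk_barMap, barMk_barMap]
    have e1 := fun l : Fin d.unop.len => chain_map o f θ.unop.toOrderHom
      (θ'.unop.toOrderHom l.castSucc) (θ'.unop.toOrderHom l.succ)
      (θ'.unop.toOrderHom.monotone (Fin.castSucc_lt_succ).le)
    have e2 := chain_map o f θ.unop.toOrderHom 0 (θ'.unop.toOrderHom 0) (Fin.zero_le _)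
    refine (congrArg₂ (barMk fun l => o (θ.unop.toOrderHom (θ'.unop.toOrderHom l)))
      (funext e1) ?_).symm
    rw [e2, ← lift_eComp_assoc, chain_trans]
    rfl

end Bar

section Realization

variable {C : Type} [EnrichedCategory V C] [MonoidalClosed V] [HasLimitsOfSize.{0, 0} V]
  [HasColimitsOfSize.{0, 0} V]

/-- The action of the spaces of morphisms on the bar construction. -/
def barAct (c d : C) (n : ℕ) : (bar c n : V) ⊗ (c ⟶[V] d) ⟶ bar d n :=
  runcurry (barDesc fun o => rcurry (barMk o (fun l => fst _ _ ≫ fst _ _ ≫ Pi.π _ l)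
    (lift (fst _ _ ≫ snd _ _) (snd _ _) ≫ eComp V _ _ _)))

theorem lift_barAct {c d : C} {n : ℕ} {W : V} (o : Fin (n + 1) → C)
    (f : ∀ l : Fin n, W ⟶ (o l.succ ⟶[V] o l.castSucc)) (g : W ⟶ (o 0 ⟶[V] c))
    (h : W ⟶ (c ⟶[V] d)) :
    lift (barMk o f g) h ≫ barAct c d n = barMk o f (lift g h ≫ eComp V _ _ _) := by
  have e : barMk o f g = lift (Pi.lift f) g ≫ barι c o := rfl
  have e' : ∀ {Z : V} (k : ∀ o : Fin (n + 1) → C, barSummand (V := V) c o ⟶ Z),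
    barι c o ≫ barDesc k = k o := fun k => Sigma.ι_desc _ _
  rw [barAct, e, ← lift_runcurry, e', runcurry_rcurry, comp_barMk, comp_lift_assoc]
  simp

theorem barAct_barMap {c d : C} {n m : ℕ} {W : V} (θ : Fin (m + 1) →o Fin (n + 1))
    (x : W ⟶ bar c n) (h : W ⟶ (c ⟶[V] d)) :
    lift x h ≫ barAct c d n ≫ barMap d θ = lift (x ≫ barMap c θ) h ≫ barAct c d m := by
  have key : barAct c d n ≫ barMap d θ =
      lift (fst (bar c n) (c ⟶[V] d) ≫ barMap c θ) (snd _ _) ≫ barAct c d m := by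
    apply bar_ext₂
    intro W' o f g w
    rw [← Category.assoc, lift_barAct, barMk_barMap, comp_lift_assoc, lift_fst_assoc, lift_snd,
      barMk_barMap, lift_barAct, lift_eComp_assoc]
  rw [key, comp_lift_assoc, lift_fst_assoc, lift_snd]

/-- The functor `([n], [m]) ↦ B n × Δ^m`, for a simplicial space `B`. -/
abbrev realizationFunctor (Δ : SimplexCategory ⥤ V) (B : SimplicialObject V) :
    SimplexCategoryᵒᵖ ⥤ SimplexCategory ⥤ V :=
  B ⋙ MonoidalCategory.curriedTensor V ⋙ (Functor.whiskeringLeft SimplexCategory V V).obj Δ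

/-- The geometric realization `|B| = ∫^n B n × Δ^n`. -/
def realization (Δ : SimplexCategory ⥤ V) (B : SimplicialObject V) : V :=
  coend (realizationFunctor Δ B)

/-- The canonical map `B n × Δ^n ⟶ |B|`. -/
def realizationι (Δ : SimplexCategory ⥤ V) (B : SimplicialObject V) (n : SimplexCategory) :
    B.obj (Opposite.op n) ⊗ Δ.obj n ⟶ realization Δ B :=
  coend.ι (realizationFunctor Δ B) n

theorem realizationι_jointEpi (Δ : SimplexCategory ⥤ V) (B : SimplicialObject V) :
    JointEpi (realizationι Δ B) :=
  fun _ _ _ h => coend.hom_ext (F := realizationFunctor Δ B) h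

theorem realization_ext {Δ : SimplexCategory ⥤ V} {B : SimplicialObject V} {W Z : V}
    {f g : realization Δ B ⊗ W ⟶ Z}
    (h : ∀ {W' : V} (n : SimplexCategory) (x : W' ⟶ B.obj (Opposite.op n)) (t : W' ⟶ Δ.obj n)
      (w : W' ⟶ W), lift (lift x t ≫ realizationι Δ B n) w ≫ f =
        lift (lift x t ≫ realizationι Δ B n) w ≫ g) : f = g := by
  apply (realizationι_jointEpi Δ B).tensor
  intro n
  have := h n (fst (B.obj (Opposite.op n) ⊗ Δ.obj n) W ≫ fst _ _) (fst _ _ ≫ snd _ _) (snd _ _)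
  rwa [← comp_lift, lift_fst_snd, Category.comp_id] at this

theorem realizationι_condition {Δ : SimplexCategory ⥤ V} {B : SimplicialObject V}
    {n m : SimplexCategory} (θ : m ⟶ n) {W : V} (x : W ⟶ B.obj (Opposite.op n))
    (t : W ⟶ Δ.obj m) :
    lift (x ≫ B.map θ.op) t ≫ realizationι Δ B m =
      lift x (t ≫ Δ.map θ) ≫ realizationι Δ B n := by
  have h := lift x t ≫= coend.condition (realizationFunctor Δ B) θ
  have e1 : ((realizationFunctor Δ B).map θ.op).app m = B.map θ.op ▷ Δ.obj m := rfl
  have e2 : ((realizationFunctor Δ B).obj (Opposite.op n)).map θ =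
    B.obj (Opposite.op n) ◁ Δ.map θ := rfl
  rw [e1, e2] at h
  refine Eq.trans ?_ (h.trans ?_)
  · exact (lift_whiskerRight_assoc _ _ _ _).symm
  · exact lift_whiskerLeft_assoc _ _ _ _

theorem whiskerRight_aux {P P' : V} (Q W : V) (b : P ⟶ P') :
    lift (fst (P ⊗ Q) W ≫ b ▷ Q) (snd _ _) =
      lift (lift ((fst _ _ ≫ fst _ _) ≫ b) (fst _ _ ≫ snd _ _)) (snd _ _) := by
  ext <;> simp

theorem whiskerLeft_aux {Q Q' : V} (P W : V) (b : Q ⟶ Q') :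
    lift (fst (P ⊗ Q) W ≫ P ◁ b) (snd _ _) =
      lift (lift (fst _ _ ≫ fst _ _) ((fst _ _ ≫ snd _ _) ≫ b)) (snd _ _) := by
  ext <;> simp

theorem param_eq_aux {P Q R Y Z W : V} (x : W ⟶ P) (t : W ⟶ Q) (w : W ⟶ R) (q : P ⊗ Q ⟶ Y)
    (f : Y ⊗ R ⟶ Z) :
    lift x (𝟙 W) ≫ lift (lift (fst _ _) (snd _ _ ≫ t) ≫ q) (snd _ _ ≫ w) ≫ f =
      lift (lift x t ≫ q) w ≫ f := by
  simp [comp_lift_assoc]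

/-- Maps out of the geometric realization, with a parameter. -/
def realizationDesc {Δ : SimplexCategory ⥤ V} {B : SimplicialObject V} {W Z : V}
    (τ : ∀ n, (B.obj (Opposite.op n) ⊗ Δ.obj n) ⊗ W ⟶ Z)
    (h : ∀ {W' : V} {n m : SimplexCategory} (θ : m ⟶ n) (x : W' ⟶ B.obj (Opposite.op n))
      (t : W' ⟶ Δ.obj m) (w : W' ⟶ W),
      lift (lift (x ≫ B.map θ.op) t) w ≫ τ m = lift (lift x (t ≫ Δ.map θ)) w ≫ τ n) :
    realization Δ B ⊗ W ⟶ Z :=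
  runcurry (coend.desc (F := realizationFunctor Δ B) (fun n => rcurry (τ n)) (by
    intro m n θ
    have e1 : ((realizationFunctor Δ B).map θ.op).app m = B.map θ.op ▷ Δ.obj m := rfl
    have e2 : ((realizationFunctor Δ B).obj (Opposite.op n)).map θ =
      B.obj (Opposite.op n) ◁ Δ.map θ := rfl
    rw [e1, e2]
    refine (rcurry_natural _ _).trans (Eq.trans ?_ (rcurry_natural _ _).symm)
    congr 1
    have := h θ (fst (B.obj (Opposite.op n) ⊗ Δ.obj m) W ≫ fst _ _) (fst _ _ ≫ snd _ _) (snd _ _)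
    exact (congrArg (· ≫ τ m) (whiskerRight_aux _ _ _)).trans (this.trans
      (congrArg (· ≫ τ n) (whiskerLeft_aux _ _ _)).symm)))

theorem lift_realizationDesc {Δ : SimplexCategory ⥤ V} {B : SimplicialObject V} {W Z : V}
    (τ : ∀ n, (B.obj (Opposite.op n) ⊗ Δ.obj n) ⊗ W ⟶ Z) (h) {W' : V} (n : SimplexCategory)
    (x : W' ⟶ B.obj (Opposite.op n) ⊗ Δ.obj n) (w : W' ⟶ W) :
    lift (x ≫ realizationι Δ B n) w ≫ realizationDesc τ h = lift x w ≫ τ n := by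
  have e : ∀ hk, realizationι Δ B n ≫ (coend.desc (F := realizationFunctor Δ B)
      (fun n => rcurry (τ n)) hk : realization Δ B ⟶ _) = rcurry (τ n) := fun hk => coend.ι_desc _ _ _
  refine (lift_runcurry _ _ _ _).symm.trans ?_
  refine (congrArg (fun s => lift x w ≫ runcurry s) (e _)).trans ?_
  rw [runcurry_rcurry]

variable (Δ : SimplexCategory ⥤ V)

/-- The canonical map from `E_n C (c) × Δ^n` to the realization. -/
def barRealι (c : C) (n : SimplexCategory) :
    bar c n.len ⊗ Δ.obj n ⟶ realization Δ (barObject c) :=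
  realizationι Δ (barObject c) n

theorem barReal_ext {c : C} {W Z : V} {f g : realization Δ (barObject c) ⊗ W ⟶ Z}
    (h : ∀ {W' : V} (n : SimplexCategory) (o : Fin (n.len + 1) → C)
      (f' : ∀ l : Fin n.len, W' ⟶ (o l.succ ⟶[V] o l.castSucc)) (g' : W' ⟶ (o 0 ⟶[V] c))
      (t : W' ⟶ Δ.obj n) (w : W' ⟶ W),
      lift (lift (barMk o f' g') t ≫ barRealι Δ c n) w ≫ f =
        lift (lift (barMk o f' g') t ≫ barRealι Δ c n) w ≫ g) : f = g := by
  apply realization_ext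
  intro W' n x t w
  have key : lift (lift (fst (bar c n.len) W') (snd _ _ ≫ t) ≫ barRealι Δ c n) (snd _ _ ≫ w) ≫ f =
      lift (lift (fst (bar c n.len) W') (snd _ _ ≫ t) ≫ barRealι Δ c n) (snd _ _ ≫ w) ≫ g := by
    apply bar_ext₂
    intro W₂ o f' g' w'
    have := h n o f' g' (w' ≫ t) (w' ≫ w)
    simpa [comp_lift_assoc] using this
  exact (param_eq_aux (P := bar c n.len) x t w (barRealι Δ c n) f).symm.trans
    ((congrArg (lift (show W' ⟶ bar c n.len from x) (𝟙 W') ≫ ·) key).trans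
      (param_eq_aux (P := bar c n.len) x t w (barRealι Δ c n) g))

/-- Auxiliary definition for `classifyingAct`. -/
def classifyingActAux (c d : C) (n : SimplexCategory) :
    (bar c n.len ⊗ Δ.obj n) ⊗ (c ⟶[V] d) ⟶ realization Δ (barObject d) :=
  lift (lift (fst _ _ ≫ fst _ _) (snd _ _) ≫ barAct c d n.len) (fst _ _ ≫ snd _ _) ≫ barRealι Δ d n

theorem lift_classifyingActAux {c d : C} {n : SimplexCategory} {W : V} (x : W ⟶ bar c n.len)
    (t : W ⟶ Δ.obj n) (w : W ⟶ (c ⟶[V] d)) :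
    lift (lift x t) w ≫ classifyingActAux Δ c d n =
      lift (lift x w ≫ barAct c d n.len) t ≫ barRealι Δ d n := by
  rw [classifyingActAux, comp_lift_assoc, comp_lift_assoc]
  simp

/-- The action of the spaces of morphisms on the realization of the bar construction. -/
def classifyingAct (c d : C) :
    realization Δ (barObject c) ⊗ (c ⟶[V] d) ⟶ realization Δ (barObject d) :=
  realizationDesc (B := barObject c) (fun n => classifyingActAux Δ c d n) (by
    intro W n m θ x t w
    have e1 := realizationι_condition (Δ := Δ) (B := barObject d) θ
      (lift x w ≫ barAct c d n.len) t
    have e2 := barAct_barMap (d := d) θ.toOrderHom x w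
    refine (lift_classifyingActAux Δ _ _ _).trans (Eq.trans ?_
      (lift_classifyingActAux Δ _ _ _).symm)
    refine Eq.trans ?_ e1
    refine congrArg (fun s => lift s t ≫ realizationι Δ (barObject d) m) ?_
    exact e2.symm.trans (Category.assoc _ _ _).symm)

theorem lift_classifyingAct {c d : C} {n : SimplexCategory} {W : V} (x : W ⟶ bar c n.len)
    (t : W ⟶ Δ.obj n) (w : W ⟶ (c ⟶[V] d)) :
    lift (lift x t ≫ barRealι Δ c n) w ≫ classifyingAct Δ c d =
      lift (lift x w ≫ barAct c d n.len) t ≫ barRealι Δ d n :=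
  (lift_realizationDesc (B := barObject c) _ _ n (lift x t) w).trans
    (lift_classifyingActAux Δ x t w)

theorem lift_classifyingAct' {c d : C} {n : SimplexCategory} {W : V} (o : Fin (n.len + 1) → C)
    (f : ∀ l : Fin n.len, W ⟶ (o l.succ ⟶[V] o l.castSucc)) (g : W ⟶ (o 0 ⟶[V] c))
    (t : W ⟶ Δ.obj n) (w : W ⟶ (c ⟶[V] d)) :
    lift (lift (barMk o f g) t ≫ barRealι Δ c n) w ≫ classifyingAct Δ c d =
      lift (barMk o f (lift g w ≫ eComp V _ _ _)) t ≫ barRealι Δ d n := by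
  rw [lift_classifyingAct, lift_barAct]

theorem param_eq' {P Q R Y Z W : V} (x : W ⟶ P) (f : W ⟶ Q) (g : W ⟶ R) (q : P ⊗ Q ⟶ Y)
    (q' : Y ⊗ R ⟶ Z) {S : V} (k : W ⟶ S) (r : P ⊗ S ⟶ Z)
    (h : lift (fst P W) (snd _ _ ≫ k) ≫ r =
      lift (lift (fst P W) (snd _ _ ≫ f) ≫ q) (snd _ _ ≫ g) ≫ q') :
    lift x k ≫ r = lift (lift x f ≫ q) g ≫ q' := by
  have e := lift x (𝟙 W) ≫= h
  simpa [comp_lift_assoc] using e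

/-- The continuous functor `EC = |B_•(C(-, -), C, *)|`. -/
def classifying (C : Type) [EnrichedCategory V C] : EnrichedFunctor V C V :=
  ofAct (fun c : C => realization Δ (barObject c)) (classifyingAct Δ)
    (by
      intro W c x
      have key : lift (fst _ W) (snd _ _ ≫ toUnit _ ≫ eId V c) ≫ classifyingAct Δ c c =
          fst (realization Δ (barObject c)) W := by
        apply barReal_ext
        intro W' n o f g t w
        rw [comp_lift_assoc, lift_fst, lift_snd_assoc, comp_toUnit_assoc, lift_classifyingAct',
          lift_eComp_eId]
      have := lift x (𝟙 W) ≫= key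
      simpa [comp_lift_assoc] using this)
    (by
      intro W c d e x f g
      apply param_eq'
      apply barReal_ext
      intro W' n o f' g' t w
      have e1 : ∀ {Y Z : V} (q : Y ⊗ (d ⟶[V] e) ⟶ Z)
          (q' : realization Δ (barObject c) ⊗ (c ⟶[V] d) ⟶ Y),
          lift (lift (barMk o f' g') t ≫ barRealι Δ c n) w ≫
          lift (lift (fst _ W) (snd _ _ ≫ f) ≫ q') (snd _ _ ≫ g) ≫ q =
          lift (lift (lift (barMk o f' g') t ≫ barRealι Δ c n) (w ≫ f) ≫ q') (w ≫ g) ≫ q := by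
        intros
        simp [comp_lift_assoc]
      rw [e1, lift_classifyingAct', lift_classifyingAct', comp_lift_assoc, lift_fst,
        lift_snd_assoc, comp_lift_assoc, lift_classifyingAct', lift_eComp_assoc])

end Realization

/-! ### The extended operad -/

section Extended

variable [MonoidalClosed V] [HasLimitsOfSize.{0, 0} V] [HasColimitsOfSize.{0, 0} V]
  {X : ℕ → V}

/-- The objects of the full subcategory `D ⊆ D₊` of the nonempty finite ordinals. -/
structure NonemptyOrdinals (A : Operad X) where
  /-- the underlying finite ordinal -/
  obj : Ordinals A
  ne : obj.len ≠ 0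

/-- The full subcategory `D ⊆ D₊`. -/
instance nonemptyOperators (A : Operad X) : EnrichedCategory V (NonemptyOrdinals A) where
  Hom S T := S.obj ⟶[V] T.obj
  id S := eId V S.obj
  comp S T U := eComp V S.obj T.obj U.obj
  id_comp S T := e_id_comp V S.obj T.obj
  comp_id S T := e_comp_id V S.obj T.obj
  assoc S T U R := e_assoc V S.obj T.obj U.obj R.obj

theorem initial_strict {W Z : V} (x : W ⟶ ⊥_ V) (f g : W ⟶ Z) : f = g := by
  have h : snd (⊥_ V) W ≫ f = snd (⊥_ V) W ≫ g :=
    rcurry_injective (initial.hom_ext _ _)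
  have := lift x (𝟙 W) ≫= h
  simpa using this

theorem toEmpty_strict {a : ℕ} {W Z : V} (x : W ⟶ opHom X (a + 1) 0) (f g : W ⟶ Z) : f = g :=
  initial_strict (x ≫ Sigma.desc fun φ => (φ 0).elim0) f g

variable (Δ : SimplexCategory ⥤ V) (A : Operad X)

/-- The continuous functor `ED : D ⟶ V`. -/
abbrev classifyingD : EnrichedFunctor V (NonemptyOrdinals A) V := classifying Δ (NonemptyOrdinals A)

/-- The values of the extension of `ED` to `D₊`: it is empty on the empty ordinal. -/
def extObj : Ordinals A → V
  | ⟨0⟩ => ⊥_ V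
  | ⟨n + 1⟩ => (classifyingD Δ A).obj ⟨⟨n + 1⟩, Nat.succ_ne_zero n⟩

/-- The action of the spaces of morphisms on the values of the extension of `ED` to `D₊`. It is the
unique map from the empty space, unless the ordinals are nonempty. -/
def extAct : ∀ S T : Ordinals A, extObj Δ A S ⊗ (S ⟶[V] T) ⟶ extObj Δ A T
  | ⟨0⟩, T => runcurry (initial.to ((ihom ((⟨0⟩ : Ordinals A) ⟶[V] T)).obj (extObj Δ A T)))
  | ⟨n + 1⟩, ⟨0⟩ => snd _ (opHom X (n + 1) 0) ≫ Sigma.desc fun φ => (φ 0).elim0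
  | ⟨n + 1⟩, ⟨m + 1⟩ =>
    act (classifyingD Δ A) ⟨⟨n + 1⟩, Nat.succ_ne_zero n⟩ ⟨⟨m + 1⟩, Nat.succ_ne_zero m⟩

/-- The continuous functor `ẼD : D₊ ⟶ V`, the extension of `ED` with value `∅` at the empty
ordinal. -/
def extED : EnrichedFunctor V (Ordinals A) V :=
  ofAct (extObj Δ A) (extAct Δ A)
    (by
      rintro W ⟨_ | n⟩ x
      · exact initial_strict x _ _
      · exact act_eId (classifyingD Δ A) (c := ⟨⟨n + 1⟩, Nat.succ_ne_zero n⟩) x)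
    (by
      rintro W ⟨_ | a⟩ ⟨_ | b⟩ ⟨_ | c⟩ x f g
      · exact initial_strict x _ _
      · exact initial_strict x _ _
      · exact initial_strict x _ _
      · exact initial_strict x _ _
      · exact toEmpty_strict f _ _
      · exact toEmpty_strict f _ _
      · exact toEmpty_strict g _ _
      · exact act_eComp (classifyingD Δ A) (c := ⟨⟨a + 1⟩, Nat.succ_ne_zero a⟩)
          (d := ⟨⟨b + 1⟩, Nat.succ_ne_zero b⟩) (e := ⟨⟨c + 1⟩, Nat.succ_ne_zero c⟩) x f g)

/-- `ε(n)`, the left Kan extension of the `n`-fold external product of `ẼD` along `u(n)`. -/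
def eps (n : ℕ) : EnrichedFunctor V (Ordinals A) V :=
  lan (ordinalSum A n) (extProd fun _ : Fin n => extED Δ A)

/-- `Ã(n) = map(ẼD, ε(n))`. -/
def extSpace (n : ℕ) : V := mapObj (extED Δ A) (eps Δ A n)

/-- The identity morphism, for objects that are equal. -/
def idOf {C : Type} [EnrichedCategory V C] {a b : C} (h : a = b) : 𝟙_ V ⟶ (a ⟶[V] b) :=
  eId V a ≫ eqToHom (congrArg (fun t => (a ⟶[V] t)) h)

theorem ordinalSum_one (c : Ordinals A) : (ordinalSum A 1).obj (fun _ => c) = c :=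
  congrArg Ordinals.mk (by simp)

/-- The canonical map `ẼD c ⟶ ε(1) c` to the left Kan extension along `u(1)`. -/
def epsOne (c : Ordinals A) : (extED Δ A).obj c ⟶ (eps Δ A 1).obj c :=
  lift (Pi.lift fun _ => 𝟙 _) (toUnit _ ≫ idOf (ordinalSum_one A c)) ≫
    lanι (ordinalSum A 1) (extProd fun _ : Fin 1 => extED Δ A) (fun _ => c) c

/-- The part of a family `U` with index set `k 0 + ... + k (n - 1)` that belongs to the block
`i`. -/
def block {n : ℕ} {k : Fin n → ℕ} (U : Fin (∑ i, k i) → Ordinals A) (i : Fin n) :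
    Fin (k i) → Ordinals A :=
  fun j => U (finSigmaFinEquiv ⟨i, j⟩)

/-- The ordinal sums of the blocks of a family `U`. -/
def blockSum {n : ℕ} {k : Fin n → ℕ} (U : Fin (∑ i, k i) → Ordinals A) (i : Fin n) :
    Ordinals A :=
  (ordinalSum A (k i)).obj (block A U i)

theorem ordinalSum_blockSum {n : ℕ} {k : Fin n → ℕ} (U : Fin (∑ i, k i) → Ordinals A) :
    (ordinalSum A (∑ i, k i)).obj U = (ordinalSum A n).obj (blockSum A U) :=
  congrArg Ordinals.mk ((Finset.sum_congr rfl fun p _ => by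
    simp [block, pos]).trans (sum_pos fun i j => (block A U i j).len).symm)

/-- The canonical map `∏ₚ ẼD (U p) ⟶ ∏ᵢ ε(k i) (blockSum U i)`. -/
def blockMap {n : ℕ} {k : Fin n → ℕ} (U : Fin (∑ i, k i) → Ordinals A) :
    (∏ᶜ fun p => (extED Δ A).obj (U p)) ⟶ ∏ᶜ fun i => (eps Δ A (k i)).obj (blockSum A U i) :=
  Pi.lift fun i =>
    lift (Pi.lift fun j => Pi.π (fun p => (extED Δ A).obj (U p)) (finSigmaFinEquiv ⟨i, j⟩))
        (toUnit _ ≫ eId V (blockSum A U i)) ≫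
      lanι (ordinalSum A (k i)) (extProd fun _ : Fin (k i) => extED Δ A) (block A U i)
        (blockSum A U i)

/-- The canonical map `∏ₚ ẼD (U p) × D₊(⨆ U, d) ⟶ LKan_{u(n)} (∏̃ᵢ ε(k i)) (d)`. -/
def iteratedι {n : ℕ} {k : Fin n → ℕ} (U : Fin (∑ i, k i) → Ordinals A) (d : Ordinals A) :
    (∏ᶜ fun p => (extED Δ A).obj (U p)) ⊗ ((ordinalSum A (∑ i, k i)).obj U ⟶[V] d) ⟶
      (lan (ordinalSum A n) (extProd fun i => eps Δ A (k i))).obj d :=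
  lift (fst _ _ ≫ blockMap Δ A U)
      (lift (toUnit _ ≫ idOf (ordinalSum_blockSum A U).symm) (snd _ _) ≫ eComp V _ _ d) ≫
    lanι (ordinalSum A n) (extProd fun i => eps Δ A (k i)) (blockSum A U) d

/-- The map `Ã(k 0) × ... × Ã(k (n - 1)) ⟶ map(ε(n), LKan_{u(n)} (∏̃ᵢ ε(k i)))` that sends `(gᵢ)ᵢ` to
`LKan_{u(n)} (∏̃ᵢ gᵢ)`. -/
def lanProdMap (n : ℕ) (k : Fin n → ℕ) :
    (∏ᶜ fun i => extSpace Δ A (k i)) ⟶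
      mapObj (eps Δ A n) (lan (ordinalSum A n) (extProd fun i => eps Δ A (k i))) :=
  extProdMap (fun _ : Fin n => extED Δ A) (fun i => eps Δ A (k i)) ≫
    lanMap (ordinalSum A n) (extProd fun _ : Fin n => extED Δ A) (extProd fun i => eps Δ A (k i))

end Extended

end

/-- The standard cosimplicial space `[n] ↦ Δ^n`, in a full subcategory of the category of
topological spaces that contains the standard simplices. -/
noncomputable def simplices (P : ObjectProperty TopCat.{u}) (hP : ∀ n, P (SimplexCategory.toTop.{u}.obj n)) :
    SimplexCategory ⥤ P.FullSubcategory :=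
  P.lift SimplexCategory.toTop.{u} hP

end ExtendedOperad

open ExtendedOperad

/-!
The theorem holds for every continuous functor `E` on the category of operators in place of `ẼD`.
The functor `ε(n)` is the `n`-th power of `E` with respect to the convolution product that is
induced by the ordinal sum (`power`). Parts (a) and (b) express that this product is unital and
associative, and part (c) describes the operad of transformations from the object `E` to its
powers.

The proof works with generalized elements. An element of `LKan_{u(n)} (∏̃ᵢ Gᵢ)` is represented by
elements `xᵢ` of the values of the `Gᵢ` and a morphism `w` out of the ordinal sum of the ordinals
of the `xᵢ` (`convGen`), and the only relation is that a family of morphisms acting on the `xᵢ`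
may be moved into `w` as its ordinal sum (`convGen_act`). The map `κ` sends the class of the
classes of `((xᵢⱼ)ⱼ, gᵢ)` and of `w` to the class of `((xᵢⱼ), w ∘ ⨆ᵢ gᵢ)` (`flatGen`, `nest`).
That this is well defined requires maps out of the product of the spaces `ε(kᵢ)(Uᵢ)`, which is a
product of quotients. As the product with a fixed space preserves quotients, and as the relations
are reflexive, the product of the quotients is the quotient of the products of the spaces of
generators (`exists_piDesc_of_reflexive`, `exists_piDesc_lan`). For the same reason natural
operations on families of elements of powers can be compared on generators (`power_induction`).
The inverse of `κ` sends the class of `((xₚ), w)` to the class of the classes of the blocks of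
`(xₚ)` with identity morphisms, and of `w` (`splitGen`, `kappaIso`).

The composition of the operad is determined by its values on generators: the transformations `tᵢ`
send the class of `((xᵢ), w)` to the image under `κ` of the class of `((tᵢ xᵢ), w)`
(`bind_convGen`). So the associativity law is a consequence of the associativity of `κ`
(`nest_nest`, `bind_nest`, `bind_bind`), which is the associativity of the ordinal sum, and the
unit laws hold as the ordinal sum of one morphism is that morphism, and the ordinal sum of
identities is an identity (`nest_one`, `bind_unit`).

The laws of the ordinal sum identify natural numbers that are only propositionally equal.
Therefore the elements carry their source and target, their ordinal or their exponent as data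
(`OpElt`, `PtElt`, `PowElt`), so that all the laws are equations without transport.
-/

namespace ExtendedOperad

universe v₁ u₁

noncomputable section

variable {V : Type u₁} [Category.{v₁} V] [CartesianMonoidalCategory V]

/-! ### Iterated ordinal sums of finite ordinals -/

theorem sum_blocks {n : ℕ} {k : Fin n → ℕ} (b : Fin (∑ i, k i) → ℕ) :
    ∑ p, b p = ∑ i, ∑ j, b (finSigmaFinEquiv ⟨i, j⟩) := by
  refine Eq.trans ?_ (sum_pos fun i j => b (finSigmaFinEquiv ⟨i, j⟩)).symm
  exact Finset.sum_congr rfl fun p _ =>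
    congrArg b (Equiv.apply_symm_apply (finSigmaFinEquiv (n := k)) p).symm

/-- The identification is the only strictly monotone map between finite ordinals of the same
length. -/
theorem eq_cast_of_strictMono {m m' : ℕ} (h : m = m') {f : Fin m → Fin m'} (hf : StrictMono f)
    (p : Fin m) : f p = Fin.cast h p := by
  subst h
  have hs := Finite.surjective_of_injective hf.injective
  exact congrFun ((StrictMono.range_inj hf strictMono_id).1
    (hs.range_eq.trans Set.range_id.symm)) p

/-- Associativity of the lexicographic enumeration of iterated sums. -/
theorem finSigmaFinEquiv_assoc {n : ℕ} {k : Fin n → ℕ} (b : Fin (∑ i, k i) → ℕ) (i : Fin n)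
    (j : Fin (k i)) (t : Fin (b (finSigmaFinEquiv ⟨i, j⟩))) :
    Fin.cast (sum_blocks b) (finSigmaFinEquiv ⟨finSigmaFinEquiv ⟨i, j⟩, t⟩) =
      finSigmaFinEquiv (n := fun i => ∑ j, b (finSigmaFinEquiv ⟨i, j⟩)) ⟨i,
        finSigmaFinEquiv (n := fun j => b (finSigmaFinEquiv ⟨i, j⟩)) ⟨j, t⟩⟩ := by
  have h2 : ∀ i, StrictMono fun s : Fin (∑ j, b (finSigmaFinEquiv ⟨i, j⟩)) =>
      (finSigmaFinEquiv ⟨finSigmaFinEquiv ⟨i, (pos s).1⟩, (pos s).2⟩ : Fin (∑ p, b p)) := fun i =>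
    strictMono_of_sigma
      (fun q : (j : Fin (k i)) × Fin (b (finSigmaFinEquiv ⟨i, j⟩)) =>
        (finSigmaFinEquiv ⟨finSigmaFinEquiv ⟨i, q.1⟩, q.2⟩ : Fin (∑ p, b p)))
      (fun _ _ _ _ h => sigma_lt (sigma_lt' h)) (fun _ _ _ h => sigma_lt' h)
  have h1 := strictMono_of_sigma
    (fun q : (i : Fin n) × Fin (∑ j, b (finSigmaFinEquiv ⟨i, j⟩)) =>
      (finSigmaFinEquiv ⟨finSigmaFinEquiv ⟨q.1, (pos q.2).1⟩, (pos q.2).2⟩ : Fin (∑ p, b p)))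
    (fun _ _ _ _ h => sigma_lt (sigma_lt h)) (fun i _ _ h => h2 i h)
  have h := eq_cast_of_strictMono (sum_blocks b).symm h1
    (finSigmaFinEquiv (n := fun i => ∑ j, b (finSigmaFinEquiv ⟨i, j⟩)) ⟨i,
        finSigmaFinEquiv (n := fun j => b (finSigmaFinEquiv ⟨i, j⟩)) ⟨j, t⟩⟩)
  have e1 := congrArg (fun q : (i : Fin n) × Fin (∑ j, b (finSigmaFinEquiv ⟨i, j⟩)) =>
    (finSigmaFinEquiv ⟨finSigmaFinEquiv ⟨q.1, (pos q.2).1⟩, (pos q.2).2⟩ : Fin (∑ p, b p)))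
    (Equiv.symm_apply_apply (finSigmaFinEquiv (n := fun i => ∑ j, b (finSigmaFinEquiv ⟨i, j⟩)))
      ⟨i, finSigmaFinEquiv (n := fun j => b (finSigmaFinEquiv ⟨i, j⟩)) ⟨j, t⟩⟩)
  have e2 := congrArg (fun q : (j : Fin (k i)) × Fin (b (finSigmaFinEquiv ⟨i, j⟩)) =>
    (finSigmaFinEquiv ⟨finSigmaFinEquiv ⟨i, q.1⟩, q.2⟩ : Fin (∑ p, b p)))
    (Equiv.symm_apply_apply (finSigmaFinEquiv (n := fun j => b (finSigmaFinEquiv ⟨i, j⟩))) ⟨j, t⟩)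
  have e := (e1.trans e2).symm.trans h
  exact congrArg (Fin.cast (sum_blocks b)) e

/-! ### Morphisms of the category of operators with their source and target remembered -/

section OpElt

variable [MonoidalClosed V] [HasLimitsOfSize.{0, 0} V] [HasColimitsOfSize.{0, 0} V]
  {X : ℕ → V}

/-- A generalized element, with domain `W`, of some space of morphisms of the category of
operators. As the source and the target are part of the data, the laws of the ordinal sum hold as
equations, although they identify ordinals that are only propositionally equal. -/
structure OpElt (X : ℕ → V) (W : V) where
  /-- the source -/
  src : ℕ
  /-- the target -/
  tgt : ℕ
  /-- the morphism -/
  hom : W ⟶ opHom X src tgt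

theorem OpElt.mk_cast {W : V} {a a' b b' : ℕ} (ha : a = a') (hb : b = b') (f : W ⟶ opHom X a b) :
    OpElt.mk a' b' (f ≫ eqToHom (congrArg₂ (opHom X) ha hb)) = ⟨a, b, f⟩ := by
  subst ha hb
  simp

theorem OpElt.mk_inj {W : V} {a b : ℕ} {f g : W ⟶ opHom X a b}
    (h : OpElt.mk a b f = ⟨a, b, g⟩) : f = g := by
  cases h
  rfl

theorem OpElt.mk_inj_cast {W : V} {a a' b b' : ℕ} {f : W ⟶ opHom X a b} {g : W ⟶ opHom X a' b'}
    (h : OpElt.mk a b f = ⟨a', b', g⟩) (ha : a = a') (hb : b = b') :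
    f ≫ eqToHom (congrArg₂ (opHom X) ha hb) = g := by
  subst ha hb
  cases h
  simp

/-- Elements that are given by monotone maps and elements of the operad agree if the monotone
maps and the elements agree up to the identification of the ordinals. -/
theorem OpElt.mk_opMk_congr {W : V} {a a' b b' : ℕ} (ha : a = a') (hb : b = b')
    {φ : Fin a →o Fin b} {φ' : Fin a' →o Fin b'}
    (hφ : ∀ s, Fin.cast hb (φ s) = φ' (Fin.cast ha s))
    {x : ∀ t, W ⟶ X (fib φ t)} {x' : ∀ t, W ⟶ X (fib φ' t)}
    (hx : ∀ t, (⟨_, x t⟩ : Elt X W) = ⟨_, x' (Fin.cast hb t)⟩) :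
    OpElt.mk a b (opMk φ x) = ⟨a', b', opMk φ' x'⟩ := by
  subst ha hb
  exact congrArg (OpElt.mk a b) (opMk_congr (OrderHom.ext _ _ (funext hφ)) hx)

/-- Restriction of an element along a map of the domains. -/
def OpElt.pre {W W' : V} (s : W' ⟶ W) (f : OpElt X W) : OpElt X W' := ⟨f.src, f.tgt, s ≫ f.hom⟩

theorem OpElt.pre_id {W : V} (f : OpElt X W) : f.pre (𝟙 W) = f := by
  simp [OpElt.pre]

variable (A : Operad X)

/-- Composition of morphisms. -/
def OpElt.comp {W : V} (f g : OpElt X W) (h : f.tgt = g.src) : OpElt X W :=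
  ⟨f.src, g.tgt, lift f.hom (g.hom ≫ eqToHom (congrArg (fun a => opHom X a g.tgt) h.symm)) ≫
    opComp A _ _ _⟩

theorem OpElt.comp_mk {W : V} {a b c : ℕ} (f : W ⟶ opHom X a b) (g : W ⟶ opHom X b c) :
    OpElt.comp A ⟨a, b, f⟩ ⟨b, c, g⟩ rfl = ⟨a, c, lift f g ≫ opComp A a b c⟩ := by
  simp [OpElt.comp]

theorem OpElt.comp_eq {W : V} {a b c : ℕ} {F G : OpElt X W} {f : W ⟶ opHom X a b}
    {g : W ⟶ opHom X b c} (hF : F = ⟨a, b, f⟩) (hG : G = ⟨b, c, g⟩) (h : F.tgt = G.src) :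
    OpElt.comp A F G h = ⟨a, c, lift f g ≫ opComp A a b c⟩ := by
  subst hF hG
  exact OpElt.comp_mk A f g

theorem OpElt.pre_comp {W W' : V} (s : W' ⟶ W) (f g : OpElt X W) (h : f.tgt = g.src) :
    (OpElt.comp A f g h).pre s = OpElt.comp A (f.pre s) (g.pre s) h := by
  simp [OpElt.comp, OpElt.pre, comp_lift_assoc]

theorem OpElt.comp_assoc {W : V} (f g k : OpElt X W) (h : f.tgt = g.src) (h' : g.tgt = k.src) :
    OpElt.comp A (OpElt.comp A f g h) k h' = OpElt.comp A f (OpElt.comp A g k h') h := by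
  obtain ⟨a, b, f⟩ := f
  obtain ⟨b', c, g⟩ := g
  obtain ⟨c', d, k⟩ := k
  obtain rfl : b = b' := h
  obtain rfl : c = c' := h'
  exact (OpElt.comp_eq A (OpElt.comp_mk A f g) rfl _).trans ((congrArg (OpElt.mk a d)
    (opComp_assoc A a b c d f g k)).trans
    (OpElt.comp_eq A rfl (OpElt.comp_mk A g k) _).symm)

/-- The identity of `a`. -/
def OpElt.id (W : V) (a : ℕ) : OpElt X W := ⟨a, a, toUnit W ≫ opId A a⟩

theorem OpElt.pre_idElt {W W' : V} (s : W' ⟶ W) (a : ℕ) :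
    (OpElt.id A W a).pre s = OpElt.id A W' a := by
  simp [OpElt.id, OpElt.pre]

theorem OpElt.id_comp {W : V} (f : OpElt X W) (a : ℕ) (h : a = f.src) :
    OpElt.comp A (OpElt.id A W a) f h = f := by
  obtain ⟨a', b, f⟩ := f
  obtain rfl : a = a' := h
  exact (OpElt.comp_mk A _ f).trans (congrArg _ (opId_opComp A a b f))

theorem OpElt.comp_id {W : V} (f : OpElt X W) (b : ℕ) (h : f.tgt = b) :
    OpElt.comp A f (OpElt.id A W b) h = f := by
  obtain ⟨a, b', f⟩ := f
  obtain rfl : b' = b := h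
  exact (OpElt.comp_mk A f _).trans (congrArg _ (opComp_opId A a b' f))

/-- The ordinal sum of a family of morphisms. -/
def OpElt.sum {n : ℕ} {W : V} (f : Fin n → OpElt X W) : OpElt X W :=
  ⟨∑ i, (f i).src, ∑ i, (f i).tgt, (Pi.lift fun i => (f i).hom) ≫ sumHom _ _⟩

theorem OpElt.pre_sum {n : ℕ} {W W' : V} (s : W' ⟶ W) (f : Fin n → OpElt X W) :
    (OpElt.sum f).pre s = OpElt.sum fun i => (f i).pre s := by
  rw [OpElt.sum, OpElt.pre, ← Category.assoc, pi_lift_comp]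
  rfl

theorem OpElt.sum_mk_opMk {n : ℕ} {W : V} {a b : Fin n → ℕ} (φ : ∀ i, Fin (a i) →o Fin (b i))
    (x : ∀ i t, W ⟶ X (fib (φ i) t)) :
    OpElt.sum (fun i => ⟨a i, b i, opMk (φ i) (x i)⟩) =
      ⟨∑ i, a i, ∑ i, b i, opMk (sumMap φ) fun p =>
        x (pos p).1 (pos p).2 ≫ eqToHom (congrArg X (fib_sumMap φ p))⟩ := by
  rw [OpElt.sum, lift_sumHom]

/-- The component of an ordinal sum at a point `(i, t)` is the component at `t` of the `i`-th
summand. -/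
theorem sumHom_elt {n : ℕ} {W : V} {a b : Fin n → ℕ} (φ : ∀ i, Fin (a i) →o Fin (b i))
    (x : ∀ i t, W ⟶ X (fib (φ i) t)) (i : Fin n) (t : Fin (b i)) :
    (⟨_, x (pos (finSigmaFinEquiv ⟨i, t⟩)).1 (pos (finSigmaFinEquiv ⟨i, t⟩)).2 ≫
      eqToHom (congrArg X (fib_sumMap φ (finSigmaFinEquiv ⟨i, t⟩)))⟩ : Elt X W) = ⟨_, x i t⟩ :=
  (elt_cast (fib_sumMap φ _) _).trans
    (congrArg (fun q : (i : Fin n) × Fin (b i) => (⟨fib (φ q.1) q.2, x q.1 q.2⟩ : Elt X W))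
      (Equiv.symm_apply_apply (finSigmaFinEquiv (n := b)) ⟨i, t⟩))

/-- The ordinal sum is compatible with composition. -/
theorem OpElt.sum_comp {n : ℕ} {W : V} (f g : Fin n → OpElt X W) (h : ∀ i, (f i).tgt = (g i).src) :
    OpElt.sum (fun i => OpElt.comp A (f i) (g i) (h i)) =
      OpElt.comp A (OpElt.sum f) (OpElt.sum g)
        (show ∑ i, (f i).tgt = ∑ i, (g i).src from Finset.sum_congr rfl fun i _ => h i) := by
  obtain ⟨c, g', rfl⟩ : ∃ (c : Fin n → ℕ) (g' : ∀ i, W ⟶ opHom X (f i).tgt (c i)),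
      g = fun i => ⟨(f i).tgt, c i, g' i⟩ :=
    ⟨fun i => (g i).tgt, fun i => (g i).hom ≫ eqToHom (congrArg₂ (opHom X) (h i).symm rfl),
      funext fun i => (OpElt.mk_cast (h i).symm rfl (g i).hom).symm⟩
  have e := lift (Pi.lift fun i => (f i).hom) (Pi.lift g') ≫=
    (ordinalSum A n).map_comp (fun i => ⟨(f i).src⟩) (fun i => ⟨(f i).tgt⟩) (fun i => ⟨c i⟩)
  have e1 := act_ext (fun i => opComp A (f i).src (f i).tgt (c i)) (Pi.lift fun i => (f i).hom)
    (Pi.lift g')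
  simp only [Pi.lift_π] at e1
  have e2 : ∀ {Z : V} (r : _ ⟶ Z), lift (Pi.lift fun i => (f i).hom) (Pi.lift g') ≫
      ((sumHom (fun i => (f i).src) fun i => (f i).tgt) ⊗ₘ sumHom (fun i => (f i).tgt) c) ≫ r =
      lift ((Pi.lift fun i => (f i).hom) ≫ sumHom _ _) (Pi.lift g' ≫ sumHom _ _) ≫ r := fun r =>
    lift_map_assoc _ _ _ _ _
  have e3 := (congrArg (· ≫ sumHom (fun i => (f i).src) c) e1).symm.trans
    ((Category.assoc _ _ _).trans (e.trans (e2 _)))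
  refine Eq.trans ?_ ((congrArg (OpElt.mk (∑ i, (f i).src) (∑ i, c i)) e3).trans
    (OpElt.comp_eq A rfl rfl _).symm)
  exact congrArg OpElt.sum (funext fun i => OpElt.comp_eq A rfl rfl _)

/-- Two natural operations on families of morphisms agree if they agree on the families of
morphisms that are given by monotone maps and elements of the operad. -/
theorem OpElt.induction {n : ℕ} {a b : Fin n → ℕ} {W : V}
    (F G : ∀ {W' : V}, (W' ⟶ W) → (∀ i, W' ⟶ opHom X (a i) (b i)) → OpElt X W')
    (hF : ∀ {W' W'' : V} (s : W'' ⟶ W') t e, (F t e).pre s = F (s ≫ t) fun i => s ≫ e i)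
    (hG : ∀ {W' W'' : V} (s : W'' ⟶ W') t e, (G t e).pre s = G (s ≫ t) fun i => s ≫ e i)
    (hsrc : ∀ {W' : V} (t : W' ⟶ W) e, (F t e).src = (G t e).src)
    (htgt : ∀ {W' : V} (t : W' ⟶ W) e, (F t e).tgt = (G t e).tgt)
    (h : ∀ {W' : V} (t : W' ⟶ W) (φ : ∀ i, Fin (a i) →o Fin (b i))
      (x : ∀ i t, W' ⟶ X (fib (φ i) t)),
      F t (fun i => opMk (φ i) (x i)) = G t (fun i => opMk (φ i) (x i)))
    (e : ∀ i, W ⟶ opHom X (a i) (b i)) : F (𝟙 W) e = G (𝟙 W) e := by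
  -- by naturality the universal family, parametrized by the product, suffices
  have key : F (snd (∏ᶜ fun i => opHom X (a i) (b i)) W) (fun i => fst _ _ ≫ Pi.π _ i) =
      G (snd (∏ᶜ fun i => opHom X (a i) (b i)) W) (fun i => fst _ _ ≫ Pi.π _ i) := by
    have h1 := hsrc (snd (∏ᶜ fun i => opHom X (a i) (b i)) W) (fun i => fst _ _ ≫ Pi.π _ i)
    have h2 := htgt (snd (∏ᶜ fun i => opHom X (a i) (b i)) W) (fun i => fst _ _ ≫ Pi.π _ i)
    refine (OpElt.mk_cast h1 h2 _).symm.trans ?_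
    refine congrArg (OpElt.mk _ _) (opPi_ext fun φ x w => ?_)
    have h' := h w φ x
    have e1 := hF (lift (Pi.lift fun i => opMk (φ i) (x i)) w)
      (snd (∏ᶜ fun i => opHom X (a i) (b i)) W) (fun i => fst _ _ ≫ Pi.π _ i)
    have e2 := hG (lift (Pi.lift fun i => opMk (φ i) (x i)) w)
      (snd (∏ᶜ fun i => opHom X (a i) (b i)) W) (fun i => fst _ _ ≫ Pi.π _ i)
    simp only [lift_snd, lift_fst_assoc, Pi.lift_π] at e1 e2
    rw [← Category.assoc]
    exact OpElt.mk_inj_cast (e1.trans (h'.trans e2.symm)) h1 h2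
  have e1 := hF (lift (Pi.lift e) (𝟙 W))
    (snd (∏ᶜ fun i => opHom X (a i) (b i)) W) (fun i => fst _ _ ≫ Pi.π _ i)
  have e2 := hG (lift (Pi.lift e) (𝟙 W))
    (snd (∏ᶜ fun i => opHom X (a i) (b i)) W) (fun i => fst _ _ ≫ Pi.π _ i)
  simp only [lift_snd, lift_fst_assoc, Pi.lift_π] at e1 e2
  rw [← e1, ← e2, key]

/-- Associativity of the ordinal sum: the sum of a family is the sum of the sums of its blocks. -/
theorem OpElt.sum_blocks {n : ℕ} {k : Fin n → ℕ} {W : V} (f : Fin (∑ i, k i) → OpElt X W) :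
    OpElt.sum f = OpElt.sum fun i => OpElt.sum fun j => f (finSigmaFinEquiv ⟨i, j⟩) := by
  refine OpElt.induction (a := fun p => (f p).src) (b := fun p => (f p).tgt)
    (fun _ e => OpElt.sum fun p => ⟨_, _, e p⟩)
    (fun _ e => OpElt.sum fun i => OpElt.sum fun j => ⟨_, _, e (finSigmaFinEquiv ⟨i, j⟩)⟩)
    ?_ ?_ ?_ ?_ ?_ fun p => (f p).hom
  · intros
    simp only [OpElt.pre_sum]
    rfl
  · intros
    simp only [OpElt.pre_sum]
    rfl
  · intros
    exact ExtendedOperad.sum_blocks _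
  · intros
    exact ExtendedOperad.sum_blocks _
  · intro W' _ φ x
    rw [OpElt.sum_mk_opMk]
    have e : ∀ i, (OpElt.sum fun j => OpElt.mk _ _ (opMk (φ (finSigmaFinEquiv (n := k) ⟨i, j⟩))
      (x (finSigmaFinEquiv ⟨i, j⟩)))) = _ := fun i => OpElt.sum_mk_opMk
        (fun j => φ (finSigmaFinEquiv ⟨i, j⟩)) (fun j => x (finSigmaFinEquiv ⟨i, j⟩))
    simp only [e]
    rw [OpElt.sum_mk_opMk]
    refine OpElt.mk_opMk_congr (ExtendedOperad.sum_blocks _) (ExtendedOperad.sum_blocks _) ?_ ?_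
    · intro s
      obtain ⟨⟨p, t⟩, rfl⟩ := finSigmaFinEquiv.surjective s
      obtain ⟨⟨i, j⟩, rfl⟩ := finSigmaFinEquiv.surjective p
      rw [sumMap_apply, finSigmaFinEquiv_assoc, finSigmaFinEquiv_assoc, sumMap_apply, sumMap_apply]
    · intro s
      obtain ⟨⟨p, t⟩, rfl⟩ := finSigmaFinEquiv.surjective s
      obtain ⟨⟨i, j⟩, rfl⟩ := finSigmaFinEquiv.surjective p
      rw [finSigmaFinEquiv_assoc]
      refine (sumHom_elt φ x _ t).trans (Eq.trans ?_ (sumHom_elt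
        (fun i => sumMap fun j => φ (finSigmaFinEquiv ⟨i, j⟩)) (fun i p =>
          x (finSigmaFinEquiv ⟨i, (pos p).1⟩) (pos p).2 ≫ eqToHom (congrArg X
            (fib_sumMap (fun j => φ (finSigmaFinEquiv ⟨i, j⟩)) p))) i _).symm)
      exact (sumHom_elt (fun j => φ (finSigmaFinEquiv ⟨i, j⟩))
        (fun j => x (finSigmaFinEquiv ⟨i, j⟩)) j t).symm

theorem OpElt.sum_id {n : ℕ} {W : V} (a : Fin n → ℕ) :
    OpElt.sum (fun i => OpElt.id A W (a i)) = OpElt.id A W (∑ i, a i) := by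
  have e := toUnit W ≫= (ordinalSum A n).map_id (fun i => ⟨a i⟩)
  have e1 : (Pi.lift fun i => toUnit W ≫ opId A (a i)) =
      toUnit W ≫ eId V (fun i => (⟨a i⟩ : Ordinals A)) := (pi_lift_comp _ _).symm
  refine congrArg (OpElt.mk _ _) ?_
  exact (congrArg (· ≫ sumHom a a) e1).trans ((Category.assoc _ _ _).trans e)

/-- The ordinal sum of one morphism. -/
theorem OpElt.sum_one {W : V} (f : OpElt X W) : OpElt.sum (fun _ : Fin 1 => f) = f := by
  refine OpElt.induction (n := 1) (a := fun _ => f.src) (b := fun _ => f.tgt)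
    (fun _ e => OpElt.sum fun p => ⟨_, _, e p⟩) (fun _ e => ⟨_, _, e 0⟩)
    ?_ ?_ ?_ ?_ ?_ fun _ => f.hom
  · intros
    simp only [OpElt.pre_sum]
    rfl
  · intros
    rfl
  · intros
    exact Fin.sum_univ_one fun _ => f.src
  · intros
    exact Fin.sum_univ_one fun _ => f.tgt
  · intro W' _ φ x
    rw [OpElt.sum_mk_opMk]
    have e : ∀ {a : Fin 1 → ℕ} (t : Fin (a 0)),
        Fin.cast (Fin.sum_univ_one a) (finSigmaFinEquiv ⟨0, t⟩) = t := fun t => by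
      ext
      simp
    refine OpElt.mk_opMk_congr (Fin.sum_univ_one _) (Fin.sum_univ_one _) ?_ ?_
    · intro s
      obtain ⟨⟨p, t⟩, rfl⟩ := finSigmaFinEquiv.surjective s
      obtain rfl := Subsingleton.elim p 0
      rw [sumMap_apply, e, e]
    · intro s
      obtain ⟨⟨p, t⟩, rfl⟩ := finSigmaFinEquiv.surjective s
      obtain rfl := Subsingleton.elim p 0
      rw [e]
      exact sumHom_elt φ x _ t

end OpElt

/-! ### Maps out of finite products of reflexive quotients -/

section Presentation

variable [MonoidalClosed V] [HasLimitsOfSize.{0, 0} V]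

theorem lift_piCons_map {n : ℕ} {Q R : Fin (n + 1) → V} (u : ∀ i, Q i ⟶ R i) {W : V}
    (p : W ⟶ Q 0) (q : W ⟶ ∏ᶜ fun i : Fin n => Q i.succ) :
    lift (p ≫ u 0) (q ≫ Limits.Pi.map fun i : Fin n => u i.succ) ≫ piCons R =
      lift p q ≫ piCons Q ≫ Limits.Pi.map u := by
  apply Pi.hom_ext
  intro i
  refine Fin.cases ?_ (fun i => ?_) i <;> simp [piCons]

theorem lift_uncurry_comp {W P S S' Z : V} (p : W ⟶ P) (q : W ⟶ S) (r : S ⟶ S')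
    (h : S' ⟶ (ihom P).obj Z) :
    lift p (q ≫ r) ≫ uncurry h = lift p q ≫ uncurry (r ≫ h) := by
  rw [uncurry_natural_left, ← Category.assoc, lift_whiskerLeft]

/-- A finite product of reflexive quotients `Y i` of families `P i j` by relations `R i j j'` is the
quotient of the products of the `P i (j i)`, as the product with a fixed space preserves quotients
and the relations in the single variables are instances of the simultaneous relation. -/
theorem exists_piDesc_of_reflexive {n : ℕ} {J : Fin n → Type} {P : ∀ i, J i → V}
    {R : ∀ i, J i → J i → V} {Y : Fin n → V} (ι : ∀ i j, P i j ⟶ Y i)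
    (a : ∀ i j j', R i j j' ⟶ P i j') (b : ∀ i j j', R i j j' ⟶ P i j)
    (r : ∀ i j, P i j ⟶ R i j j) (ha : ∀ i j, r i j ≫ a i j j = 𝟙 _)
    (hb : ∀ i j, r i j ≫ b i j j = 𝟙 _) (epi : ∀ i, JointEpi (ι i))
    (desc : ∀ i {Z : V} (f : ∀ j, P i j ⟶ Z), (∀ j j', a i j j' ≫ f j' = b i j j' ≫ f j) →
      ∃ g : Y i ⟶ Z, ∀ j, ι i j ≫ g = f j)
    {Z : V} (f : ∀ j : ∀ i, J i, (∏ᶜ fun i => P i (j i)) ⟶ Z)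
    (hf : ∀ j j' : ∀ i, J i, (Limits.Pi.map fun i => a i (j i) (j' i)) ≫ f j' =
      (Limits.Pi.map fun i => b i (j i) (j' i)) ≫ f j) :
    ∃ g : (∏ᶜ Y) ⟶ Z, ∀ j : ∀ i, J i, (Limits.Pi.map fun i => ι i (j i)) ≫ g = f j := by
  induction n generalizing Z with
  | zero =>
    refine ⟨(Pi.lift fun i => i.elim0) ≫ f (fun i => i.elim0), fun j => ?_⟩
    obtain rfl : j = fun i => i.elim0 := funext fun i => i.elim0
    rw [← Category.assoc]
    refine (congrArg (· ≫ f fun i => i.elim0) ?_).trans (Category.id_comp _)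
    apply Pi.hom_ext
    intro i
    exact i.elim0
  | succ n ih =>
    -- the simultaneous relation on generalized elements
    have hf' : ∀ (j0 j0' : J 0) (jt jt' : ∀ i : Fin n, J i.succ) {W : V} (p : W ⟶ R 0 j0 j0')
        (q : W ⟶ ∏ᶜ fun i : Fin n => R i.succ (jt i) (jt' i)),
        lift (p ≫ a 0 j0 j0') (q ≫ Limits.Pi.map fun i : Fin n => a i.succ (jt i) (jt' i)) ≫
          piCons (fun i => P i (Fin.cons (α := J) j0' jt' i)) ≫ f (Fin.cons j0' jt') =
        lift (p ≫ b 0 j0 j0') (q ≫ Limits.Pi.map fun i : Fin n => b i.succ (jt i) (jt' i)) ≫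
          piCons (fun i => P i (Fin.cons (α := J) j0 jt i)) ≫ f (Fin.cons j0 jt) := by
      intro j0 j0' jt jt' W p q
      have h1 := lift_piCons_map (fun i => a i (Fin.cons (α := J) j0 jt i)
        (Fin.cons (α := J) j0' jt' i)) p q
      have h2 := lift_piCons_map (fun i => b i (Fin.cons (α := J) j0 jt i)
        (Fin.cons (α := J) j0' jt' i)) p q
      have h3 := hf (Fin.cons j0 jt) (Fin.cons j0' jt')
      refine (Category.assoc _ _ _).symm.trans (Eq.trans ?_ (Category.assoc _ _ _))
      refine (congrArg (· ≫ _) h1).trans (Eq.trans ?_ (congrArg (· ≫ _) h2).symm)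
      simp only [Category.assoc]
      rw [h3]
    choose g hg using fun j0 : J 0 => ih (fun i => ι i.succ) (fun i => a i.succ)
      (fun i => b i.succ) (fun i => r i.succ) (fun i => ha i.succ) (fun i => hb i.succ)
      (fun i => epi i.succ) (fun i => desc i.succ) (Z := (ihom (P 0 j0)).obj Z)
      (fun jt => curry (piCons (fun i => P i (Fin.cons (α := J) j0 jt i)) ≫ f (Fin.cons j0 jt)))
      (by
        intro jt jt'
        rw [← curry_natural_left, ← curry_natural_left]
        congr 1
        have h := hf' j0 j0 jt jt' (fst (P 0 j0) _ ≫ r 0 j0) (snd _ _)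
        simp only [Category.assoc, ha, hb, Category.comp_id] at h
        refine Eq.trans ?_ (h.trans ?_) <;>
        · refine congrArg (· ≫ _) ?_
          ext <;> simp)
    have hg' : ∀ (j0 : J 0) (jt : ∀ i : Fin n, J i.succ) {W : V} (p : W ⟶ P 0 j0)
        (q : W ⟶ ∏ᶜ fun i : Fin n => P i.succ (jt i)),
        lift p (q ≫ Limits.Pi.map fun i : Fin n => ι i.succ (jt i)) ≫ uncurry (g j0) =
          lift p q ≫ piCons (fun i => P i (Fin.cons (α := J) j0 jt i)) ≫ f (Fin.cons j0 jt) := by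
      intro j0 jt W p q
      refine (lift_uncurry_comp _ _ _ _).trans ?_
      refine (congrArg (fun t => lift p q ≫ uncurry t) (hg j0 jt)).trans ?_
      rw [uncurry_curry]
    obtain ⟨G, hG⟩ := desc 0 (Z := (ihom (∏ᶜ fun i : Fin n => Y i.succ)).obj Z)
      (fun j0 => rcurry (uncurry (g j0))) (by
        intro j0 j0'
        rw [rcurry_natural, rcurry_natural]
        congr 1
        apply curry_injective
        apply JointEpi.pi fun i : Fin n => epi i.succ
        intro jt
        rw [← curry_natural_left, ← curry_natural_left]
        congr 1
        have e : ∀ {S : V} (u : R 0 j0 j0' ⟶ S) {T : V} (k : S ⊗ _ ⟶ T),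
            (R 0 j0 j0' ◁ Limits.Pi.map fun i : Fin n => ι i.succ (jt i)) ≫
              lift (fst _ _ ≫ u) (snd _ _) ≫ k =
            lift (fst _ _ ≫ u) (snd _ _ ≫ Limits.Pi.map fun i : Fin n => ι i.succ (jt i)) ≫ k := by
          intro S u T k
          rw [← Category.assoc]
          refine congrArg (· ≫ k) ?_
          ext <;> simp
        refine (e (a 0 j0 j0') _).trans (Eq.trans ?_ (e (b 0 j0 j0') _).symm)
        rw [hg', hg']
        have h := hf' j0 j0' jt jt (fst (R 0 j0 j0') _)
          (snd _ (∏ᶜ fun i : Fin n => P i.succ (jt i)) ≫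
            Limits.Pi.map fun i : Fin n => r i.succ (jt i))
        have ea : (Limits.Pi.map fun i : Fin n => r i.succ (jt i)) ≫
            (Limits.Pi.map fun i : Fin n => a i.succ (jt i) (jt i)) = 𝟙 _ := by
          apply Pi.hom_ext
          intro i
          simp [ha]
        have eb : (Limits.Pi.map fun i : Fin n => r i.succ (jt i)) ≫
            (Limits.Pi.map fun i : Fin n => b i.succ (jt i) (jt i)) = 𝟙 _ := by
          apply Pi.hom_ext
          intro i
          simp [hb]
        rw [Category.assoc, Category.assoc, ea, eb, Category.comp_id] at h
        exact h)
    refine ⟨piUncons _ ≫ runcurry G, fun j => ?_⟩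
    obtain ⟨j0, jt, rfl⟩ : ∃ j0 jt, j = Fin.cons (α := J) j0 jt :=
      ⟨j 0, Fin.tail j, (Fin.cons_self_tail j).symm⟩
    rw [reassoc_of% piUncons_natural, ← lift_runcurry]
    have e1 := hG j0
    refine (congrArg (fun t => piUncons (fun i => P i (Fin.cons (α := J) j0 jt i)) ≫
      lift (fst (P 0 j0) (∏ᶜ fun i : Fin n => P i.succ (jt i)))
        (snd _ _ ≫ Limits.Pi.map fun i : Fin n => ι i.succ (jt i)) ≫ runcurry t) e1).trans ?_
    rw [runcurry_rcurry]
    exact (congrArg (piUncons (fun i => P i (Fin.cons (α := J) j0 jt i)) ≫ ·)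
      (hg' j0 jt (fst _ _) (snd _ _))).trans (piUncons_lift_piCons _ _)

end Presentation

/-! ### Maps out of products of left Kan extensions -/

section PiLan

variable [MonoidalClosed V] [HasLimitsOfSize.{0, 0} V] [HasColimitsOfSize.{0, 0} V]
  {n : ℕ} {C : Fin n → Type} [∀ i, EnrichedCategory V (C i)] {D : Type} [EnrichedCategory V D]

theorem pi_lift_map {P Q : Fin n → V} {W : V} (x : ∀ i, W ⟶ P i) (u : ∀ i, P i ⟶ Q i) :
    Pi.lift x ≫ Limits.Pi.map u = Pi.lift fun i => x i ≫ u i := by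
  apply Pi.hom_ext
  intro i
  simp

/-- Maps out of a finite product of left Kan extensions are given by maps out of the products of
the spaces of generators that respect the defining relations. -/
theorem exists_piDesc_lan (J : ∀ i, EnrichedFunctor V (C i) D)
    (F : ∀ i, EnrichedFunctor V (C i) V) (d : Fin n → D) {Q Z : V}
    (f : ∀ c : ∀ i, C i, (∏ᶜ fun i => (F i).obj (c i) ⊗ ((J i).obj (c i) ⟶[V] d i)) ⊗ Q ⟶ Z)
    (hf : ∀ {W : V} (c c' : ∀ i, C i) (x : ∀ i, W ⟶ (F i).obj (c i))
      (φ : ∀ i, W ⟶ (c i ⟶[V] c' i)) (g : ∀ i, W ⟶ ((J i).obj (c' i) ⟶[V] d i)) (w : W ⟶ Q),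
      lift (Pi.lift fun i => lift (lift (x i) (φ i) ≫ act (F i) _ _) (g i)) w ≫ f c' =
      lift (Pi.lift fun i => lift (x i) (lift (φ i ≫ (J i).map _ _) (g i) ≫ eComp V _ _ _)) w ≫
        f c) :
    ∃ h : (∏ᶜ fun i => lanObj (J i) (F i) (d i)) ⊗ Q ⟶ Z, ∀ {W : V} (c : ∀ i, C i)
      (x : ∀ i, W ⟶ (F i).obj (c i)) (g : ∀ i, W ⟶ ((J i).obj (c i) ⟶[V] d i)) (w : W ⟶ Q),
      lift (Pi.lift fun i => lift (x i) (g i) ≫ lanι (J i) (F i) (c i) (d i)) w ≫ h =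
        lift (Pi.lift fun i => lift (x i) (g i)) w ≫ f c := by
  obtain ⟨h, hh⟩ := exists_piDesc_of_reflexive
    (P := fun i c => (F i).obj c ⊗ ((J i).obj c ⟶[V] d i))
    (R := fun i c c' => ((F i).obj c ⊗ (c ⟶[V] c')) ⊗ ((J i).obj c' ⟶[V] d i))
    (Y := fun i => lanObj (J i) (F i) (d i))
    (fun i c => lanι (J i) (F i) c (d i))
    (fun i c c' => lift (fst _ _ ≫ act (F i) c c') (snd _ _))
    (fun i c c' => lift (fst _ _ ≫ fst _ _)
      (lift (fst _ _ ≫ snd _ _ ≫ (J i).map c c') (snd _ _) ≫ eComp V _ _ _))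
    (fun i c => lift (lift (fst _ _) (toUnit _ ≫ eId V c)) (snd _ _))
    (fun i c => by
      simp only [comp_lift, lift_fst_assoc, lift_snd, act_eId, lift_fst_snd])
    (fun i c => by
      simp only [comp_lift, comp_lift_assoc, lift_fst_assoc, lift_snd, lift_snd_assoc, lift_fst,
        Category.assoc, (J i).map_id, lift_eId_eComp, lift_fst_snd])
    (fun i => lanι_jointEpi (J i) (F i) (d i))
    (fun i Z f hf => by
      refine ⟨lanDescAux (J i) (Sigma.desc f) ?_, fun c => ?_⟩
      · apply Sigma.hom_ext
        rintro ⟨c, c'⟩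
        rw [lanLeft, lanRight, Sigma.ι_desc_assoc, Sigma.ι_desc_assoc, Category.assoc,
          Category.assoc, Sigma.ι_desc, Sigma.ι_desc]
        exact hf c c'
      · rw [lanι, Category.assoc, lanπ_lanDescAux, Sigma.ι_desc])
    (Z := (ihom Q).obj Z) (fun c => rcurry (f c)) (by
      intro c c'
      rw [rcurry_natural, rcurry_natural]
      congr 1
      have h := hf c c' (fun i => fst (∏ᶜ fun i => ((F i).obj (c i) ⊗ (c i ⟶[V] c' i)) ⊗
        ((J i).obj (c' i) ⟶[V] d i)) Q ≫ Pi.π _ i ≫ fst _ _ ≫ fst _ _)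
        (fun i => fst _ _ ≫ Pi.π _ i ≫ fst _ _ ≫ snd _ _)
        (fun i => fst _ _ ≫ Pi.π _ i ≫ snd _ _) (snd _ _)
      refine Eq.trans ?_ (h.trans ?_)
      · refine congrArg (fun t => lift t (snd _ _) ≫ f c') ?_
        apply Pi.hom_ext
        intro i
        simp only [Category.assoc, Pi.map_π, Pi.lift_π, comp_lift, comp_lift_assoc]
        refine congrArg (fun t => lift t _) ?_
        simp only [← Category.assoc]
        refine congrArg (· ≫ _) ?_
        ext <;> simp
      · refine congrArg (fun t => lift t (snd _ _) ≫ f c) ?_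
        apply Pi.hom_ext
        intro i
        simp only [Category.assoc, Pi.map_π, Pi.lift_π, comp_lift, comp_lift_assoc])
  refine ⟨runcurry h, fun c x g w => ?_⟩
  have e := pi_lift_map (fun i => lift (x i) (g i)) fun i => lanι (J i) (F i) (c i) (d i)
  rw [← e, ← lift_runcurry, hh, runcurry_rcurry]

/-- Maps out of a finite product of left Kan extensions, with a parameter, agree if they agree on
the families of generators. -/
theorem piLan_ext {J : ∀ i, EnrichedFunctor V (C i) D} {F : ∀ i, EnrichedFunctor V (C i) V}
    {d : Fin n → D} {W Z : V} {f g : (∏ᶜ fun i => lanObj (J i) (F i) (d i)) ⊗ W ⟶ Z}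
    (h : ∀ {W' : V} (c : ∀ i, C i) (x : ∀ i, W' ⟶ (F i).obj (c i))
      (p : ∀ i, W' ⟶ ((J i).obj (c i) ⟶[V] d i)) (w : W' ⟶ W),
      lift (Pi.lift fun i => lift (x i) (p i) ≫ lanι (J i) (F i) (c i) (d i)) w ≫ f =
      lift (Pi.lift fun i => lift (x i) (p i) ≫ lanι (J i) (F i) (c i) (d i)) w ≫ g) : f = g := by
  apply (JointEpi.pi fun i : Fin n => lanι_jointEpi (J i) (F i) (d i)).tensor
  intro c
  have e : fst (∏ᶜ fun i => (F i).obj (c i) ⊗ ((J i).obj (c i) ⟶[V] d i)) W ≫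
      (Limits.Pi.map fun i => lanι (J i) (F i) (c i) (d i)) =
      Pi.lift fun i => lift (fst _ _ ≫ Pi.π _ i ≫ fst _ _) (fst _ _ ≫ Pi.π _ i ≫ snd _ _) ≫
        lanι (J i) (F i) (c i) (d i) := by
    apply Pi.hom_ext
    intro i
    simp only [Category.assoc, Pi.map_π, Pi.lift_π, ← comp_lift, lift_fst_snd, Category.comp_id]
  rw [e]
  exact h _ _ _ _

end PiLan

/-! ### Elements of the values of continuous functors on the category of operators -/

section Elements

variable [MonoidalClosed V] [HasLimitsOfSize.{0, 0} V] [HasColimitsOfSize.{0, 0} V]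
  {X : ℕ → V}

/-- A generalized element, with domain `W`, of some member of a family of spaces. -/
abbrev GElt {I : Type} (T : I → V) (W : V) := (i : I) × (W ⟶ T i)

/-- Restriction of an element along a map of the domains. -/
def GElt.pre {I : Type} {T : I → V} {W W' : V} (s : W' ⟶ W) (x : GElt T W) : GElt T W' :=
  ⟨x.1, s ≫ x.2⟩

theorem GElt.mk_cast {I : Type} {T : I → V} {W : V} {i j : I} (h : i = j) (f : W ⟶ T i) :
    (⟨j, f ≫ eqToHom (congrArg T h)⟩ : GElt T W) = ⟨i, f⟩ := by
  subst h
  simp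

theorem GElt.cast_eq {I : Type} {T : I → V} {W : V} {x y : GElt T W} (h : x = y)
    (hi : x.1 = y.1) : x.2 ≫ eqToHom (congrArg T hi) = y.2 := by
  subst h
  simp

theorem GElt.mk_inj {I : Type} {T : I → V} {W : V} {i : I} {f g : W ⟶ T i}
    (h : (⟨i, f⟩ : GElt T W) = ⟨i, g⟩) : f = g :=
  eq_of_heq (Sigma.mk.inj h).2

variable {A : Operad X}

/-- A generalized element of some value of a continuous functor on the category of operators. -/
abbrev PtElt (F : EnrichedFunctor V (Ordinals A) V) (W : V) := GElt F.obj W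

/-- The action of a morphism of the category of operators on an element. -/
def PtElt.act {F : EnrichedFunctor V (Ordinals A) V} {W : V} (x : PtElt F W) (f : OpElt X W)
    (h : x.1.len = f.src) : PtElt F W :=
  ⟨⟨f.tgt⟩, lift x.2 (show W ⟶ (x.1 ⟶[V] ⟨f.tgt⟩) from
    f.hom ≫ eqToHom (congrArg (fun a => opHom X a f.tgt) h.symm)) ≫
      ExtendedOperad.act F x.1 ⟨f.tgt⟩⟩

theorem PtElt.act_mk {F : EnrichedFunctor V (Ordinals A) V} {W : V} {U U' : Ordinals A}
    (x : W ⟶ F.obj U) (f : W ⟶ (U ⟶[V] U')) :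
    PtElt.act (⟨U, x⟩ : PtElt F W) ⟨U.len, U'.len, f⟩ rfl =
      ⟨U', lift x f ≫ ExtendedOperad.act F U U'⟩ := by
  have e : f ≫ eqToHom (rfl : opHom X U.len U'.len = opHom X U.len U'.len) = f :=
    Category.comp_id _
  exact congrArg (fun t => (⟨U', lift x t ≫ ExtendedOperad.act F U U'⟩ : PtElt F W)) e

theorem PtElt.act_congr {F : EnrichedFunctor V (Ordinals A) V} {W : V} {x x' : PtElt F W}
    {f f' : OpElt X W} (hx : x = x') (hf : f = f') (h : x.1.len = f.src) :
    x.act f h = x'.act f' (hx ▸ hf ▸ h) := by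
  subst hx hf
  rfl

theorem PtElt.pre_act {F : EnrichedFunctor V (Ordinals A) V} {W W' : V} (s : W' ⟶ W)
    (x : PtElt F W) (f : OpElt X W) (h : x.1.len = f.src) :
    (x.act f h).pre s = PtElt.act (x.pre s) (f.pre s) h := by
  obtain ⟨⟨a⟩, x⟩ := x
  obtain ⟨a', b, f⟩ := f
  obtain rfl : a = a' := h
  refine (congrArg (GElt.pre s) (PtElt.act_mk (U' := ⟨b⟩) x f)).trans ?_
  refine Eq.trans ?_ (PtElt.act_mk (U := ⟨a⟩) (U' := ⟨b⟩) (s ≫ x) (s ≫ f)).symm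
  refine congrArg (Sigma.mk (⟨b⟩ : Ordinals A)) ?_
  exact comp_lift_assoc _ _ _ _

/-- The element of the left Kan extension along the ordinal sum functor that is represented by
elements `x i` and a morphism `g` from the ordinal sum of their ordinals. -/
def convGen {n : ℕ} {G : Fin n → EnrichedFunctor V (Ordinals A) V} {W : V}
    (x : ∀ i, PtElt (G i) W) (g : OpElt X W) (h : ∑ i, (x i).1.len = g.src) :
    PtElt (lan (ordinalSum A n) (extProd G)) W :=
  ⟨⟨g.tgt⟩, lift (show W ⟶ (extProd G).obj (fun i => (x i).1) from Pi.lift fun i => (x i).2)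
    (show W ⟶ ((ordinalSum A n).obj (fun i => (x i).1) ⟶[V] ⟨g.tgt⟩) from
      g.hom ≫ eqToHom (congrArg (fun a => opHom X a g.tgt) h.symm)) ≫
      lanι (ordinalSum A n) (extProd G) (fun i => (x i).1) ⟨g.tgt⟩⟩

theorem convGen_mk {n : ℕ} {G : Fin n → EnrichedFunctor V (Ordinals A) V} {W : V}
    {U : Fin n → Ordinals A} {d : Ordinals A} (x : ∀ i, W ⟶ (G i).obj (U i))
    (g : W ⟶ ((ordinalSum A n).obj U ⟶[V] d)) :
    convGen (G := G) (fun i => ⟨U i, x i⟩) ⟨∑ i, (U i).len, d.len, g⟩ rfl =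
      ⟨d, lift (show W ⟶ (extProd G).obj U from Pi.lift x) g ≫
        lanι (ordinalSum A n) (extProd G) U d⟩ := by
  have e : g ≫ eqToHom (rfl : opHom X (∑ i, (U i).len) d.len = opHom X (∑ i, (U i).len) d.len) =
    g := Category.comp_id _
  exact congrArg (fun t => (⟨d, lift (show W ⟶ (extProd G).obj U from Pi.lift x) t ≫
        lanι (ordinalSum A n) (extProd G) U d⟩ :
          PtElt (lan (ordinalSum A n) (extProd G)) W)) e

theorem convGen_congr {n : ℕ} {G : Fin n → EnrichedFunctor V (Ordinals A) V} {W : V}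
    {x x' : ∀ i, PtElt (G i) W} {g g' : OpElt X W} (hx : ∀ i, x i = x' i) (hg : g = g')
    (h : ∑ i, (x i).1.len = g.src) (h' : ∑ i, (x' i).1.len = g'.src) :
    convGen x g h = convGen x' g' h' := by
  obtain rfl := funext hx
  subst hg
  rfl

theorem pre_convGen {n : ℕ} {G : Fin n → EnrichedFunctor V (Ordinals A) V} {W W' : V}
    (s : W' ⟶ W) (x : ∀ i, PtElt (G i) W) (g : OpElt X W) (h : ∑ i, (x i).1.len = g.src) :
    (convGen x g h).pre s = convGen (fun i => (x i).pre s) (g.pre s) h := by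
  refine congrArg (Sigma.mk (⟨g.tgt⟩ : Ordinals A)) ?_
  refine (comp_lift_assoc _ _ _ _).trans ?_
  refine congrArg (· ≫ _) ?_
  exact congrArg₂ lift (pi_lift_comp _ _) (Category.assoc _ _ _).symm

/-- The category of operators acts on the Kan extension by composition. -/
theorem act_convGen {n : ℕ} {G : Fin n → EnrichedFunctor V (Ordinals A) V} {W : V}
    (x : ∀ i, PtElt (G i) W) (g f : OpElt X W) (h : ∑ i, (x i).1.len = g.src)
    (h' : g.tgt = f.src) :
    (convGen x g h).act f h' = convGen x (OpElt.comp A g f h') h := by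
  obtain ⟨a, b, g⟩ := g
  obtain rfl : ∑ i, (x i).1.len = a := h
  obtain ⟨b', c, f⟩ := f
  obtain rfl : b = b' := h'
  refine (PtElt.act_congr (convGen_mk (G := G) (d := ⟨b⟩) (fun i => (x i).2) g) rfl _).trans ?_
  refine (PtElt.act_mk (U := ⟨b⟩) (U' := ⟨c⟩) _ f).trans ?_
  refine Eq.trans ?_ (convGen_congr (fun _ => rfl) (OpElt.comp_mk A g f) _ rfl).symm
  refine Eq.trans ?_ (convGen_mk (G := G) (d := ⟨c⟩) (fun i => (x i).2) _).symm
  refine congrArg (Sigma.mk (⟨c⟩ : Ordinals A)) ?_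
  exact lift_act_lan (ordinalSum A n) (extProd G) _ _ _

/-- The relation that defines the Kan extension. -/
theorem convGen_act {n : ℕ} {G : Fin n → EnrichedFunctor V (Ordinals A) V} {W : V}
    (x : ∀ i, PtElt (G i) W) (f : Fin n → OpElt X W) (hf : ∀ i, (x i).1.len = (f i).src)
    (g : OpElt X W) (h : ∑ i, (f i).tgt = g.src) :
    convGen (fun i => (x i).act (f i) (hf i)) g h = convGen x (OpElt.comp A (OpElt.sum f) g h)
      (Finset.sum_congr rfl fun i _ => hf i) := by
  obtain ⟨a, c, g⟩ := g
  obtain rfl : ∑ i, (f i).tgt = a := h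
  obtain ⟨b, f', rfl⟩ : ∃ (b : Fin n → ℕ) (f' : ∀ i, W ⟶ opHom X (x i).1.len (b i)),
      f = fun i => ⟨(x i).1.len, b i, f' i⟩ :=
    ⟨fun i => (f i).tgt, fun i => (f i).hom ≫ eqToHom (congrArg₂ (opHom X) (hf i).symm rfl),
      funext fun i => (OpElt.mk_cast (hf i).symm rfl (f i).hom).symm⟩
  refine (convGen_congr (fun i => PtElt.act_mk (U' := ⟨b i⟩) (x i).2 (f' i)) rfl _ rfl).trans ?_
  refine (convGen_mk (G := G) (U := fun i => ⟨b i⟩) (d := ⟨c⟩) _ g).trans ?_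
  refine Eq.trans ?_ (convGen_congr (fun _ => rfl) (OpElt.comp_eq A rfl rfl _) _ rfl).symm
  refine Eq.trans ?_ (convGen_mk (G := G) (d := ⟨c⟩) (fun i => (x i).2) _).symm
  refine congrArg (Sigma.mk (⟨c⟩ : Ordinals A)) ?_
  have e := lanι_act (ordinalSum A n) (extProd G) (c := fun i => (x i).1) (c' := fun i => ⟨b i⟩)
    (d := ⟨c⟩) (Pi.lift fun i => (x i).2) (Pi.lift f') g
  refine Eq.trans ?_ e
  refine congrArg (fun t => lift t g ≫ _) ?_
  refine Eq.trans ?_ (lift_act_extProd G _ _).symm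
  refine congrArg Pi.lift (funext fun i => ?_)
  rw [Pi.lift_π, Pi.lift_π]

end Elements

/-! ### Iterated Kan extensions along the ordinal sum functors -/

section Powers

variable [MonoidalClosed V] [HasLimitsOfSize.{0, 0} V] [HasColimitsOfSize.{0, 0} V]
  {X : ℕ → V} {A : Operad X}

theorem apply_pos {n : ℕ} {k : Fin n → ℕ} {α : Sort*} (f : ∀ i, Fin (k i) → α) (i : Fin n)
    (j : Fin (k i)) :
    f (pos (finSigmaFinEquiv ⟨i, j⟩)).1 (pos (finSigmaFinEquiv ⟨i, j⟩)).2 = f i j :=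
  congrArg (fun q : (i : Fin n) × Fin (k i) => f q.1 q.2)
    (Equiv.symm_apply_apply (finSigmaFinEquiv (n := k)) ⟨i, j⟩)

theorem OpElt.comp_congr {W : V} {f f' g g' : OpElt X W} (hf : f = f') (hg : g = g')
    (h : f.tgt = g.src) (h' : f'.tgt = g'.src) : OpElt.comp A f g h = OpElt.comp A f' g' h' := by
  subst hf hg
  rfl

theorem OpElt.sum_pos {n : ℕ} {k : Fin n → ℕ} {W : V} (f : ∀ i, Fin (k i) → OpElt X W) :
    OpElt.sum (fun p : Fin (∑ i, k i) => f (pos p).1 (pos p).2) =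
      OpElt.sum fun i => OpElt.sum (f i) := by
  rw [OpElt.sum_blocks]
  exact congrArg OpElt.sum (funext fun i => congrArg OpElt.sum (funext fun j => apply_pos f i j))

/-- The `n`-th power of a continuous functor with respect to the convolution product: the left Kan
extension of the `n`-fold external product along the ordinal sum functor. -/
abbrev power (E : EnrichedFunctor V (Ordinals A) V) (n : ℕ) : EnrichedFunctor V (Ordinals A) V :=
  lan (ordinalSum A n) (extProd fun _ : Fin n => E)

variable {E : EnrichedFunctor V (Ordinals A) V}

/-- A generalized element of some value of some power of `E`. -/
abbrev PowElt (E : EnrichedFunctor V (Ordinals A) V) (W : V) :=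
  GElt (fun q : ℕ × Ordinals A => (power E q.1).obj q.2) W

/-- An element of a value of the `n`-th power, with `n` remembered. -/
def PtElt.toPow {W : V} (n : ℕ) (y : PtElt (power E n) W) : PowElt E W := ⟨(n, y.1), y.2⟩

theorem PtElt.toPow_inj {W : V} {n : ℕ} {y y' : PtElt (power E n) W} (h : y.toPow n = y'.toPow n) :
    y = y' := by
  obtain ⟨d, y⟩ := y
  obtain ⟨d', y'⟩ := y'
  cases h
  rfl

theorem toPow_convGen_congr {W : V} {n n' : ℕ} (hn : n = n') {x : Fin n → PtElt E W}
    {x' : Fin n' → PtElt E W} {g g' : OpElt X W} (hx : ∀ i, x i = x' (Fin.cast hn i)) (hg : g = g')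
    (h : ∑ i, (x i).1.len = g.src) (h' : ∑ i, (x' i).1.len = g'.src) :
    (convGen x g h).toPow n = (convGen x' g' h').toPow n' := by
  subst hn
  exact congrArg (PtElt.toPow n) (convGen_congr hx hg h h')

/-- The element of the power of exponent `k 0 + ... + k (n - 1)` that corresponds to a generator of
the iterated Kan extension. -/
def flatGen {n : ℕ} {k : Fin n → ℕ} {W : V} (x : ∀ i, Fin (k i) → PtElt E W) (g : Fin n → OpElt X W)
    (hg : ∀ i, ∑ j, (x i j).1.len = (g i).src) (w : OpElt X W) (hw : ∑ i, (g i).tgt = w.src) :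
    PtElt (power E (∑ i, k i)) W :=
  convGen (fun p => x (pos p).1 (pos p).2) (OpElt.comp A (OpElt.sum g) w hw)
    ((ExtendedOperad.sum_pos fun i j => (x i j).1.len).symm.trans
      (Finset.sum_congr rfl fun i _ => hg i))

theorem flatGen_congr {n : ℕ} {k : Fin n → ℕ} {W : V} {x x' : ∀ i, Fin (k i) → PtElt E W}
    {g g' : Fin n → OpElt X W} {w w' : OpElt X W} (ex : ∀ i j, x i j = x' i j)
    (eg : ∀ i, g i = g' i) (ew : w = w') (hg : ∀ i, ∑ j, (x i j).1.len = (g i).src)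
    (hg' : ∀ i, ∑ j, (x' i j).1.len = (g' i).src) (hw : ∑ i, (g i).tgt = w.src)
    (hw' : ∑ i, (g' i).tgt = w'.src) : flatGen x g hg w hw = flatGen x' g' hg' w' hw' := by
  obtain rfl : x = x' := funext fun i => funext (ex i)
  obtain rfl := funext eg
  subst ew
  rfl

theorem pre_flatGen {n : ℕ} {k : Fin n → ℕ} {W W' : V} (s : W' ⟶ W)
    (x : ∀ i, Fin (k i) → PtElt E W) (g : Fin n → OpElt X W)
    (hg : ∀ i, ∑ j, (x i j).1.len = (g i).src) (w : OpElt X W) (hw : ∑ i, (g i).tgt = w.src) :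
    (flatGen x g hg w hw).pre s =
      flatGen (fun i j => (x i j).pre s) (fun i => (g i).pre s) hg (w.pre s) hw := by
  refine (pre_convGen s _ _ _).trans (convGen_congr (fun _ => rfl) ?_ _ _)
  exact (OpElt.pre_comp A s _ _ _).trans (OpElt.comp_congr (OpElt.pre_sum s g) rfl _ _)

/-- The flattening of generators respects the defining relations of the powers. -/
theorem flatGen_act {n : ℕ} {k : Fin n → ℕ} {W : V} (x : ∀ i, Fin (k i) → PtElt E W)
    (f : ∀ i, Fin (k i) → OpElt X W) (hf : ∀ i j, (x i j).1.len = (f i j).src)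
    (g : Fin n → OpElt X W) (hg : ∀ i, ∑ j, (f i j).tgt = (g i).src) (w : OpElt X W)
    (hw : ∑ i, (g i).tgt = w.src) :
    flatGen (fun i j => (x i j).act (f i j) (hf i j)) g hg w hw =
      flatGen x (fun i => OpElt.comp A (OpElt.sum (f i)) (g i) (hg i))
        (fun i => Finset.sum_congr rfl fun j _ => hf i j) w hw := by
  have e0 : ∑ p : Fin (∑ i, k i), (f (pos p).1 (pos p).2).tgt = ∑ i, (g i).src :=
    (ExtendedOperad.sum_pos fun i j => (f i j).tgt).symm.trans
      (Finset.sum_congr rfl fun i _ => hg i)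
  have e1 : OpElt.comp A (OpElt.sum fun i => OpElt.comp A (OpElt.sum (f i)) (g i) (hg i)) w hw =
      OpElt.comp A (OpElt.sum fun p : Fin (∑ i, k i) => f (pos p).1 (pos p).2)
        (OpElt.comp A (OpElt.sum g) w hw) e0 := by
    refine (OpElt.comp_congr ((OpElt.sum_comp A (fun i => OpElt.sum (f i)) g hg).trans
      (OpElt.comp_congr (OpElt.sum_pos f).symm rfl _
        (show (OpElt.sum fun p : Fin (∑ i, k i) => f (pos p).1 (pos p).2).tgt = (OpElt.sum g).src
          from e0))) rfl _ hw).trans ?_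
    exact OpElt.comp_assoc A _ _ _ _ _
  exact (convGen_act (fun p : Fin (∑ i, k i) => x (pos p).1 (pos p).2)
    (fun p => f (pos p).1 (pos p).2) (fun p => hf _ _) _ e0).trans
    (convGen_congr (fun _ => rfl) e1.symm _ _)

theorem lift_piLift_fst {n : ℕ} {P : Fin n → V} {W R Z : V} (x : ∀ i, W ⟶ P i) (w : W ⟶ R)
    (i : Fin n) (r : P i ⟶ Z) : lift (Pi.lift x) w ≫ fst _ _ ≫ Pi.π P i ≫ r = x i ≫ r := by
  simp

/-- The flattening of generators is given by maps out of the product of the values of the powers. -/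
theorem exists_flatten (E : EnrichedFunctor V (Ordinals A) V) {n : ℕ} (k : Fin n → ℕ)
    (U : Fin n → Ordinals A) (d : Ordinals A) :
    ∃ h : (∏ᶜ fun i => (power E (k i)).obj (U i)) ⊗ opHom X (∑ i, (U i).len) d.len ⟶
        (power E (∑ i, k i)).obj d,
      ∀ {W : V} (T : ∀ i, Fin (k i) → Ordinals A) (x : ∀ i j, W ⟶ E.obj (T i j))
        (g : ∀ i, W ⟶ opHom X (∑ j, (T i j).len) (U i).len)
        (w : W ⟶ opHom X (∑ i, (U i).len) d.len),
        lift (Pi.lift fun i => lift (show W ⟶ (extProd fun _ : Fin (k i) => E).obj (T i) from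
          Pi.lift (x i)) (g i) ≫
          lanι (ordinalSum A (k i)) (extProd fun _ : Fin (k i) => E) (T i) (U i)) w ≫ h =
        (flatGen (fun i j => ⟨T i j, x i j⟩) (fun i => ⟨_, _, g i⟩) (fun _ => rfl)
          ⟨_, _, w⟩ rfl).2 := by
  -- the value at the universal family of generators
  let u : ∀ T : ∀ i, Fin (k i) → Ordinals A, PtElt (power E (∑ i, k i))
      ((∏ᶜ fun i => (extProd fun _ : Fin (k i) => E).obj (T i) ⊗
        ((ordinalSum A (k i)).obj (T i) ⟶[V] U i)) ⊗ opHom X (∑ i, (U i).len) d.len) := fun T =>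
    flatGen (fun i j => ⟨T i j, fst _ _ ≫ Pi.π (fun i =>
        (extProd fun _ : Fin (k i) => E).obj (T i) ⊗ ((ordinalSum A (k i)).obj (T i) ⟶[V] U i)) i ≫
        fst _ _ ≫ Pi.π (fun j => E.obj (T i j)) j⟩)
      (fun i => ⟨_, _, fst _ _ ≫ Pi.π (fun i =>
        (extProd fun _ : Fin (k i) => E).obj (T i) ⊗ ((ordinalSum A (k i)).obj (T i) ⟶[V] U i)) i ≫
        snd _ _⟩) (fun _ => rfl) ⟨_, _, snd _ _⟩ rfl
  let f : ∀ T : ∀ i, Fin (k i) → Ordinals A,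
      (∏ᶜ fun i => (extProd fun _ : Fin (k i) => E).obj (T i) ⊗
        ((ordinalSum A (k i)).obj (T i) ⟶[V] U i)) ⊗ opHom X (∑ i, (U i).len) d.len ⟶
        (power E (∑ i, k i)).obj d := fun T => (u T).2
  have hf : ∀ {W : V} (T : ∀ i, Fin (k i) → Ordinals A)
      (x : ∀ i, W ⟶ (extProd fun _ : Fin (k i) => E).obj (T i))
      (g : ∀ i, W ⟶ opHom X (∑ j, (T i j).len) (U i).len)
      (w : W ⟶ opHom X (∑ i, (U i).len) d.len),
      (⟨d, lift (Pi.lift fun i => lift (x i) (g i)) w ≫ f T⟩ : PtElt (power E (∑ i, k i)) W) =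
        flatGen (fun i j => ⟨T i j, x i ≫ Pi.π (fun j => E.obj (T i j)) j⟩)
          (fun i => ⟨_, _, g i⟩) (fun _ => rfl) ⟨_, _, w⟩ rfl := by
    intro W T x g w
    change GElt.pre (lift (Pi.lift fun i => lift (x i) (g i)) w) (u T) = _
    refine (pre_flatGen _ _ _ _ _ _).trans ?_
    refine flatGen_congr (fun i j => ?_) (fun i => ?_) ?_ _ _ _ _
    · refine congrArg (Sigma.mk (T i j)) ?_
      exact (lift_piLift_fst _ _ i _).trans (lift_fst_assoc _ _ _)
    · refine congrArg (OpElt.mk _ _) ?_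
      exact (lift_piLift_fst _ _ i _).trans (lift_snd _ _)
    · exact congrArg (OpElt.mk _ _) (lift_snd _ _)
  obtain ⟨h, hh⟩ := exists_piDesc_lan (fun i => ordinalSum A (k i))
    (fun i => extProd fun _ : Fin (k i) => E) U f (by
      intro W T T' x φ g w
      apply GElt.mk_inj (T := (power E (∑ i, k i)).obj)
      refine (hf T' _ g w).trans (Eq.trans ?_ (hf T x _ w).symm)
      have e1 := flatGen_act
        (fun i j => (⟨T i j, x i ≫ Pi.π (fun j => E.obj (T i j)) j⟩ : PtElt E W))
        (fun i j => ⟨(T i j).len, (T' i j).len, φ i ≫ Pi.π (fun j => (T i j ⟶[V] T' i j)) j⟩)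
        (fun i j => rfl) (fun i => ⟨_, _, g i⟩) (fun i => rfl) ⟨_, _, w⟩ rfl
      refine Eq.trans ?_ (e1.trans ?_)
      · refine flatGen_congr (fun i j => ?_) (fun _ => rfl) rfl _ _ _ _
        refine Eq.trans ?_ (PtElt.act_mk _ _).symm
        refine congrArg (Sigma.mk (T' i j)) ?_
        refine (congrArg (· ≫ Pi.π (fun j => E.obj (T' i j)) j)
          (lift_act_extProd (fun _ : Fin (k i) => E) (x i) (φ i))).trans ?_
        exact Pi.lift_π _ _
      · refine flatGen_congr (fun _ _ => rfl) (fun i => ?_) rfl _ _ _ _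
        refine OpElt.comp_eq A (congrArg (OpElt.mk _ _) ?_) rfl _
        refine congrArg (· ≫ sumHom _ _) ?_
        apply Pi.hom_ext
        intro j
        exact Pi.lift_π _ _)
  refine ⟨h, fun {W} T x g w => ?_⟩
  refine (hh T _ g w).trans ?_
  apply GElt.mk_inj (T := (power E (∑ i, k i)).obj)
  refine (hf T _ g w).trans ?_
  change _ = flatGen (fun i j => (⟨T i j, x i j⟩ : PtElt E W)) (fun i => ⟨_, _, g i⟩)
    (fun _ => rfl) ⟨_, _, w⟩ rfl
  refine flatGen_congr (fun i j => ?_) (fun _ => rfl) rfl _ _ _ _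
  exact congrArg (Sigma.mk (T i j)) (Pi.lift_π _ _)

end Powers

/-! ### Flattening of elements of iterated Kan extensions -/

section Nesting

variable [MonoidalClosed V] [HasLimitsOfSize.{0, 0} V] [HasColimitsOfSize.{0, 0} V]
  {X : ℕ → V} {A : Operad X}

theorem piLift_comp_π {n : ℕ} {P : Fin n → V} {W : V} (x : W ⟶ ∏ᶜ P) :
    (Pi.lift fun i => x ≫ Pi.π P i) = x := by
  apply Pi.hom_ext
  intro i
  simp

/-- Maps out of a value of a Kan extension, with a parameter, agree if they agree on the
generators. -/
theorem conv_ext {n : ℕ} {G : Fin n → EnrichedFunctor V (Ordinals A) V} {d : Ordinals A} {Q Z : V}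
    {f g : (lan (ordinalSum A n) (extProd G)).obj d ⊗ Q ⟶ Z}
    (h : ∀ {W : V} (e : W ⟶ (lan (ordinalSum A n) (extProd G)).obj d) (q : W ⟶ Q)
      (x : ∀ i, PtElt (G i) W) (w : OpElt X W) (hw : ∑ i, (x i).1.len = w.src),
      (⟨d, e⟩ : PtElt (lan (ordinalSum A n) (extProd G)) W) = convGen x w hw →
        lift e q ≫ f = lift e q ≫ g) : f = g := by
  refine lan_ext (J := ordinalSum A n) (F := extProd G) fun {W} U x w q => ?_
  refine h _ q (fun i => ⟨U i, x ≫ Pi.π (fun i => (G i).obj (U i)) i⟩) ⟨_, d.len, w⟩ rfl ?_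
  refine Eq.trans ?_ (convGen_mk _ w).symm
  refine congrArg (Sigma.mk d) (congrArg (fun t => lift t w ≫ _) ?_)
  exact (piLift_comp_π _).symm

theorem conv_hom_ext {n : ℕ} {G : Fin n → EnrichedFunctor V (Ordinals A) V} {d : Ordinals A}
    {Z : V} {f g : (lan (ordinalSum A n) (extProd G)).obj d ⟶ Z}
    (h : ∀ {W : V} (e : W ⟶ (lan (ordinalSum A n) (extProd G)).obj d)
      (x : ∀ i, PtElt (G i) W) (w : OpElt X W) (hw : ∑ i, (x i).1.len = w.src),
      (⟨d, e⟩ : PtElt (lan (ordinalSum A n) (extProd G)) W) = convGen x w hw →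
        e ≫ f = e ≫ g) : f = g := by
  have key : fst ((lan (ordinalSum A n) (extProd G)).obj d) (𝟙_ V) ≫ f = fst _ _ ≫ g := by
    refine conv_ext fun e q x w hw he => ?_
    rw [lift_fst_assoc, lift_fst_assoc]
    exact h e x w hw he
  simpa using lift (𝟙 _) (toUnit _) ≫= key

/-- Two natural operations on families of elements of powers of `E` agree if they agree on the
families of generators. -/
theorem power_induction {E : EnrichedFunctor V (Ordinals A) V} {n : ℕ} {k : Fin n → ℕ}
    {U : Fin n → Ordinals A} {W : V} {I : Type} {T : I → V}
    (F G : ∀ {W' : V}, (W' ⟶ W) → (∀ i, W' ⟶ (power E (k i)).obj (U i)) → GElt T W')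
    (hF : ∀ {W' W'' : V} (s : W'' ⟶ W') t e, (F t e).pre s = F (s ≫ t) fun i => s ≫ e i)
    (hG : ∀ {W' W'' : V} (s : W'' ⟶ W') t e, (G t e).pre s = G (s ≫ t) fun i => s ≫ e i)
    (hi : ∀ {W' : V} (t : W' ⟶ W) e, (F t e).1 = (G t e).1)
    (h : ∀ {W' : V} (t : W' ⟶ W) (e : ∀ i, W' ⟶ (power E (k i)).obj (U i))
      (x : ∀ i, Fin (k i) → PtElt E W') (g : Fin n → OpElt X W')
      (hg : ∀ i, ∑ j, (x i j).1.len = (g i).src),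
      (∀ i, (⟨U i, e i⟩ : PtElt (power E (k i)) W') = convGen (x i) (g i) (hg i)) → F t e = G t e)
    (e : ∀ i, W ⟶ (power E (k i)).obj (U i)) : F (𝟙 W) e = G (𝟙 W) e := by
  -- by naturality the universal family, parametrized by the product, suffices
  have key : F (snd (∏ᶜ fun i => (power E (k i)).obj (U i)) W) (fun i => fst _ _ ≫ Pi.π _ i) =
      G (snd (∏ᶜ fun i => (power E (k i)).obj (U i)) W) (fun i => fst _ _ ≫ Pi.π _ i) := by
    have h1 := hi (snd (∏ᶜ fun i => (power E (k i)).obj (U i)) W) (fun i => fst _ _ ≫ Pi.π _ i)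
    refine (GElt.mk_cast h1 _).symm.trans ?_
    refine congrArg (Sigma.mk _) (piLan_ext (J := fun i => ordinalSum A (k i))
      (F := fun i => extProd fun _ : Fin (k i) => E) (d := U) fun {W'} c x p w => ?_)
    have h' := h w (fun i => lift (x i) (p i) ≫
        lanι (ordinalSum A (k i)) (extProd fun _ : Fin (k i) => E) (c i) (U i))
      (fun i j => ⟨c i j, x i ≫ Pi.π (fun j => E.obj (c i j)) j⟩)
      (fun i => ⟨_, (U i).len, p i⟩) (fun _ => rfl) (fun i => by
        refine Eq.trans ?_ (convGen_mk _ (p i)).symm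
        refine congrArg (Sigma.mk (U i)) (congrArg (fun t => lift t (p i) ≫ _) ?_)
        exact (piLift_comp_π _).symm)
    have e0 : ∀ i, lift (Pi.lift fun i => lift (x i) (p i) ≫
        lanι (ordinalSum A (k i)) (extProd fun _ : Fin (k i) => E) (c i) (U i)) w ≫
        fst (∏ᶜ fun i => (power E (k i)).obj (U i)) W ≫ Pi.π _ i = lift (x i) (p i) ≫
        lanι (ordinalSum A (k i)) (extProd fun _ : Fin (k i) => E) (c i) (U i) := fun i =>
      (lift_fst_assoc _ _ _).trans (Pi.lift_π _ _)
    have e3 : lift (Pi.lift fun i => lift (x i) (p i) ≫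
        lanι (ordinalSum A (k i)) (extProd fun _ : Fin (k i) => E) (c i) (U i)) w ≫
        snd (∏ᶜ fun i => (power E (k i)).obj (U i)) W = w := lift_snd _ _
    have e1 := (hF (lift (Pi.lift fun i => lift (x i) (p i) ≫
        lanι (ordinalSum A (k i)) (extProd fun _ : Fin (k i) => E) (c i) (U i)) w)
      (snd (∏ᶜ fun i => (power E (k i)).obj (U i)) W) (fun i => fst _ _ ≫ Pi.π _ i)).trans
      (congrArg₂ (fun t e => F t e) e3 (funext e0))
    have e2 := (hG (lift (Pi.lift fun i => lift (x i) (p i) ≫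
        lanι (ordinalSum A (k i)) (extProd fun _ : Fin (k i) => E) (c i) (U i)) w)
      (snd (∏ᶜ fun i => (power E (k i)).obj (U i)) W) (fun i => fst _ _ ≫ Pi.π _ i)).trans
      (congrArg₂ (fun t e => G t e) e3 (funext e0))
    refine (Category.assoc _ _ _).symm.trans ?_
    exact GElt.cast_eq (e1.trans (h'.trans e2.symm)) h1
  have e0 : ∀ i, lift (Pi.lift e) (𝟙 W) ≫
      fst (∏ᶜ fun i => (power E (k i)).obj (U i)) W ≫ Pi.π _ i = e i := fun i =>
    (lift_fst_assoc _ _ _).trans (Pi.lift_π _ _)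
  have e1 := hF (lift (Pi.lift e) (𝟙 W))
    (snd (∏ᶜ fun i => (power E (k i)).obj (U i)) W) (fun i => fst _ _ ≫ Pi.π _ i)
  have e2 := hG (lift (Pi.lift e) (𝟙 W))
    (snd (∏ᶜ fun i => (power E (k i)).obj (U i)) W) (fun i => fst _ _ ≫ Pi.π _ i)
  rw [funext e0, lift_snd] at e1 e2
  rw [← e1, ← e2, key]

/-- The variant of `power_induction` for a single element. -/
theorem power_induction_one {E : EnrichedFunctor V (Ordinals A) V} {n : ℕ}
    {U : Ordinals A} {W : V} {I : Type} {T : I → V}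
    (F G : ∀ {W' : V}, (W' ⟶ W) → (W' ⟶ (power E n).obj U) → GElt T W')
    (hF : ∀ {W' W'' : V} (s : W'' ⟶ W') t e, (F t e).pre s = F (s ≫ t) (s ≫ e))
    (hG : ∀ {W' W'' : V} (s : W'' ⟶ W') t e, (G t e).pre s = G (s ≫ t) (s ≫ e))
    (hi : ∀ {W' : V} (t : W' ⟶ W) e, (F t e).1 = (G t e).1)
    (h : ∀ {W' : V} (t : W' ⟶ W) (e : W' ⟶ (power E n).obj U)
      (x : Fin n → PtElt E W') (g : OpElt X W') (hg : ∑ j, (x j).1.len = g.src),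
      (⟨U, e⟩ : PtElt (power E n) W') = convGen x g hg → F t e = G t e)
    (e : W ⟶ (power E n).obj U) : F (𝟙 W) e = G (𝟙 W) e :=
  power_induction (n := 1) (k := fun _ => n) (U := fun _ => U) (fun t e => F t (e 0))
    (fun t e => G t (e 0)) (fun _ _ _ => hF _ _ _) (fun _ _ _ => hG _ _ _) (fun _ _ => hi _ _)
    (fun t e x g hg he => h t (e 0) (x 0) (g 0) (hg 0) (he 0)) fun _ => e

variable (E : EnrichedFunctor V (Ordinals A) V)

/-- The map that sends an element of the iterated Kan extension that is represented by generators to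
the corresponding generator of the power. -/
def flatten {n : ℕ} (k : Fin n → ℕ) (U : Fin n → Ordinals A) (d : Ordinals A) :
    (∏ᶜ fun i => (power E (k i)).obj (U i)) ⊗ opHom X (∑ i, (U i).len) d.len ⟶
      (power E (∑ i, k i)).obj d :=
  (exists_flatten E k U d).choose

variable {E}

/-- The image of the element of the iterated Kan extension that is represented by elements `y i` of
powers and a morphism. -/
def nest {n : ℕ} {k : Fin n → ℕ} {W : V} (y : ∀ i, PtElt (power E (k i)) W) (w : OpElt X W)
    (h : ∑ i, (y i).1.len = w.src) : PtElt (power E (∑ i, k i)) W :=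
  ⟨⟨w.tgt⟩, lift (Pi.lift fun i => (y i).2)
    (w.hom ≫ eqToHom (congrArg (fun a => opHom X a w.tgt) h.symm)) ≫
      flatten E k (fun i => (y i).1) ⟨w.tgt⟩⟩

theorem nest_mk {n : ℕ} {k : Fin n → ℕ} {W : V} {U : Fin n → Ordinals A} {d : Ordinals A}
    (y : ∀ i, W ⟶ (power E (k i)).obj (U i)) (w : W ⟶ opHom X (∑ i, (U i).len) d.len) :
    nest (fun i => ⟨U i, y i⟩) ⟨_, _, w⟩ rfl = ⟨d, lift (Pi.lift y) w ≫ flatten E k U d⟩ := by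
  have e : w ≫ eqToHom (rfl : opHom X (∑ i, (U i).len) d.len = opHom X (∑ i, (U i).len) d.len) =
    w := Category.comp_id _
  exact congrArg (fun t => (⟨d, lift (Pi.lift y) t ≫ flatten E k U d⟩ :
    PtElt (power E (∑ i, k i)) W)) e

theorem nest_congr {n : ℕ} {k : Fin n → ℕ} {W : V} {y y' : ∀ i, PtElt (power E (k i)) W}
    {w w' : OpElt X W} (ey : ∀ i, y i = y' i) (ew : w = w') (h : ∑ i, (y i).1.len = w.src)
    (h' : ∑ i, (y' i).1.len = w'.src) : nest y w h = nest y' w' h' := by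
  obtain rfl := funext ey
  subst ew
  rfl

theorem pre_nest {n : ℕ} {k : Fin n → ℕ} {W W' : V} (s : W' ⟶ W)
    (y : ∀ i, PtElt (power E (k i)) W) (w : OpElt X W) (h : ∑ i, (y i).1.len = w.src) :
    (nest y w h).pre s = nest (fun i => (y i).pre s) (w.pre s) h := by
  refine congrArg (Sigma.mk (⟨w.tgt⟩ : Ordinals A)) ?_
  refine (comp_lift_assoc _ _ _ _).trans ?_
  refine congrArg (· ≫ _) ?_
  exact congrArg₂ lift (pi_lift_comp _ _) (Category.assoc _ _ _).symm

/-- The flattening of an element that is represented by generators. -/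
theorem nest_convGen {n : ℕ} {k : Fin n → ℕ} {W : V} (x : ∀ i, Fin (k i) → PtElt E W)
    (g : Fin n → OpElt X W) (hg : ∀ i, ∑ j, (x i j).1.len = (g i).src) (w : OpElt X W)
    (hw : ∑ i, (g i).tgt = w.src) :
    nest (fun i => convGen (x i) (g i) (hg i)) w hw = flatGen x g hg w hw := by
  obtain ⟨b, g', rfl⟩ : ∃ (b : Fin n → ℕ) (g' : ∀ i, W ⟶ opHom X (∑ j, (x i j).1.len) (b i)),
      g = fun i => ⟨∑ j, (x i j).1.len, b i, g' i⟩ :=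
    ⟨fun i => (g i).tgt, fun i => (g i).hom ≫ eqToHom (congrArg₂ (opHom X) (hg i).symm rfl),
      funext fun i => (OpElt.mk_cast (hg i).symm rfl (g i).hom).symm⟩
  obtain ⟨a, c, w⟩ := w
  obtain rfl : ∑ i, b i = a := hw
  refine (nest_congr (fun i => convGen_mk (d := ⟨b i⟩) (fun j => (x i j).2) (g' i)) rfl _
    rfl).trans ?_
  refine (nest_mk (U := fun i => ⟨b i⟩) (d := ⟨c⟩) _ w).trans ?_
  refine congrArg (Sigma.mk (⟨c⟩ : Ordinals A)) ?_
  exact (exists_flatten E k (fun i => ⟨b i⟩) ⟨c⟩).choose_spec (fun i j => (x i j).1)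
    (fun i j => (x i j).2) g' w

/-- The flattening respects the defining relation of the outer Kan extension. -/
theorem nest_act {n : ℕ} {k : Fin n → ℕ} {W : V} (y : ∀ i, PtElt (power E (k i)) W)
    (f : Fin n → OpElt X W) (hf : ∀ i, (y i).1.len = (f i).src) (w : OpElt X W)
    (hw : ∑ i, (f i).tgt = w.src) :
    nest (fun i => (y i).act (f i) (hf i)) w hw = nest y (OpElt.comp A (OpElt.sum f) w hw)
      (Finset.sum_congr rfl fun i _ => hf i) := by
  have key := power_induction (E := E) (k := k) (U := fun i => (y i).1)
    (T := (power E (∑ i, k i)).obj) (W := W)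
    (fun t e => nest (fun i => PtElt.act ⟨(y i).1, e i⟩ ((f i).pre t) (hf i)) (w.pre t) hw)
    (fun t e => nest (fun i => ⟨(y i).1, e i⟩) (OpElt.comp A (OpElt.sum fun i => (f i).pre t)
      (w.pre t) hw) (Finset.sum_congr rfl fun i _ => hf i)) ?_ ?_ (fun _ _ => rfl) ?_
      fun i => (y i).2
  · simp only [OpElt.pre_id] at key
    exact key
  · intro W' W'' s t e
    refine (pre_nest _ _ _ _).trans (nest_congr (fun i => ?_) ?_ _ _)
    · refine (PtElt.pre_act _ _ _ _).trans (PtElt.act_congr rfl ?_ _)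
      exact congrArg (OpElt.mk _ _) (Category.assoc _ _ _).symm
    · exact congrArg (OpElt.mk _ _) (Category.assoc _ _ _).symm
  · intro W' W'' s t e
    refine (pre_nest _ _ _ _).trans (nest_congr (fun i => rfl) ?_ _ _)
    refine (OpElt.pre_comp A _ _ _ _).trans (OpElt.comp_congr ?_ ?_ _ _)
    · refine (OpElt.pre_sum _ _).trans (congrArg OpElt.sum (funext fun i => ?_))
      exact congrArg (OpElt.mk _ _) (Category.assoc _ _ _).symm
    · exact congrArg (OpElt.mk _ _) (Category.assoc _ _ _).symm
  · intro W' t e x g hg he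
    have hs : ∀ i, (g i).tgt = ((f i).pre t).src := fun i =>
      (congrArg (fun z : PtElt (power E (k i)) W' => z.1.len) (he i)).symm.trans (hf i)
    have hs' : ∑ i, (g i).tgt = ∑ i, ((f i).pre t).src := Finset.sum_congr rfl fun i _ => hs i
    refine (nest_congr (fun i => (PtElt.act_congr (he i) rfl _).trans
      (act_convGen (x i) (g i) ((f i).pre t) (hg i) (hs i))) rfl _
      (show ∑ i, (f i).tgt = (w.pre t).src from hw)).trans ?_
    refine (nest_convGen x (fun i => OpElt.comp A (g i) ((f i).pre t) (hs i)) hg _ _).trans ?_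
    refine Eq.trans ?_ (nest_congr he rfl _
      (show ∑ i, (g i).tgt = (OpElt.comp A (OpElt.sum fun i => (f i).pre t) (w.pre t) hw).src
        from hs')).symm
    refine Eq.trans ?_ (nest_convGen x g hg _ _).symm
    refine convGen_congr (fun _ => rfl) ?_ _ _
    refine (OpElt.comp_congr (OpElt.sum_comp A _ _ hs) rfl _
      (show ∑ i, (f i).tgt = (w.pre t).src from hw)).trans ?_
    exact OpElt.comp_assoc A _ _ _ _ _

/-- The flattening commutes with the action of the category of operators. -/
theorem act_nest {n : ℕ} {k : Fin n → ℕ} {W : V} (y : ∀ i, PtElt (power E (k i)) W)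
    (w f : OpElt X W) (hw : ∑ i, (y i).1.len = w.src) (h : w.tgt = f.src) :
    (nest y w hw).act f h = nest y (OpElt.comp A w f h) hw := by
  have key := power_induction (E := E) (k := k) (U := fun i => (y i).1)
    (T := (power E (∑ i, k i)).obj) (W := W)
    (fun t e => PtElt.act (nest (fun i => ⟨(y i).1, e i⟩) (w.pre t) hw) (f.pre t) h)
    (fun t e => nest (fun i => ⟨(y i).1, e i⟩) (OpElt.comp A (w.pre t) (f.pre t) h) hw)
    ?_ ?_ (fun _ _ => rfl) ?_ fun i => (y i).2
  · simp only [OpElt.pre_id] at key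
    exact key
  · intro W' W'' s t e
    refine (PtElt.pre_act _ _ _ _).trans (PtElt.act_congr ((pre_nest _ _ _ _).trans
      (nest_congr (fun _ => rfl) ?_ _ _)) ?_ _)
    · exact congrArg (OpElt.mk _ _) (Category.assoc _ _ _).symm
    · exact congrArg (OpElt.mk _ _) (Category.assoc _ _ _).symm
  · intro W' W'' s t e
    refine (pre_nest _ _ _ _).trans (nest_congr (fun i => rfl) ?_ _ _)
    refine (OpElt.pre_comp A _ _ _ _).trans (OpElt.comp_congr ?_ ?_ _ _)
    · exact congrArg (OpElt.mk _ _) (Category.assoc _ _ _).symm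
    · exact congrArg (OpElt.mk _ _) (Category.assoc _ _ _).symm
  · intro W' t e x g hg he
    have hs : ∑ i, (g i).tgt = (w.pre t).src := Eq.trans (Finset.sum_congr rfl fun i _ =>
      (congrArg (fun z : PtElt (power E (k i)) W' => z.1.len) (he i)).symm) hw
    refine (PtElt.act_congr ((nest_congr he rfl _ hs).trans (nest_convGen x g hg _ _))
      rfl _).trans ?_
    refine (act_convGen _ _ _ _ _).trans ?_
    refine Eq.trans ?_ (nest_congr he rfl _
      (show ∑ i, (g i).tgt = (OpElt.comp A (w.pre t) (f.pre t) h).src from hs)).symm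
    refine Eq.trans ?_ (nest_convGen x g hg _ _).symm
    exact convGen_congr (fun _ => rfl) (OpElt.comp_assoc A _ _ _ _ _) _ _

end Nesting

/-! ### The canonical isomorphisms -/

section Isomorphisms

variable [MonoidalClosed V] [HasLimitsOfSize.{0, 0} V] [HasColimitsOfSize.{0, 0} V]
  {X : ℕ → V} {A : Operad X}

/-- The image of an element under a family of maps. -/
def PtElt.map {F G : EnrichedFunctor V (Ordinals A) V} (φ : ∀ d, F.obj d ⟶ G.obj d) {W : V}
    (x : PtElt F W) : PtElt G W :=
  ⟨x.1, x.2 ≫ φ x.1⟩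

theorem PtElt.pre_map {F G : EnrichedFunctor V (Ordinals A) V} (φ : ∀ d, F.obj d ⟶ G.obj d)
    {W W' : V} (s : W' ⟶ W) (x : PtElt F W) : (x.map φ).pre s = PtElt.map φ (x.pre s) :=
  congrArg (Sigma.mk x.1) (Category.assoc _ _ _).symm

/-- A natural operation on generators that respects the defining relation is given by maps out of
the left Kan extension along the ordinal sum functor. -/
theorem exists_convDesc {n : ℕ} {G : Fin n → EnrichedFunctor V (Ordinals A) V}
    {H : EnrichedFunctor V (Ordinals A) V}
    (f : ∀ {W : V} (x : ∀ i, PtElt (G i) W) (w : OpElt X W), ∑ i, (x i).1.len = w.src →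
      (W ⟶ H.obj ⟨w.tgt⟩))
    (hpre : ∀ {W W' : V} (s : W' ⟶ W) (x : ∀ i, PtElt (G i) W) (w : OpElt X W)
      (h : ∑ i, (x i).1.len = w.src), s ≫ f x w h = f (fun i => (x i).pre s) (w.pre s) h)
    (hact : ∀ {W : V} (x : ∀ i, PtElt (G i) W) (a : Fin n → OpElt X W)
      (ha : ∀ i, (x i).1.len = (a i).src) (w : OpElt X W) (h : ∑ i, (a i).tgt = w.src),
      f (fun i => (x i).act (a i) (ha i)) w h = f x (OpElt.comp A (OpElt.sum a) w h)
        (Finset.sum_congr rfl fun i _ => ha i)) :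
    ∃ φ : ∀ d, (lan (ordinalSum A n) (extProd G)).obj d ⟶ H.obj d,
      ∀ {W : V} (x : ∀ i, PtElt (G i) W) (w : OpElt X W) (h : ∑ i, (x i).1.len = w.src),
        (convGen x w h).map φ = ⟨⟨w.tgt⟩, f x w h⟩ := by
  have fcongr : ∀ {W : V} {x x' : ∀ i, PtElt (G i) W} {w w' : OpElt X W}
      (_ : ∀ i, x i = x' i) (_ : w = w') (h : ∑ i, (x i).1.len = w.src)
      (h' : ∑ i, (x' i).1.len = w'.src),
      (⟨⟨w.tgt⟩, f x w h⟩ : PtElt H W) = ⟨⟨w'.tgt⟩, f x' w' h'⟩ := by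
    intro W x x' w w' hx hw h h'
    obtain rfl := funext hx
    subst hw
    rfl
  -- the values on the universal generators
  let τ : ∀ (d : Ordinals A) (U : Fin n → Ordinals A),
      (extProd G).obj U ⊗ ((ordinalSum A n).obj U ⟶[V] d) ⟶ H.obj d := fun d U =>
    f (fun i => ⟨U i, fst _ _ ≫ Pi.π (fun i => (G i).obj (U i)) i⟩) ⟨_, d.len, snd _ _⟩ rfl
  have hτ : ∀ {W : V} (d : Ordinals A) (U : Fin n → Ordinals A) (x : W ⟶ (extProd G).obj U)
      (w : W ⟶ ((ordinalSum A n).obj U ⟶[V] d)),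
      (⟨d, lift x w ≫ τ d U⟩ : PtElt H W) =
        ⟨d, f (fun i => ⟨U i, x ≫ Pi.π (fun i => (G i).obj (U i)) i⟩) ⟨_, d.len, w⟩ rfl⟩ := by
    intro W d U x w
    refine (congrArg (Sigma.mk d) (hpre (lift x w) _ _ _)).trans ?_
    exact fcongr (fun i => congrArg (Sigma.mk (U i)) (lift_fst_assoc _ _ _))
      (congrArg (OpElt.mk _ _) (lift_snd _ _)) _ _
  have key : ∀ d : Ordinals A, ∀ {W : V} (U U' : Fin n → Ordinals A) (x : W ⟶ (extProd G).obj U)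
      (a : W ⟶ (U ⟶[V] U')) (g : W ⟶ ((ordinalSum A n).obj U' ⟶[V] d)) (q : W ⟶ 𝟙_ V),
      lift (lift (lift x a ≫ act (extProd G) U U') g) q ≫ fst _ _ ≫ τ d U' =
        lift (lift x (lift (a ≫ (ordinalSum A n).map U U') g ≫ eComp V _ _ _)) q ≫
          fst _ _ ≫ τ d U := by
    intro d W U U' x a g q
    rw [lift_fst_assoc, lift_fst_assoc]
    apply GElt.mk_inj (T := H.obj)
    refine (hτ _ _ _ _).trans (Eq.trans ?_ (hτ _ _ _ _).symm)
    have e := hact (fun i => (⟨U i, x ≫ Pi.π (fun i => (G i).obj (U i)) i⟩ : PtElt (G i) W))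
      (fun i => ⟨(U i).len, (U' i).len, a ≫ Pi.π (fun i => (U i ⟶[V] U' i)) i⟩) (fun _ => rfl)
      ⟨_, d.len, g⟩ rfl
    refine Eq.trans (fcongr (w := ⟨_, d.len, g⟩) (w' := ⟨_, d.len, g⟩) (fun i => ?_) rfl _ _)
      ((congrArg (Sigma.mk d) e).trans
      (fcongr (fun _ => rfl) (OpElt.comp_eq A (congrArg (OpElt.mk _ _) ?_) rfl _) _ _))
    · refine Eq.trans (congrArg (Sigma.mk (U' i)) ?_) (PtElt.act_mk _ _).symm
      exact (congrArg (· ≫ Pi.π (fun i => (G i).obj (U' i)) i)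
        (lift_act_extProd G x a)).trans (Pi.lift_π _ _)
    · exact congrArg (· ≫ sumHom _ _) (piLift_comp_π a)
  -- `lanDesc` has a parameter space, here the point
  refine ⟨fun d => lift (𝟙 _) (toUnit _) ≫ lanDesc (ordinalSum A n) (F := extProd G) (W := 𝟙_ V)
    (fun U => fst _ _ ≫ τ d U) (key d), fun {W} x w h => ?_⟩
  obtain ⟨a, c, w⟩ := w
  obtain rfl : ∑ i, (x i).1.len = a := h
  refine (congrArg (PtElt.map _) (convGen_mk (G := G) (d := ⟨c⟩) (fun i => (x i).2) w)).trans ?_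
  have e : ∀ {P Z : V} (y : W ⟶ P) (r : P ⊗ 𝟙_ V ⟶ Z),
      y ≫ lift (𝟙 _) (toUnit _) ≫ r = lift y (toUnit _) ≫ r := by
    intro P Z y r
    rw [comp_lift_assoc, Category.comp_id, comp_toUnit]
  refine (congrArg (Sigma.mk (⟨c⟩ : Ordinals A)) ((e _ _).trans
    ((lift_lanDesc (ordinalSum A n) _ (key ⟨c⟩) _ _ _).trans (lift_fst_assoc _ _ _)))).trans ?_
  refine (hτ ⟨c⟩ _ _ _).trans (fcongr (w := ⟨_, c, w⟩) (w' := ⟨_, c, w⟩) (fun i => ?_) rfl _ _)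
  exact congrArg (Sigma.mk (x i).1) (Pi.lift_π _ _)

/-- Maps out of the values of a Kan extension are natural if they are natural on the generators. -/
theorem conv_naturality {n : ℕ} {G : Fin n → EnrichedFunctor V (Ordinals A) V}
    {H : EnrichedFunctor V (Ordinals A) V}
    (φ : ∀ d, (lan (ordinalSum A n) (extProd G)).obj d ⟶ H.obj d)
    (h : ∀ {W : V} (x : ∀ i, PtElt (G i) W) (w q : OpElt X W) (hw : ∑ i, (x i).1.len = w.src)
      (hq : w.tgt = q.src), ((convGen x w hw).act q hq).map φ =
        PtElt.act ((convGen x w hw).map φ) q hq) (c d : Ordinals A) :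
    act (lan (ordinalSum A n) (extProd G)) c d ≫ φ d =
      lift (fst _ _ ≫ φ c) (snd _ _) ≫ act H c d := by
  refine conv_ext fun {W} e q x w hw he => ?_
  rw [comp_lift_assoc, lift_fst_assoc, lift_snd]
  apply GElt.mk_inj (T := H.obj)
  have e1 : ∀ {F : EnrichedFunctor V (Ordinals A) V} {y : W ⟶ F.obj c},
      (⟨d, lift y q ≫ act F c d⟩ : PtElt F W) = PtElt.act ⟨c, y⟩ ⟨c.len, d.len, q⟩ rfl :=
    (PtElt.act_mk _ _).symm
  refine Eq.trans ?_ e1.symm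
  have hc : w.tgt = c.len := (congrArg (fun z : PtElt _ W => z.1.len) he).symm
  have h1 := h x w ⟨c.len, d.len, q⟩ hw hc
  have h2 : (⟨d, lift e q ≫ act (lan (ordinalSum A n) (extProd G)) c d ≫ φ d⟩ : PtElt H W) =
      PtElt.map φ (PtElt.act (⟨c, e⟩ : PtElt (lan (ordinalSum A n) (extProd G)) W)
        ⟨c.len, d.len, q⟩ rfl) :=
    Eq.trans (congrArg (fun t => (⟨d, t⟩ : PtElt H W)) (Category.assoc _ _ _).symm)
      (congrArg (PtElt.map φ) (PtElt.act_mk e q)).symm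
  exact h2.trans ((congrArg (PtElt.map φ) (PtElt.act_congr he rfl _)).trans
    (h1.trans (PtElt.act_congr (congrArg (PtElt.map φ) he).symm rfl _)))

variable (E : EnrichedFunctor V (Ordinals A) V)

/-- The flattening factors through the iterated Kan extension. -/
theorem exists_kappaHom {n : ℕ} (k : Fin n → ℕ) :
    ∃ φ : ∀ d, (lan (ordinalSum A n) (extProd fun i => power E (k i))).obj d ⟶
        (power E (∑ i, k i)).obj d,
      ∀ {W : V} (y : ∀ i, PtElt (power E (k i)) W) (w : OpElt X W)
        (h : ∑ i, (y i).1.len = w.src), (convGen y w h).map φ = nest y w h :=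
  exists_convDesc (fun y w h => (nest y w h).2)
    (fun s y w h => GElt.mk_inj (T := (power E (∑ i, k i)).obj) (pre_nest s y w h))
    (fun y a ha w h => GElt.mk_inj (T := (power E (∑ i, k i)).obj) (nest_act y a ha w h))

/-- The comparison map from the iterated Kan extension to the power. -/
def kappaHom {n : ℕ} (k : Fin n → ℕ) (d : Ordinals A) :
    (lan (ordinalSum A n) (extProd fun i => power E (k i))).obj d ⟶
      (power E (∑ i, k i)).obj d :=
  (exists_kappaHom E k).choose d

variable {E}

theorem kappaHom_convGen {n : ℕ} {k : Fin n → ℕ} {W : V} (y : ∀ i, PtElt (power E (k i)) W)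
    (w : OpElt X W) (h : ∑ i, (y i).1.len = w.src) :
    (convGen y w h).map (kappaHom E k) = nest y w h :=
  (exists_kappaHom E k).choose_spec y w h

/-- The generator of the iterated Kan extension that corresponds to a generator of the power of
exponent `k 0 + ... + k (n - 1)`. -/
def splitGen {n : ℕ} {k : Fin n → ℕ} {W : V} (x : Fin (∑ i, k i) → PtElt E W) (w : OpElt X W)
    (h : ∑ p, (x p).1.len = w.src) :
    PtElt (lan (ordinalSum A n) (extProd fun i => power E (k i))) W :=
  convGen (fun i => convGen (fun j => x (finSigmaFinEquiv ⟨i, j⟩)) (OpElt.id A W _) rfl) w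
    ((sum_blocks fun p => (x p).1.len).symm.trans h)

theorem pre_splitGen {n : ℕ} {k : Fin n → ℕ} {W W' : V} (s : W' ⟶ W)
    (x : Fin (∑ i, k i) → PtElt E W) (w : OpElt X W) (h : ∑ p, (x p).1.len = w.src) :
    (splitGen x w h).pre s = splitGen (fun p => (x p).pre s) (w.pre s) h := by
  refine (pre_convGen _ _ _ _).trans (convGen_congr (fun i => ?_) rfl _ _)
  exact (pre_convGen _ _ _ _).trans (convGen_congr (fun _ => rfl) (OpElt.pre_idElt A s _) _ _)

/-- The splitting into blocks respects the defining relation of the power. -/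
theorem splitGen_act {n : ℕ} {k : Fin n → ℕ} {W : V} (x : Fin (∑ i, k i) → PtElt E W)
    (a : Fin (∑ i, k i) → OpElt X W) (ha : ∀ p, (x p).1.len = (a p).src) (w : OpElt X W)
    (h : ∑ p, (a p).tgt = w.src) :
    splitGen (fun p => (x p).act (a p) (ha p)) w h =
      splitGen x (OpElt.comp A (OpElt.sum a) w h) (Finset.sum_congr rfl fun p _ => ha p) := by
  have hs : ∀ i, ∑ j, (x (finSigmaFinEquiv ⟨i, j⟩)).1.len =
      ∑ j, (a (finSigmaFinEquiv ⟨i, j⟩)).src := fun i => Finset.sum_congr rfl fun j _ => ha _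
  have hw : ∑ i, ∑ j, (a (finSigmaFinEquiv ⟨i, j⟩)).tgt = w.src :=
    (sum_blocks fun p => (a p).tgt).symm.trans h
  refine Eq.trans (convGen_congr (fun i => ?_) rfl _ hw) ((convGen_act
    (fun i => convGen (fun j => x (finSigmaFinEquiv ⟨i, j⟩)) (OpElt.id A W _) rfl)
    (fun i => OpElt.sum fun j => a (finSigmaFinEquiv ⟨i, j⟩)) hs w hw).trans
    (convGen_congr (fun _ => rfl) (OpElt.comp_congr (OpElt.sum_blocks a).symm rfl _ _) _ _))
  refine (convGen_act _ _ (fun j => ha _) _ _).trans ?_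
  refine Eq.trans ?_ (act_convGen _ _ _ _ _).symm
  exact convGen_congr (fun _ => rfl)
    ((OpElt.comp_id A _ _ _).trans (OpElt.id_comp A _ _ (hs i)).symm) _ _

theorem exists_kappaInv (E : EnrichedFunctor V (Ordinals A) V) {n : ℕ} (k : Fin n → ℕ) :
    ∃ φ : ∀ d, (power E (∑ i, k i)).obj d ⟶
        (lan (ordinalSum A n) (extProd fun i => power E (k i))).obj d,
      ∀ {W : V} (x : Fin (∑ i, k i) → PtElt E W) (w : OpElt X W)
        (h : ∑ i, (x i).1.len = w.src), (convGen x w h).map φ = splitGen x w h :=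
  exists_convDesc (fun x w h => (splitGen x w h).2)
    (fun s y w h => GElt.mk_inj
      (T := (lan (ordinalSum A n) (extProd fun i => power E (k i))).obj) (pre_splitGen s y w h))
    (fun y a ha w h => GElt.mk_inj
      (T := (lan (ordinalSum A n) (extProd fun i => power E (k i))).obj) (splitGen_act y a ha w h))

theorem nest_splitGen {n : ℕ} {k : Fin n → ℕ} {W : V} (x : Fin (∑ i, k i) → PtElt E W)
    (w : OpElt X W) (h : ∑ p, (x p).1.len = w.src) :
    (splitGen x w h).map (kappaHom E k) = convGen x w h := by
  have h' := (sum_blocks fun p => (x p).1.len).symm.trans h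
  refine (kappaHom_convGen _ _ _).trans ?_
  refine (nest_convGen (fun i j => x (finSigmaFinEquiv ⟨i, j⟩)) _ (fun _ => rfl) w h').trans ?_
  refine convGen_congr (fun p => congrArg x (Equiv.apply_symm_apply finSigmaFinEquiv p)) ?_ _ _
  exact (OpElt.comp_congr (OpElt.sum_id A _) rfl _ h').trans (OpElt.id_comp A _ _ h')

/-- The isomorphism between the iterated Kan extension and the power. -/
def kappaIso (E : EnrichedFunctor V (Ordinals A) V) (n : ℕ) (k : Fin n → ℕ) :
    FunctorIso (lan (ordinalSum A n) (extProd fun i => power E (k i))) (power E (∑ i, k i)) where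
  app d :=
    { hom := kappaHom E k d
      inv := (exists_kappaInv E k).choose d
      hom_inv_id := by
        have hi := fun {W : V} => (exists_kappaInv E k).choose_spec (W := W)
        set ψ := (exists_kappaInv E k).choose
        refine conv_hom_ext fun {W} e y w hw he => ?_
        apply GElt.mk_inj (T := (lan (ordinalSum A n) (extProd fun i => power E (k i))).obj)
        have e1 : (⟨d, e ≫ kappaHom E k d ≫ ψ d⟩ :
            PtElt (lan (ordinalSum A n) (extProd fun i => power E (k i))) W) =
            PtElt.map ψ (PtElt.map (kappaHom E k) ⟨d, e⟩) :=
          congrArg (Sigma.mk d) (Category.assoc _ _ _).symm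
        rw [e1, Category.comp_id, he, kappaHom_convGen]
        have key := power_induction (E := E) (k := k) (U := fun i => (y i).1)
          (T := (lan (ordinalSum A n) (extProd fun i => power E (k i))).obj) (W := W)
          (fun t e => (nest (fun i => ⟨(y i).1, e i⟩) (w.pre t) hw).map ψ)
          (fun t e => convGen (fun i => ⟨(y i).1, e i⟩) (w.pre t) hw) ?_ ?_ (fun _ _ => rfl) ?_
          fun i => (y i).2
        · simp only [OpElt.pre_id] at key
          exact key
        · intro W' W'' s t e
          refine (PtElt.pre_map _ _ _).trans (congrArg (PtElt.map ψ) ?_)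
          refine (pre_nest _ _ _ _).trans (nest_congr (fun _ => rfl) ?_ _ _)
          exact congrArg (OpElt.mk _ _) (Category.assoc _ _ _).symm
        · intro W' W'' s t e
          refine (pre_convGen _ _ _ _).trans (convGen_congr (fun _ => rfl) ?_ _ _)
          exact congrArg (OpElt.mk _ _) (Category.assoc _ _ _).symm
        · intro W' t e x g hg he
          have hs : ∑ i, (g i).tgt = (w.pre t).src := Eq.trans (Finset.sum_congr rfl fun i _ =>
            (congrArg (fun z : PtElt (power E (k i)) W' => z.1.len) (he i)).symm) hw
          refine (congrArg (PtElt.map ψ) ((nest_congr he rfl _ hs).trans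
            (nest_convGen x g hg _ _))).trans ?_
          refine (hi _ _ _).trans ?_
          refine Eq.trans ?_ (convGen_congr (fun i => (he i).symm) rfl hs hw)
          have hx : ∀ i, ∑ j, ((fun p : Fin (∑ i, k i) => x (pos p).1 (pos p).2)
              (finSigmaFinEquiv ⟨i, j⟩)).1.len = (g i).src := fun i =>
            (Finset.sum_congr rfl fun j _ => congrArg (fun z : PtElt E W' => z.1.len)
              (apply_pos x i j)).trans (hg i)
          refine (convGen_act (G := fun i => power E (k i)) _ g hx (w.pre t) hs).symm.trans ?_
          refine convGen_congr (fun i => ?_) rfl _ _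
          refine (act_convGen _ _ _ _ (hx i)).trans ?_
          exact convGen_congr (fun j => apply_pos x i j) (OpElt.id_comp A _ _ (hx i)) _ _
      inv_hom_id := by
        have hi := fun {W : V} => (exists_kappaInv E k).choose_spec (W := W)
        set ψ := (exists_kappaInv E k).choose
        refine conv_hom_ext fun {W} e x w hw he => ?_
        apply GElt.mk_inj (T := (power E (∑ i, k i)).obj)
        have e1 : (⟨d, e ≫ ψ d ≫ kappaHom E k d⟩ : PtElt (power E (∑ i, k i)) W) =
            PtElt.map (kappaHom E k) (PtElt.map ψ ⟨d, e⟩) :=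
          congrArg (Sigma.mk d) (Category.assoc _ _ _).symm
        rw [e1, Category.comp_id, he, hi, nest_splitGen] }
  naturality := conv_naturality _ fun y w q hw hq => by
    refine (congrArg (PtElt.map (kappaHom E k)) (act_convGen y w q hw hq)).trans ?_
    refine (kappaHom_convGen _ _ _).trans ?_
    refine (act_nest y w q hw hq).symm.trans ?_
    exact PtElt.act_congr (kappaHom_convGen _ _ _).symm rfl _

/-! #### The first power -/

/-- The identity morphism of equal objects is an identity, once source and target are part
of the data. -/
theorem OpElt.idOf_eq {W : V} {a b : Ordinals A} (h : a = b) :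
    OpElt.mk a.len b.len (toUnit W ≫ idOf (V := V) h) = OpElt.id A W b.len := by
  subst h
  refine congrArg (OpElt.mk a.len a.len) ?_
  refine congrArg (toUnit W ≫ ·) ?_
  exact (congrArg (eId V a ≫ ·) (eqToHom_refl _ _)).trans (Category.comp_id _)

/-- The canonical map to the first power. -/
def oneHom (E : EnrichedFunctor V (Ordinals A) V) (c : Ordinals A) :
    E.obj c ⟶ (power E 1).obj c :=
  lift (Pi.lift fun _ => 𝟙 _) (toUnit _ ≫ idOf (ordinalSum_one A c)) ≫
    lanι (ordinalSum A 1) (extProd fun _ : Fin 1 => E) (fun _ => c) c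

/-- The canonical map to the first power sends `x` to the class of `(x, id)`. -/
theorem map_oneHom {W : V} (x : PtElt E W) :
    x.map (oneHom E) =
      convGen (fun _ : Fin 1 => x) (OpElt.id A W x.1.len) (Fin.sum_univ_one _) := by
  obtain ⟨c, x⟩ := x
  refine Eq.trans ?_ ((convGen_mk (G := fun _ : Fin 1 => E) (U := fun _ => c) (d := c)
    (fun _ => x) (toUnit W ≫ idOf (ordinalSum_one A c))).symm.trans
    (convGen_congr (fun _ => rfl) (OpElt.idOf_eq (ordinalSum_one A c)) _ _))
  refine congrArg (Sigma.mk c) ?_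
  refine (Category.assoc _ _ _).symm.trans (congrArg (· ≫ _) ?_)
  refine (comp_lift _ _ _).trans (congrArg₂ lift ?_ (comp_toUnit_assoc _ _))
  refine (pi_lift_comp _ _).trans ?_
  simp

theorem PtElt.act_act {F : EnrichedFunctor V (Ordinals A) V} {W : V} (x : PtElt F W)
    (f g : OpElt X W) (h : x.1.len = f.src) (h' : f.tgt = g.src) :
    (x.act f h).act g h' = x.act (OpElt.comp A f g h') h := by
  obtain ⟨⟨a⟩, x⟩ := x
  obtain ⟨a', b, f⟩ := f
  obtain rfl : a = a' := h
  obtain ⟨b', c, g⟩ := g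
  obtain rfl : b = b' := h'
  refine (PtElt.act_congr (PtElt.act_mk (U := ⟨a⟩) (U' := ⟨b⟩) x f) rfl _).trans ?_
  refine (PtElt.act_mk (U := ⟨b⟩) (U' := ⟨c⟩) _ g).trans ?_
  refine Eq.trans ?_ (PtElt.act_congr rfl (OpElt.comp_mk A f g).symm rfl)
  refine Eq.trans ?_ (PtElt.act_mk (U := ⟨a⟩) (U' := ⟨c⟩) x _).symm
  exact congrArg (Sigma.mk (⟨c⟩ : Ordinals A))
    (act_eComp F (c := ⟨a⟩) (d := ⟨b⟩) (e := ⟨c⟩) x f g).symm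

theorem PtElt.act_id {F : EnrichedFunctor V (Ordinals A) V} {W : V} (x : PtElt F W) (a : ℕ)
    (h : x.1.len = a) : x.act (OpElt.id A W a) h = x := by
  obtain ⟨⟨a⟩, x⟩ := x
  subst h
  refine (PtElt.act_mk (U := ⟨a⟩) (U' := ⟨a⟩) x _).trans ?_
  exact congrArg (Sigma.mk (⟨a⟩ : Ordinals A)) (act_eId F (c := ⟨a⟩) x)

theorem OpElt.sum_fin_one {W : V} (f : Fin 1 → OpElt X W) : OpElt.sum f = f 0 :=
  (congrArg OpElt.sum (funext fun i => congrArg f (Subsingleton.elim i 0))).trans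
    (OpElt.sum_one (f 0))

/-- The inverse of the canonical map sends the class of `(x, w)` to `x w`. -/
theorem exists_oneInv (E : EnrichedFunctor V (Ordinals A) V) :
    ∃ φ : ∀ d, (power E 1).obj d ⟶ E.obj d,
      ∀ {W : V} (x : Fin 1 → PtElt E W) (w : OpElt X W)
        (h : ∑ i, (x i).1.len = w.src), (convGen x w h).map φ =
          (x 0).act w ((Fin.sum_univ_one _).symm.trans h) :=
  exists_convDesc (fun x w h => ((x 0).act w ((Fin.sum_univ_one _).symm.trans h)).2)
    (fun s _ w _ => GElt.mk_inj (T := E.obj) (PtElt.pre_act s _ w _))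
    (fun x a ha w h => GElt.mk_inj (T := E.obj)
      ((PtElt.act_act (x 0) (a 0) w (ha 0) ((Fin.sum_univ_one _).symm.trans h)).trans
        (PtElt.act_congr rfl (OpElt.comp_congr (OpElt.sum_fin_one a).symm rfl _ _) _)))

/-- A continuous functor is isomorphic to its first power. -/
def oneIso (E : EnrichedFunctor V (Ordinals A) V) : FunctorIso E (power E 1) where
  app c :=
    { hom := oneHom E c
      inv := (exists_oneInv E).choose c
      hom_inv_id := by
        have hi := fun {W : V} => (exists_oneInv E).choose_spec (W := W)
        set ψ := (exists_oneInv E).choose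
        apply GElt.mk_inj (T := E.obj)
        have e1 : (⟨c, oneHom E c ≫ ψ c⟩ : PtElt E (E.obj c)) =
            PtElt.map ψ (PtElt.map (oneHom E) ⟨c, 𝟙 _⟩) :=
          congrArg (Sigma.mk c) (congrArg (· ≫ ψ c) (Category.id_comp _).symm)
        refine e1.trans ((congrArg (PtElt.map ψ) (map_oneHom _)).trans ?_)
        exact (hi _ _ _).trans (PtElt.act_id _ _ _)
      inv_hom_id := by
        have hi := fun {W : V} => (exists_oneInv E).choose_spec (W := W)
        set ψ := (exists_oneInv E).choose
        refine conv_hom_ext fun {W} e x w hw he => ?_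
        apply GElt.mk_inj (T := (power E 1).obj)
        have e1 : (⟨c, e ≫ ψ c ≫ oneHom E c⟩ : PtElt (power E 1) W) =
            PtElt.map (oneHom E) (PtElt.map ψ ⟨c, e⟩) :=
          congrArg (Sigma.mk c) (Category.assoc _ _ _).symm
        have hx : ∀ i, (x i).1.len = w.src := fun i =>
          (congrArg (fun i => (x i).1.len) (Subsingleton.elim i 0)).trans
            ((Fin.sum_univ_one _).symm.trans hw)
        have hw' : ∑ _ : Fin 1, w.tgt = w.tgt := Fin.sum_univ_one _
        rw [e1, Category.comp_id, he, hi]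
        refine (map_oneHom _).trans ?_
        refine (convGen_congr (x' := fun i => (x i).act w (hx i)) (g' := OpElt.id A W w.tgt)
          (fun i => PtElt.act_congr (congrArg x (Subsingleton.elim 0 i)) rfl _) rfl _ hw').trans ?_
        refine (convGen_act x (fun _ => w) hx _ hw').trans ?_
        exact convGen_congr (fun _ => rfl) ((OpElt.comp_congr (OpElt.sum_one w) rfl _ rfl).trans
          (OpElt.comp_id A w _ rfl)) _ _ }
  naturality c d := by
    apply GElt.mk_inj (T := (power E 1).obj)
    have hd : ∑ _ : Fin 1, d.len = d.len := Fin.sum_univ_one _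
    let x : PtElt E (E.obj c ⊗ (c ⟶[V] d)) := ⟨c, fst _ _⟩
    let q : OpElt X (E.obj c ⊗ (c ⟶[V] d)) := ⟨c.len, d.len, snd _ _⟩
    have h1 : (⟨d, act E c d ≫ oneHom E d⟩ : PtElt (power E 1) (E.obj c ⊗ (c ⟶[V] d))) =
        PtElt.map (oneHom E) (x.act q rfl) := by
      refine Eq.trans ?_ (congrArg (PtElt.map (oneHom E)) (PtElt.act_mk _ _)).symm
      refine congrArg (fun t => (⟨d, t ≫ oneHom E d⟩ :
        PtElt (power E 1) (E.obj c ⊗ (c ⟶[V] d)))) ?_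
      exact ((congrArg (· ≫ act E c d) (lift_fst_snd)).trans (Category.id_comp _)).symm
    refine h1.trans ((map_oneHom _).trans ?_)
    refine (convGen_act (fun _ : Fin 1 => x) (fun _ => q) (fun _ => rfl) _ hd).trans ?_
    refine Eq.trans ?_ (PtElt.act_mk (U := c) (U' := d) (fst _ _ ≫ oneHom E c) (snd _ _))
    refine Eq.trans ?_ (PtElt.act_congr (map_oneHom x).symm rfl rfl)
    refine Eq.trans ?_ (act_convGen _ _ _ _ _).symm
    refine convGen_congr (fun _ => rfl) ?_ _ _
    exact (OpElt.comp_congr (OpElt.sum_one q) rfl _ rfl).trans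
      ((OpElt.comp_id A q _ rfl).trans (OpElt.id_comp A q _ rfl).symm)

end Isomorphisms

/-! ### Values of transformations at elements -/

section Evaluation

variable [MonoidalClosed V] [HasLimitsOfSize.{0, 0} V] [HasColimitsOfSize.{0, 0} V]
  {X : ℕ → V} {A : Operad X}

/-- The value of a transformation at an element. -/
def PtElt.eval {F G : EnrichedFunctor V (Ordinals A) V} {W : V} (x : PtElt F W)
    (t : W ⟶ mapObj F G) : PtElt G W :=
  ⟨x.1, lift x.2 t ≫ ExtendedOperad.eval F G x.1⟩

theorem PtElt.pre_eval {F G : EnrichedFunctor V (Ordinals A) V} {W W' : V} (s : W' ⟶ W)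
    (x : PtElt F W) (t : W ⟶ mapObj F G) : (x.eval t).pre s = PtElt.eval (x.pre s) (s ≫ t) :=
  congrArg (Sigma.mk x.1) (comp_lift_assoc _ _ _ _)

theorem PtElt.eval_mapComp {F G H : EnrichedFunctor V (Ordinals A) V} {W : V} (x : PtElt F W)
    (s : W ⟶ mapObj F G) (t : W ⟶ mapObj G H) :
    x.eval (lift s t ≫ mapComp F G H) = (x.eval s).eval t := by
  refine congrArg (Sigma.mk x.1) ((lift_mapLift _ _ _ _ _).trans ?_)
  simp only [comp_lift_assoc, comp_lift, lift_fst, lift_snd_assoc, lift_snd]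
  rfl

theorem PtElt.eval_post {F G H : EnrichedFunctor V (Ordinals A) V} {W : V} (x : PtElt F W)
    (t : W ⟶ mapObj F G) (e : FunctorIso G H) :
    x.eval (t ≫ e.post F) = (x.eval t).map fun d => (e.app d).hom :=
  congrArg (Sigma.mk x.1) ((lift_mapLift _ _ _ _ _).trans (Category.assoc _ _ _).symm)

theorem PtElt.eval_point {F G : EnrichedFunctor V (Ordinals A) V} {W : V} (x : PtElt F W)
    (e : FunctorIso F G) : x.eval (toUnit W ≫ e.point) = x.map fun d => (e.app d).hom :=
  congrArg (Sigma.mk x.1) ((lift_mapLift _ _ _ _ _).trans (lift_fst_assoc _ _ _))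

/-- The Kan extension of the external product of transformations, on generators. -/
theorem eval_convGen {n : ℕ} {F G : Fin n → EnrichedFunctor V (Ordinals A) V} {W : V}
    (x : ∀ i, PtElt (F i) W) (w : OpElt X W) (h : ∑ i, (x i).1.len = w.src)
    (t : ∀ i, W ⟶ mapObj (F i) (G i)) :
    (convGen x w h).eval (Pi.lift t ≫ extProdMap F G ≫
      lanMap (ordinalSum A n) (extProd F) (extProd G)) =
      convGen (fun i => (x i).eval (t i)) w h := by
  obtain ⟨a, c, w⟩ := w
  obtain rfl : ∑ i, (x i).1.len = a := h
  refine (congrArg (PtElt.eval · _) (convGen_mk (G := F) (d := ⟨c⟩) (fun i => (x i).2) w)).trans ?_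
  refine Eq.trans ?_ (convGen_mk (G := G) (U := fun i => (x i).1) (d := ⟨c⟩)
    (fun i => lift (x i).2 (t i) ≫ eval (F i) (G i) (x i).1) w).symm
  refine congrArg (Sigma.mk (⟨c⟩ : Ordinals A)) ?_
  refine (congrArg (fun s => lift _ s ≫ _) (Category.assoc _ _ _).symm).trans ?_
  refine (lift_mapLift _ _ _ _ _).trans ?_
  refine (lift_lanMapApp (ordinalSum A n) (extProd F) (extProd G) _ _ _).trans ?_
  refine congrArg (fun s => lift s w ≫ lanι (ordinalSum A n) (extProd G) _ _) ?_
  refine (lift_mapLift _ _ _ _ _).trans ?_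
  refine (act_ext (fun i => eval (F i) (G i) (x i).1) _ _).trans ?_
  refine congrArg Pi.lift (funext fun i => ?_)
  rw [Pi.lift_π, Pi.lift_π]

theorem mapObj_ext {F G : EnrichedFunctor V (Ordinals A) V} {W : V} {f g : W ⟶ mapObj F G}
    (h : ∀ {W' : V} (s : W' ⟶ W) (x : PtElt F W'), x.eval (s ≫ f) = x.eval (s ≫ g)) : f = g :=
  map_ext fun c => GElt.mk_inj (T := G.obj) (h (snd _ _) ⟨c, fst _ _⟩)

/-- Transformations to powers of equal exponents agree if their values agree. The comparison takes
place among elements that carry the exponent. -/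
theorem mapObj_power_ext {E : EnrichedFunctor V (Ordinals A) V} {n n' : ℕ} (hn : n = n') {W : V}
    {f : W ⟶ mapObj E (power E n)} {g : W ⟶ mapObj E (power E n')}
    (h : ∀ {W' : V} (s : W' ⟶ W) (x : PtElt E W'),
      (x.eval (s ≫ f)).toPow n = (x.eval (s ≫ g)).toPow n') :
    f = g ≫ eqToHom (congrArg (fun n => mapObj E (power E n)) hn.symm) := by
  subst hn
  refine Eq.trans ?_ (Category.comp_id g).symm
  exact mapObj_ext fun s x => PtElt.toPow_inj (h s x)

end Evaluation

/-! ### The operad of transformations to the powers -/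

section PowerOperad

variable [MonoidalClosed V] [HasLimitsOfSize.{0, 0} V] [HasColimitsOfSize.{0, 0} V]
  {X : ℕ → V} {A : Operad X} {E : EnrichedFunctor V (Ordinals A) V}

theorem PtElt.toPow_congr {n : ℕ} {W : V} {y y' : PtElt (power E n) W} (h : y = y') :
    y.toPow n = y'.toPow n :=
  congrArg (PtElt.toPow n) h

theorem PtElt.pre_toPow_eq {n : ℕ} {W W' : V} {s : W' ⟶ W} {y : PtElt (power E n) W}
    {y' : PtElt (power E n) W'} (h : y.pre s = y') : (y.toPow n).pre s = y'.toPow n :=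
  congrArg (PtElt.toPow n) h

theorem nest_toPow_congr {n : ℕ} {k k' : Fin n → ℕ} (hk : ∀ i, k i = k' i) {W : V}
    {y : ∀ i, PtElt (power E (k i)) W} {y' : ∀ i, PtElt (power E (k' i)) W}
    (hy : ∀ i, (y i).toPow (k i) = (y' i).toPow (k' i)) (w : OpElt X W)
    (h : ∑ i, (y i).1.len = w.src) (h' : ∑ i, (y' i).1.len = w.src) :
    (nest y w h).toPow (∑ i, k i) = (nest y' w h').toPow (∑ i, k' i) := by
  obtain rfl := funext hk
  exact congrArg (PtElt.toPow _) (nest_congr (fun i => PtElt.toPow_inj (hy i)) rfl _ _)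

/-- Associativity of the flattening. -/
theorem nest_nest {n : ℕ} {k : Fin n → ℕ} {l : Fin (∑ i, k i) → ℕ} {W : V}
    (y : ∀ p, PtElt (power E (l p)) W) (f : Fin n → OpElt X W)
    (hf : ∀ i, ∑ j, (y (finSigmaFinEquiv ⟨i, j⟩)).1.len = (f i).src) (w : OpElt X W)
    (hw : ∑ i, (f i).tgt = w.src) :
    (nest y (OpElt.comp A (OpElt.sum f) w hw) ((sum_blocks fun p => (y p).1.len).trans
      (Finset.sum_congr rfl fun i _ => hf i))).toPow (∑ p, l p) =
    (nest (fun i => nest (fun j => y (finSigmaFinEquiv ⟨i, j⟩)) (f i) (hf i)) w hw).toPow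
      (∑ i, ∑ j, l (finSigmaFinEquiv ⟨i, j⟩)) := by
  have hs : ∑ p, (y p).1.len = ∑ i, (f i).src := (sum_blocks fun p => (y p).1.len).trans
      (Finset.sum_congr rfl fun i _ => hf i)
  have key := power_induction (E := E) (k := l) (U := fun p => (y p).1) (W := W)
    (T := fun q : ℕ × Ordinals A => (power E q.1).obj q.2)
    (fun t e => (nest (fun p => ⟨(y p).1, e p⟩) (OpElt.comp A (OpElt.sum fun i => (f i).pre t)
      (w.pre t) hw) hs).toPow (∑ p, l p))
    (fun t e => (nest (fun i => nest (fun j => ⟨(y (finSigmaFinEquiv ⟨i, j⟩)).1,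
      e (finSigmaFinEquiv ⟨i, j⟩)⟩) ((f i).pre t) (hf i)) (w.pre t) hw).toPow
        (∑ i, ∑ j, l (finSigmaFinEquiv ⟨i, j⟩)))
    ?_ ?_ (fun _ _ => congrArg (·, _) (sum_blocks l)) ?_ fun i => (y i).2
  · simp only [OpElt.pre_id] at key
    exact key
  · intro W' W'' s t e
    refine PtElt.pre_toPow_eq ((pre_nest _ _ _ hs).trans (nest_congr (fun _ => rfl) ?_ hs hs))
    refine (OpElt.pre_comp A _ _ _ _).trans (OpElt.comp_congr ?_ ?_ _ _)
    · refine (OpElt.pre_sum _ _).trans (congrArg OpElt.sum (funext fun i => ?_))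
      exact congrArg (OpElt.mk _ _) (Category.assoc _ _ _).symm
    · exact congrArg (OpElt.mk _ _) (Category.assoc _ _ _).symm
  · intro W' W'' s t e
    refine PtElt.pre_toPow_eq ((pre_nest _ _ _ hw).trans (nest_congr (fun i => ?_) ?_ hw hw))
    · refine (pre_nest _ _ _ _).trans (nest_congr (fun _ => rfl) ?_ _ _)
      exact congrArg (OpElt.mk _ _) (Category.assoc _ _ _).symm
    · exact congrArg (OpElt.mk _ _) (Category.assoc _ _ _).symm
  · intro W' t e x g hg he
    have hgf : ∀ i, ∑ j, (g (finSigmaFinEquiv ⟨i, j⟩)).tgt = ((f i).pre t).src := fun i =>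
      Eq.trans (Finset.sum_congr rfl fun j _ =>
        (congrArg (fun z : PtElt (power E (l _)) W' => z.1.len) (he _)).symm) (hf i)
    have hgs : ∑ p, (g p).tgt = ∑ i, (f i).src := (sum_blocks fun p => (g p).tgt).trans
      (Finset.sum_congr rfl fun i _ => hgf i)
    have e1 := (nest_congr (w' := OpElt.comp A (OpElt.sum fun i => (f i).pre t) (w.pre t) hw)
      he rfl hs hgs).trans (nest_convGen x g hg _ hgs)
    have e2 := fun i => (nest_congr (w' := (f i).pre t) (fun j => he (finSigmaFinEquiv ⟨i, j⟩)) rfl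
      (hf i) (hgf i)).trans (nest_convGen _ _ (fun j => hg _) _ (hgf i))
    have e3 := (nest_congr (w' := w.pre t) e2 rfl hw hw).trans
      (nest_convGen _ _ (fun i => (ExtendedOperad.sum_pos fun j s =>
        (x (finSigmaFinEquiv ⟨i, j⟩) s).1.len).symm.trans
          (Finset.sum_congr rfl fun j _ => hg (finSigmaFinEquiv ⟨i, j⟩))) _ hw)
    refine (PtElt.toPow_congr e1).trans (Eq.trans ?_ (PtElt.toPow_congr e3).symm)
    refine toPow_convGen_congr (sum_blocks l) (fun s => ?_) ?_ _ _
    · obtain ⟨⟨p, s⟩, rfl⟩ := finSigmaFinEquiv.surjective s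
      obtain ⟨⟨i, j⟩, rfl⟩ := finSigmaFinEquiv.surjective p
      rw [finSigmaFinEquiv_assoc]
      refine (apply_pos x _ s).trans ?_
      refine Eq.trans ?_ (apply_pos (fun i (s : Fin (∑ j, l (finSigmaFinEquiv ⟨i, j⟩))) =>
        x (finSigmaFinEquiv ⟨i, (pos s).1⟩) (pos s).2) i _).symm
      exact (apply_pos (fun j s => x (finSigmaFinEquiv ⟨i, j⟩) s) j s).symm
    · refine (OpElt.comp_assoc A _ _ _ (hgs) hw).symm.trans (OpElt.comp_congr ?_ rfl _ hw)
      refine Eq.trans ?_ (OpElt.sum_comp A (fun i => OpElt.sum fun j =>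
        g (finSigmaFinEquiv ⟨i, j⟩)) _ hgf).symm
      exact OpElt.comp_congr (OpElt.sum_blocks g) rfl _ _

/-- The flattening of a single element, with an identity morphism, is that element. -/
theorem nest_one {m : ℕ} {W : V} (y : PtElt (power E m) W) :
    (nest (fun _ : Fin 1 => y) (OpElt.id A W y.1.len) (Fin.sum_univ_one _)).toPow (∑ _ : Fin 1, m) =
      y.toPow m := by
  have key := power_induction_one (E := E) (n := m) (U := y.1) (W := W)
    (T := fun q : ℕ × Ordinals A => (power E q.1).obj q.2)
    (fun {W'} _ e => (nest (fun _ : Fin 1 => (⟨y.1, e⟩ : PtElt (power E m) W'))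
      (OpElt.id A W' y.1.len) (Fin.sum_univ_one _)).toPow (∑ _ : Fin 1, m))
    (fun {W'} _ e => PtElt.toPow m (⟨y.1, e⟩ : PtElt (power E m) W')) ?_ (fun _ _ _ => rfl)
    (fun _ _ => congrArg (·, _) (Fin.sum_univ_one _)) ?_ y.2
  · exact key
  · intro W' W'' s t e
    exact PtElt.pre_toPow_eq ((pre_nest _ _ _ (Fin.sum_univ_one _)).trans
      (nest_congr (fun _ => rfl) (OpElt.pre_idElt A s _) (Fin.sum_univ_one _)
        (Fin.sum_univ_one _)))
  · intro W' t e x g hg he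
    have hy : g.tgt = y.1.len := congrArg (fun z : PtElt (power E m) W' => z.1.len) he.symm
    have hw : ∑ _ : Fin 1, g.tgt = y.1.len := (Fin.sum_univ_one _).trans hy
    refine (congrArg (PtElt.toPow _) ((nest_congr (fun _ => he) rfl _ hw).trans
      (nest_convGen (fun _ => x) (fun _ => g) (fun _ => hg) _ _))).trans ?_
    refine Eq.trans ?_ (congrArg (PtElt.toPow m) he.symm)
    refine toPow_convGen_congr (Fin.sum_univ_one _) (fun s => congrArg x ?_) ?_ _ _
    · refine eq_cast_of_strictMono (Fin.sum_univ_one _) (strictMono_of_sigma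
        (k := fun _ : Fin 1 => m) (fun q => q.2) (fun i i' _ _ h => ?_) fun _ _ _ h => h) s
      exact absurd (Subsingleton.elim i i') h.ne
    · exact (OpElt.comp_congr (OpElt.sum_one g) rfl _ hy).trans (OpElt.comp_id A g _ hy)

/-- The value at an element of the `n`-th power of the transformation to the power of exponent
`k 0 + ... + k (n - 1)` that is induced by transformations `t i` from `E` to the powers of
exponents `k i`. -/
def bind {n : ℕ} {k : Fin n → ℕ} {W : V} (z : PtElt (power E n) W)
    (t : ∀ i, W ⟶ mapObj E (power E (k i))) : PtElt (power E (∑ i, k i)) W :=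
  (z.eval (Pi.lift t ≫ extProdMap (fun _ : Fin n => E) (fun i => power E (k i)) ≫
    lanMap (ordinalSum A n) (extProd fun _ : Fin n => E) (extProd fun i => power E (k i)))).map
      fun d => ((kappaIso E n k).app d).hom

theorem pre_bind {n : ℕ} {k : Fin n → ℕ} {W W' : V} (s : W' ⟶ W) (z : PtElt (power E n) W)
    (t : ∀ i, W ⟶ mapObj E (power E (k i))) :
    (bind z t).pre s = bind (z.pre s) fun i => s ≫ t i := by
  refine (PtElt.pre_map _ _ _).trans (congrArg (PtElt.map _) ?_)
  refine (PtElt.pre_eval _ _ _).trans (congrArg (PtElt.eval (z.pre s)) ?_)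
  refine (Category.assoc _ _ _).symm.trans (congrArg (· ≫ _) ?_)
  exact pi_lift_comp _ _

theorem bind_congr {n : ℕ} {k : Fin n → ℕ} {W : V} {z z' : PtElt (power E n) W}
    {t t' : ∀ i, W ⟶ mapObj E (power E (k i))} (hz : z = z') (ht : ∀ i, t i = t' i) :
    bind z t = bind z' t' := by
  obtain rfl := funext ht
  subst hz
  rfl

theorem bind_convGen {n : ℕ} {k : Fin n → ℕ} {W : V} (x : Fin n → PtElt E W) (w : OpElt X W)
    (h : ∑ i, (x i).1.len = w.src) (t : ∀ i, W ⟶ mapObj E (power E (k i))) :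
    bind (convGen x w h) t = nest (fun i => (x i).eval (t i)) w h :=
  (congrArg (PtElt.map _) (eval_convGen x w h t)).trans (kappaHom_convGen _ w h)

/-- Induced transformations are compatible with the flattening. -/
theorem bind_nest {n : ℕ} {k : Fin n → ℕ} {l : ∀ i, Fin (k i) → ℕ} {W : V}
    (y : ∀ i, PtElt (power E (k i)) W) (w : OpElt X W) (hw : ∑ i, (y i).1.len = w.src)
    (t : ∀ i j, W ⟶ mapObj E (power E (l i j))) :
    (bind (nest y w hw) fun p : Fin (∑ i, k i) => t (pos p).1 (pos p).2).toPow
      (∑ p : Fin (∑ i, k i), l (pos p).1 (pos p).2) =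
    (nest (fun i => bind (y i) (t i)) w hw).toPow (∑ i, ∑ j, l i j) := by
  have key := power_induction (E := E) (k := k) (U := fun i => (y i).1) (W := W)
    (T := fun q : ℕ × Ordinals A => (power E q.1).obj q.2)
    (fun s e => (bind (nest (fun i => ⟨(y i).1, e i⟩) (w.pre s) hw)
      fun p : Fin (∑ i, k i) => s ≫ t (pos p).1 (pos p).2).toPow
        (∑ p : Fin (∑ i, k i), l (pos p).1 (pos p).2))
    (fun s e => (nest (fun i => bind ⟨(y i).1, e i⟩ fun j => s ≫ t i j) (w.pre s) hw).toPow
      (∑ i, ∑ j, l i j))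
    ?_ ?_ (fun _ _ => congrArg (·, _) (ExtendedOperad.sum_pos l).symm) ?_ fun i => (y i).2
  · simp only [OpElt.pre_id, Category.id_comp] at key
    exact key
  · intro W' W'' r s e
    refine PtElt.pre_toPow_eq ((pre_bind _ _ _).trans
      (bind_congr ?_ fun p => (Category.assoc _ _ _).symm))
    refine (pre_nest r (fun i => ⟨(y i).1, e i⟩) (w.pre s) hw).trans
      (nest_congr (fun _ => rfl) ?_ _ _)
    exact congrArg (OpElt.mk _ _) (Category.assoc _ _ _).symm
  · intro W' W'' r s e
    refine PtElt.pre_toPow_eq ((pre_nest r (fun i => bind ⟨(y i).1, e i⟩ fun j => s ≫ t i j)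
      (w.pre s) hw).trans (nest_congr (y' := fun i => bind ⟨(y i).1, r ≫ e i⟩
        fun j => (r ≫ s) ≫ t i j) (w' := w.pre (r ≫ s)) (fun i => ?_) ?_ _ hw))
    · exact (pre_bind _ _ _).trans (bind_congr rfl fun j => (Category.assoc _ _ _).symm)
    · exact congrArg (OpElt.mk _ _) (Category.assoc _ _ _).symm
  · intro W' s e x g hg he
    have hs : ∑ i, (g i).tgt = (w.pre s).src := Eq.trans (Finset.sum_congr rfl fun i _ =>
      (congrArg (fun z : PtElt (power E (k i)) W' => z.1.len) (he i)).symm) hw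
    have hx : ∀ i, ∑ j, (x (pos (finSigmaFinEquiv ⟨i, j⟩)).1
        (pos (finSigmaFinEquiv ⟨i, j⟩)).2).1.len = (g i).src := fun i =>
      (Finset.sum_congr rfl fun j _ =>
        congrArg (fun z : PtElt E W' => z.1.len) (apply_pos x i j)).trans (hg i)
    have e1 := (nest_congr (w' := w.pre s) he rfl hw hs).trans (nest_convGen x g hg _ hs)
    refine (PtElt.toPow_congr ((bind_congr e1 fun _ => rfl).trans (bind_convGen _ _ _ _))).trans ?_
    refine (nest_nest (fun p : Fin (∑ i, k i) => (x (pos p).1 (pos p).2).eval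
      (s ≫ t (pos p).1 (pos p).2)) g hx (w.pre s) hs).trans ?_
    refine Eq.trans ?_ (PtElt.toPow_congr (nest_congr (w' := w.pre s) (fun i =>
      (bind_congr (he i) fun _ => rfl).trans (bind_convGen (x i) (g i) (hg i) _)) rfl hw hs)).symm
    refine nest_toPow_congr (fun i => Finset.sum_congr rfl fun j _ => apply_pos l i j)
      (fun i => ?_) _ _ _
    exact nest_toPow_congr (fun j => apply_pos l i j) (fun j =>
      apply_pos (fun i j => ((x i j).eval (s ≫ t i j)).toPow (l i j)) i j) _ _ _

variable (E) in
/-- The composition of the operad of transformations to the powers. -/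
def powerComp (n : ℕ) (k : Fin n → ℕ) :
    mapObj E (power E n) ⊗ (∏ᶜ fun i => mapObj E (power E (k i))) ⟶
      mapObj E (power E (∑ i, k i)) :=
  (mapObj E (power E n) ◁ (extProdMap (fun _ : Fin n => E) (fun i => power E (k i)) ≫
    lanMap (ordinalSum A n) (extProd fun _ : Fin n => E) (extProd fun i => power E (k i)))) ≫
    mapComp _ _ _ ≫ (kappaIso E n k).post E

/-- The composite of transformations, on elements. -/
theorem eval_powerComp {n : ℕ} {k : Fin n → ℕ} {W : V} (x : PtElt E W)
    (f : W ⟶ mapObj E (power E n)) (g : ∀ i, W ⟶ mapObj E (power E (k i))) :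
    x.eval (lift f (Pi.lift g) ≫ powerComp E n k) = bind (x.eval f) g := by
  have e : lift f (Pi.lift g) ≫ powerComp E n k = (lift f (Pi.lift g ≫
      extProdMap (fun _ : Fin n => E) (fun i => power E (k i)) ≫
      lanMap (ordinalSum A n) (extProd fun _ : Fin n => E) (extProd fun i => power E (k i))) ≫
      mapComp _ _ _) ≫ (kappaIso E n k).post E :=
    (lift_whiskerLeft_assoc _ _ _ _).trans (Category.assoc _ _ _).symm
  refine (congrArg x.eval e).trans ((PtElt.eval_post _ _ _).trans (congrArg (PtElt.map _) ?_))
  exact PtElt.eval_mapComp _ _ _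

theorem comp_lift_powerComp {n : ℕ} {k : Fin n → ℕ} {W W' : V} (s : W' ⟶ W)
    (f : W ⟶ mapObj E (power E n)) (g : ∀ i, W ⟶ mapObj E (power E (k i))) :
    s ≫ lift f (Pi.lift g) ≫ powerComp E n k =
      lift (s ≫ f) (Pi.lift fun i => s ≫ g i) ≫ powerComp E n k := by
  rw [comp_lift_assoc, pi_lift_comp]

/-- Inducing transformations twice amounts to inducing the composites. -/
theorem bind_bind {n : ℕ} {k : Fin n → ℕ} {l : ∀ i, Fin (k i) → ℕ} {W : V}
    (z : PtElt (power E n) W) (g : ∀ i, W ⟶ mapObj E (power E (k i)))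
    (t : ∀ i j, W ⟶ mapObj E (power E (l i j))) :
    (bind (bind z g) fun p : Fin (∑ i, k i) => t (pos p).1 (pos p).2).toPow
      (∑ p : Fin (∑ i, k i), l (pos p).1 (pos p).2) =
    (bind z fun i => lift (g i) (Pi.lift (t i)) ≫ powerComp E (k i) (l i)).toPow
      (∑ i, ∑ j, l i j) := by
  have key := power_induction_one (E := E) (n := n) (U := z.1) (W := W)
    (T := fun q : ℕ × Ordinals A => (power E q.1).obj q.2)
    (fun s e => (bind (bind ⟨z.1, e⟩ fun i => s ≫ g i)
      fun p : Fin (∑ i, k i) => s ≫ t (pos p).1 (pos p).2).toPow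
        (∑ p : Fin (∑ i, k i), l (pos p).1 (pos p).2))
    (fun s e => (bind ⟨z.1, e⟩ fun i => lift (s ≫ g i) (Pi.lift fun j => s ≫ t i j) ≫
      powerComp E (k i) (l i)).toPow (∑ i, ∑ j, l i j))
    ?_ ?_ (fun _ _ => congrArg (·, _) (ExtendedOperad.sum_pos l).symm) ?_ z.2
  · simp only [Category.id_comp] at key
    exact key
  · intro W' W'' r s e
    refine PtElt.pre_toPow_eq ((pre_bind _ _ _).trans
      (bind_congr ?_ fun p => (Category.assoc _ _ _).symm))
    exact (pre_bind _ _ _).trans (bind_congr rfl fun i => (Category.assoc _ _ _).symm)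
  · intro W' W'' r s e
    refine PtElt.pre_toPow_eq ((pre_bind _ _ _).trans
      (bind_congr rfl fun i => (comp_lift_powerComp _ _ _).trans ?_))
    exact congrArg (· ≫ _) (congrArg₂ lift (Category.assoc _ _ _).symm
      (congrArg Pi.lift (funext fun j => (Category.assoc _ _ _).symm)))
  · intro W' s e x w hw he
    have e1 := (bind_congr he fun _ => rfl).trans (bind_convGen x w hw fun i => s ≫ g i)
    refine (PtElt.toPow_congr (bind_congr e1 fun _ => rfl)).trans ?_
    refine (bind_nest (l := l) _ _ _ fun i j => s ≫ t i j).trans (PtElt.toPow_congr ?_)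
    refine Eq.trans ?_ ((bind_congr he fun _ => rfl).trans (bind_convGen _ _ _ _)).symm
    exact nest_congr (fun i => (eval_powerComp _ _ _).symm) rfl _ _

/-- The canonical map to the first power induces the identity of the powers. -/
theorem bind_unit {n : ℕ} {W : V} (z : PtElt (power E n) W) :
    (bind z fun _ : Fin n => toUnit W ≫ (oneIso E).point).toPow (∑ _ : Fin n, 1) = z.toPow n := by
  have hn : ∑ _ : Fin n, 1 = n := by simp
  have key := power_induction_one (E := E) (n := n) (U := z.1) (W := W)
    (T := fun q : ℕ × Ordinals A => (power E q.1).obj q.2)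
    (fun {W'} _ e => (bind (⟨z.1, e⟩ : PtElt (power E n) W') fun _ : Fin n =>
      toUnit W' ≫ (oneIso E).point).toPow (∑ _ : Fin n, 1))
    (fun {W'} _ e => PtElt.toPow n (⟨z.1, e⟩ : PtElt (power E n) W')) ?_ (fun _ _ _ => rfl)
    (fun _ _ => congrArg (·, _) hn) ?_ z.2
  · exact key
  · intro W' W'' s t e
    exact PtElt.pre_toPow_eq ((pre_bind _ _ _).trans
      (bind_congr rfl fun _ => comp_toUnit_assoc _ _))
  · intro W' t e x w hw he
    have h1 : ∀ i, (x i).eval (toUnit W' ≫ (oneIso E).point) = convGen (fun _ : Fin 1 => x i)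
        (OpElt.id A W' (x i).1.len) (Fin.sum_univ_one _) := fun i =>
      (PtElt.eval_point _ _).trans (map_oneHom _)
    refine (PtElt.toPow_congr ((bind_congr he fun _ => rfl).trans
      ((bind_convGen _ _ _ _).trans ((nest_congr (w' := w) h1 rfl hw hw).trans
        (nest_convGen _ _ _ _ hw))))).trans ?_
    refine Eq.trans ?_ (congrArg (PtElt.toPow n) he.symm)
    refine toPow_convGen_congr hn (fun s => congrArg x ?_) ?_ _ _
    · refine eq_cast_of_strictMono hn (strictMono_of_sigma (k := fun _ : Fin n => 1)
        (fun q => q.1) (fun _ _ _ _ h => h) fun _ j j' h => ?_) s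
      exact absurd (Subsingleton.elim j j') h.ne
    · exact (OpElt.comp_congr (OpElt.sum_id A _) rfl _ hw).trans (OpElt.id_comp A _ _ hw)

variable (E) in
/-- The spaces of transformations from `E` to its powers form an operad. -/
def powerOperad : Operad fun n => mapObj E (power E n) where
  unit := (oneIso E).point
  comp := powerComp E
  unit_comp {W} m f := by
    refine mapObj_power_ext (Fin.sum_univ_one _) fun {W'} s x => ?_
    refine (congrArg (fun t => (x.eval t).toPow _) (comp_lift_powerComp _ _ _)).trans ?_
    refine (congrArg (PtElt.toPow _) (eval_powerComp _ _ _)).trans ?_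
    have e : x.eval (s ≫ toUnit W ≫ (oneIso E).point) = convGen (fun _ : Fin 1 => x)
        (OpElt.id A W' x.1.len) (Fin.sum_univ_one _) :=
      (congrArg x.eval (comp_toUnit_assoc _ _)).trans ((PtElt.eval_point _ _).trans (map_oneHom _))
    refine (congrArg (PtElt.toPow _) ((congrArg (bind · _) e).trans
      (bind_convGen _ _ _ _))).trans ?_
    exact nest_one (x.eval (s ≫ f))
  comp_unit {W} n f := by
    refine mapObj_power_ext (by simp) fun {W'} s x => ?_
    refine (congrArg (fun t => (x.eval t).toPow _) (comp_lift_powerComp _ _ _)).trans ?_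
    refine (congrArg (PtElt.toPow _) (eval_powerComp _ _ _)).trans ?_
    refine (congrArg (fun t => PtElt.toPow _ (bind _ t)) (funext fun _ =>
      comp_toUnit_assoc _ _)).trans ?_
    exact bind_unit _
  assoc {W} n k l f g t := by
    refine (mapObj_power_ext (ExtendedOperad.sum_pos l).symm fun {W'} s x => ?_).trans
      (Category.assoc _ _ _)
    refine (congrArg (fun t => (x.eval t).toPow _) (comp_lift_powerComp _ _ _)).trans ?_
    refine (congrArg (PtElt.toPow _) ((eval_powerComp _ _ _).trans (congrArg (bind · _)
      ((congrArg x.eval (comp_lift_powerComp _ _ _)).trans (eval_powerComp _ _ _))))).trans ?_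
    refine (bind_bind (l := l) _ _ (fun i j => s ≫ t i j)).trans (congrArg (PtElt.toPow _) ?_)
    refine Eq.trans ?_ ((congrArg x.eval (comp_lift_powerComp _ _ _)).trans
      (eval_powerComp _ _ _)).symm
    exact congrArg (bind _) (funext fun i => (comp_lift_powerComp _ _ _).symm)

end PowerOperad

/-! ### Compatibility with the canonical maps -/

section Compatibility

variable [MonoidalClosed V] [HasLimitsOfSize.{0, 0} V] [HasColimitsOfSize.{0, 0} V]
  {X : ℕ → V} {A : Operad X}

/-- The canonical map to the iterated Kan extension represents the splitting into blocks of the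
universal generator. -/
theorem iteratedι_kappaIso (Δ : SimplexCategory ⥤ V) {n : ℕ} (k : Fin n → ℕ)
    (U : Fin (∑ j, k j) → Ordinals A) (d : Ordinals A) :
    iteratedι Δ A U d ≫ ((kappaIso (extED Δ A) n k).app d).hom =
      lanι (ordinalSum A (∑ j, k j)) (extProd fun _ => extED Δ A) U d := by
  apply GElt.mk_inj (T := (power (extED Δ A) (∑ j, k j)).obj)
  let W : V := (∏ᶜ fun p => (extED Δ A).obj (U p)) ⊗ ((ordinalSum A (∑ j, k j)).obj U ⟶[V] d)
  let x : Fin (∑ j, k j) → PtElt (extED Δ A) W := fun p =>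
    ⟨U p, fst _ _ ≫ Pi.π (fun p => (extED Δ A).obj (U p)) p⟩
  let w : OpElt X W := ⟨∑ p, (U p).len, d.len, snd _ _⟩
  have h1 : (⟨d, lanι (ordinalSum A (∑ j, k j)) (extProd fun _ => extED Δ A) U d⟩ :
      PtElt (power (extED Δ A) (∑ j, k j)) W) = convGen x w rfl := by
    refine Eq.trans ?_ (convGen_mk _ (snd _ _)).symm
    refine congrArg (Sigma.mk d) ?_
    refine ((congrArg (· ≫ lanι (ordinalSum A (∑ j, k j)) (extProd fun _ => extED Δ A) U d)
      ((congrArg (lift · (snd _ _)) (piLift_comp_π (fst _ _))).trans lift_fst_snd)).trans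
      (Category.id_comp _)).symm
  -- the two coherence morphisms in `iteratedι` are identities, once the ordinals are remembered
  have h2 : (⟨d, iteratedι Δ A U d⟩ : PtElt (lan (ordinalSum A n)
      (extProd fun i => power (extED Δ A) (k i))) W) = splitGen x w rfl := by
    refine Eq.trans ?_ (convGen_congr (x := fun i => ⟨blockSum A U i, (fst _ _ ≫ blockMap Δ A U) ≫
      Pi.π (fun i => (power (extED Δ A) (k i)).obj (blockSum A U i)) i⟩)
      (g := ⟨∑ i, (blockSum A U i).len, d.len, lift (toUnit _ ≫ idOf (ordinalSum_blockSum A U).symm)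
        (snd _ _) ≫ eComp V _ _ d⟩) (fun i => ?_) ?_ rfl _)
    · refine Eq.trans ?_ (convGen_mk _ _).symm
      refine congrArg (Sigma.mk d) ?_
      exact congrArg (lift · _ ≫ _) (piLift_comp_π _).symm
    · refine Eq.trans ?_ ((convGen_mk (d := blockSum A U i) _ (toUnit _ ≫ eId V _)).symm)
      refine congrArg (Sigma.mk (blockSum A U i)) ?_
      refine (Category.assoc _ _ _).trans ((congrArg (fst _ _ ≫ ·) (Pi.lift_π _ _)).trans ?_)
      refine (comp_lift_assoc _ _ _ _).trans (congrArg (· ≫ _) (congrArg₂ lift ?_ ?_))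
      · exact pi_lift_comp _ _
      · exact comp_toUnit_assoc _ _
    · refine (OpElt.comp_eq A (OpElt.idOf_eq (ordinalSum_blockSum A U).symm).symm rfl
        rfl).symm.trans
        (OpElt.id_comp A w _ rfl)
  refine (congrArg (PtElt.map _) h2).trans ((nest_splitGen x w rfl).trans h1.symm)

end Compatibility

end

end ExtendedOperad

open ExtendedOperad

theorem mainTheorem5 (P : ObjectProperty TopCat.{u}) [CartesianMonoidalCategory P.FullSubcategory]
    [MonoidalClosed P.FullSubcategory] [HasLimits P.FullSubcategory]
    [HasColimits P.FullSubcategory] (hP : ∀ n, P (SimplexCategory.toTop.{u}.obj n))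
    (X : ℕ → P.FullSubcategory) (A : Operad X) :
    ∃ (i : FunctorIso (extED (simplices P hP) A) (eps (simplices P hP) A 1))
      (κ : ∀ (n : ℕ) (k : Fin n → ℕ), FunctorIso
        (lan (ordinalSum A n) (extProd fun j => eps (simplices P hP) A (k j)))
        (eps (simplices P hP) A (∑ j, k j))),
      (∀ c, (i.app c).hom = epsOne (simplices P hP) A c) ∧
      (∀ (n : ℕ) (k : Fin n → ℕ) (U : Fin (∑ j, k j) → Ordinals A) (d : Ordinals A),
        iteratedι (simplices P hP) A U d ≫ ((κ n k).app d).hom =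
          lanι (ordinalSum A (∑ j, k j)) (extProd fun _ => extED (simplices P hP) A) U d) ∧
      ∃ O : Operad (extSpace (simplices P hP) A),
        O.unit = i.point ∧
        ∀ (n : ℕ) (k : Fin n → ℕ), O.comp n k =
          (extSpace (simplices P hP) A n ◁ lanProdMap (simplices P hP) A n k) ≫
            mapComp _ _ _ ≫ (κ n k).post _ := by
  exact ⟨oneIso (extED (simplices P hP) A), kappaIso (extED (simplices P hP) A), fun _ => rfl,
    fun _ k U d => iteratedι_kappaIso (simplices P hP) k U d,
    powerOperad (extED (simplices P hP) A), rfl, fun _ _ => rfl⟩
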